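/- **Game.** There are $K$ arms and $M$ players, $1\le M\le K$, and a horizon $T$. The quality $X_k(t)\in[0,1]$ of arm $k$ in round $t$ is drawn i.i.d. over rounds, independently over arms, from a law $\nu_k$ with mean $\mu_k$. The means are positive and pairwise distinct, $\mu_{(1)}>\dots>\mu_{(K)}>0$. In each round $t\in\{1,\dots,T\}$ all players simultaneously pull arms $\pi^j(t)$ and player $j$ gets $r^j(t)=X_{\pi^j(t)}(t)\,(1-\eta_{\pi^j(t)}(t))$, where $\eta_k(t)$ indicates that at least two players pull $k$. Player $j$ observes $X_{\pi^j(t)}(t)$ and $r^j(t)$ (statistic sensing). A strategy picks the next arm as a measurable function of the player's own past observations and private independent randomness; $\mathcal S$ is the set of strategies, $\mathrm{Rew}_T^j(s)=\sum_{t\le T}r^j(t)$ under the profile $s\in\mathcal S^M$, and $(s',s_{-j})$ is $s$ with $s_j$ replaced by $s'$. The profile $s$ is an *$\varepsilon$-Nash equilibrium* if $\mathbb E[\mathrm{Rew}^j_T(s',s_{-j})]\le\mathbb E[\mathrm{Rew}^j_T(s)]+\varepsilon$ for all $s'\in\mathcal S$ and all $j$. It is *$(\alpha,\varepsilon)$-stable*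 if for all $s'\in\mathcal S$, $l\ge0$ and players $i,j$, $\mathbb E[\mathrm{Rew}^i_T(s',s_{-j})]\le\mathbb E[\mathrm{Rew}^i_T(s)]-l$ implies $\mathbb E[\mathrm{Rew}^j_T(s',s_{-j})]\le\mathbb E[\mathrm{Rew}^j_T(s)]+\varepsilon-\alpha l$. The deviating strategy $s'$ may depend on all parameters $K,M,T,(\nu_k)_k$ (omniscient selfish player). **Algorithm Selfish-Robust MMAB** (input $K,T$, not $M$). Let $\beta=39$, $\gamma_1=\frac{13}{14}$, $\gamma_2=\frac{16}{15}$, $n=\beta^2K^2\log T$. 1. Pull arms uniformly at random in $[K]$ until, at some round $t_m$, every arm $k$ has been pulled at least $n$ times with $X_k>0$. Let $\hat p_k$ be the proportion of these pulls of $k$ with a collision, and let $\widehat M$ be $1+\frac{\log(1-\frac1K\sum_k\hat p_k)}{\log(1-1/K)}$, the fraction being rounded to the closest integer and the result capped at $K$. Pull uniformly in $[K]$ until round $\frac{\gamma_2}{\gamma_1}t_m$. 2. During the next $\frac{t_m\log T}{\gamma_1 n}$ rounds, pull uniformly in $[\widehat M]$ until the first positive reward; the arm $j$ then pulled is the player's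 rank, and she pulls $j$ until round $\big(\frac{\gamma_2}{\gamma_1^2\beta^2K^2}+\frac{\gamma_2^2}{\gamma_1^2}\big)t_m$. (A player left without a rank acts as if she had rank $1$.) 3. From then on, with rank $j$: let $T_k(t)$ and $\hat\mu_k(t)$ be the player's number of pulls and empirical mean of arm $k$ before round $t$, and $b_k(t)=\sup\{q\in[0,1]: T_k(t)\,\mathrm{kl}(\hat\mu_k(t),q)\le \log t+4\log\log t\}$, where $\mathrm{kl}(p,q)$ is the Kullback–Leibler divergence between Bernoulli laws of means $p,q$. These statistics are refreshed only at rounds that are multiples of $\widehat M$. Let $l_1<\dots<l_{\widehat M}$ be the $\widehat M$ empirically best arms and $\widehat m$ the $\widehat M$-th best one (ties broken by index). In round $t$ let $l=l_\pi$ with $\pi=(t+j \bmod \widehat M)+1$. If $l\ne\widehat m$, pull $l$. Otherwise let $\mathcal B$ be the set of arms $k\notin\{l_1,\dots,l_{\widehat M}\}$ with $b_k\ge\hat\mu_{\widehat m}$; pull $l$ if $\mathcal B=\emptyset$, and else pull $l$ with probability $\frac12$ and a uniformly random arm of $\mathcal B$ with probability $\frac12$. **Theorem.** There is a universal constant $C>0$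 such that for all $K$, $M$ and means $(\mu_k)_k$ as above there is $T_0$ such that, for all laws $(\nu_k)_k$ on $[0,1]$ with these means and all $T\ge T_0$, the profile in which all $M$ players play Selfish-Robust MMAB with horizon $T$ is an $\varepsilon$-Nash equilibrium and is $(\alpha,\varepsilon)$-stable, with $$\varepsilon=\sum_{k>M}\frac{\mu_{(M)}-\mu_{(k)}}{\mathrm{kl}(\mu_{(k)},\mu_{(M)})}\log T+C\,\frac{\mu_{(1)}}{\mu_{(K)}}K^3\log T,\qquad \alpha=\frac{\mu_{(M)}}{\mu_{(1)}}$$ (a summand with $\mathrm{kl}(\mu_{(k)},\mu_{(M)})=+\infty$ is $0$). -/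

import Mathlib

open MeasureTheory

noncomputable section

namespace MPBandit

variable {K M : ℕ}

/-! ## The game -/

/-- What a player sees at the end of a round under statistic sensing: the arm `π` she pulled, the
quality `X_π` of that arm, and her reward `r = X_π (1 - η_π)`. -/
abbrev Obs (K : ℕ) : Type := Fin K × unitInterval × unitInterval

/-- A strategy: the arm pulled in round `t + 1` is a measurable function of the player's own
observations in the `t` previous rounds and of her private randomness (one independent uniform
seed per round). -/
structure Strategy (K : ℕ) where
  act : (t : ℕ) → (Fin t → Obs K) → (Fin (t + 1) → unitInterval) → Fin K
  measurable_act : ∀ t, Measurable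
    fun x : (Fin t → Obs K) × (Fin (t + 1) → unitInterval) => act t x.1 x.2

/-- The randomness of one round: the arm qualities `X_k` and the private seeds of the players. -/
abbrev Draw (K M : ℕ) : Type := (Fin K → unitInterval) × (Fin M → unitInterval)

/-- The law of all the randomness: rounds are i.i.d., and within a round all `X_k ∼ ν k` and all
seeds (uniform on `[0,1]`) are independent. -/
def gameLaw (ν : Fin K → ProbabilityMeasure unitInterval) (M : ℕ) : Measure (ℕ → Draw K M) :=
  Measure.infinitePi fun _ : ℕ =>
    (Measure.pi fun k => (ν k : Measure unitInterval)).prod (Measure.pi fun _ : Fin M => volume)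

/-- The collision indicator `η_k`: at least two players pull `k`. -/
def Collision (π : Fin M → Fin K) (k : Fin K) : Prop :=
  1 < (Finset.univ.filter fun j => π j = k).card

instance (π : Fin M → Fin K) (k : Fin K) : Decidable (Collision π k) :=
  inferInstanceAs (Decidable (1 < _))

/-- The reward of player `j` when the qualities are `x` and the pulled arms are `π`. -/
def reward (x : Fin K → unitInterval) (π : Fin M → Fin K) (j : Fin M) : unitInterval :=
  if Collision π (π j) then 0 else x (π j)

/-- The observation of player `j`. -/
def observe (x : Fin K → unitInterval) (π : Fin M → Fin K) (j : Fin M) : Obs K :=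
  (π j, x (π j), reward x π j)

/-- The arms pulled in round `t + 1` when the profile `s` is played. -/
def actions (s : Fin M → Strategy K) (ω : ℕ → Draw K M) : ℕ → Fin M → Fin K
  | t => fun j => (s j).act t
      (fun i : Fin t => observe (ω i.val).1 (actions s ω i.val) j)
      (fun i : Fin (t + 1) => (ω i.val).2 j)
termination_by t => t
decreasing_by exact i.isLt

/-- `𝔼[Rew_T^j(s)]`, the expected cumulative reward of player `j` over `T` rounds. -/
def expReward (ν : Fin K → ProbabilityMeasure unitInterval) (T : ℕ) (s : Fin M → Strategy K)
    (j : Fin M) : ℝ :=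
  ∫ ω, ∑ t ∈ Finset.range T, (reward (ω t).1 (actions s ω t) j : ℝ) ∂(gameLaw ν M)

/-- `s` is an `ε`-Nash equilibrium of the `T`-round game. -/
def IsNash (ν : Fin K → ProbabilityMeasure unitInterval) (T : ℕ) (ε : ℝ)
    (s : Fin M → Strategy K) : Prop :=
  ∀ (s' : Strategy K) (j : Fin M),
    expReward ν T (Function.update s j s') j ≤ expReward ν T s j + ε

/-- `s` is `(α, ε)`-stable in the `T`-round game. -/
def IsStable (ν : Fin K → ProbabilityMeasure unitInterval) (T : ℕ) (α ε : ℝ)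
    (s : Fin M → Strategy K) : Prop :=
  ∀ (s' : Strategy K) (l : ℝ), 0 ≤ l → ∀ i j : Fin M,
    expReward ν T (Function.update s j s') i ≤ expReward ν T s i - l →
      expReward ν T (Function.update s j s') j ≤ expReward ν T s j + ε - α * l

/-! ## Means and Kullback-Leibler divergence -/

/-- The means in decreasing order: `sortedMean μ i` is `μ_(i+1)`. -/
def sortedMean (μ : Fin K → ℝ) (i : Fin K) : ℝ := μ (Tuple.sort (fun k => -μ k) i)

/-- The Kullback-Leibler divergence between Bernoulli laws of means `p` and `q`, for
`p, q ∈ [0,1]`. -/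
def kl (p q : ℝ) : ENNReal :=
  if (q = 0 ∧ p ≠ 0) ∨ (q = 1 ∧ p ≠ 1) then ⊤
  else ENNReal.ofReal (p * Real.log (p / q) + (1 - p) * Real.log ((1 - p) / (1 - q)))

/-- The kl-UCB index `sup {q | n kl(p, q) ≤ f(t)}`, `f(t) = log t + 4 log log t`, of an arm with
`n` pulls and empirical mean `p` at round `t`. -/
def klIndex (n : ℕ) (p : ℝ) (t : ℕ) : ℝ :=
  sSup {q : ℝ | 0 ≤ q ∧ q ≤ 1 ∧
    ((n * kl p q : ENNReal) : EReal) ≤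
      ((Real.log t + 4 * Real.log (Real.log t) : ℝ) : EReal)}

/-! ## Randomized choices of an arm -/

/-- A randomized choice of an arm: uniform in `S`, or `a` with probability `1/2` and otherwise
uniform in `B`. -/
inductive Choice (K : ℕ) : Type where
  | uniform (S : Finset (Fin K)) : Choice K
  | half (a : Fin K) (B : Finset (Fin K)) : Choice K

instance : MeasurableSpace (Choice K) := ⊤
instance : DiscreteMeasurableSpace (Choice K) := ⟨fun _ => trivial⟩

/-- Pull the arm `a` for sure. -/
def Choice.pull (a : Fin K) : Choice K := .uniform {a}

variable [NeZero K]

/-- For `u` uniform in `[0,1]`, a uniform element of the nonempty set `S`. -/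
def pick (S : Finset (Fin K)) (u : ℝ) : Fin K := (S.sort (· ≤ ·)).getD ⌊u * S.card⌋₊ 0

/-- Realize a randomized choice with a seed `u` uniform in `[0,1]`. -/
def Choice.draw : Choice K → ℝ → Fin K
  | .uniform S, u => pick S u
  | .half a B, u => if u < 1 / 2 then a else pick B (2 * u - 1)

/-! ## The algorithm: initialization -/

def β : ℝ := 39
def γ₁ : ℝ := 13 / 14
def γ₂ : ℝ := 16 / 15

/-- The information used in the initialization: the pulled arm, whether `X > 0`, and whether
`r > 0`. When `X > 0`, there is a collision exactly when `r > 0` fails. -/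
abbrev Signal (K : ℕ) : Type := Fin K × Bool × Bool

def signal (o : Obs K) : Signal K := (o.1, decide (0 < o.2.1), decide (0 < o.2.2))

section Init

variable {t : ℕ}

/-- `|N_k(m)|`: the number of rounds up to round `m` in which arm `k` was pulled with `X > 0`. -/
def sensedCount (g : Fin t → Signal K) (k : Fin K) (m : ℕ) : ℕ :=
  (Finset.univ.filter fun i : Fin t =>
    i.val < m ∧ (g i).1 = k ∧ (g i).2.1 = true).card

/-- `|C_k(m)|`: the number of those rounds with a collision. -/
def collisionCount (g : Fin t → Signal K) (k : Fin K) (m : ℕ) : ℕ :=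
  (Finset.univ.filter fun i : Fin t =>
    i.val < m ∧ (g i).1 = k ∧ (g i).2.1 = true ∧ (g i).2.2 = false).card

/-- The number `n = β² K² log T` of observations required on each arm. -/
def obsTarget (K T : ℕ) : ℝ := β ^ 2 * (K : ℝ) ^ 2 * Real.log T

/-- The stopping criterion of the estimation of `M` holds after round `m`. -/
def EstimDone (T : ℕ) (g : Fin t → Signal K) (m : ℕ) : Prop :=
  ∀ k : Fin K, obsTarget K T ≤ sensedCount g k m

/-- The duration `t_m` of the estimation of `M` (meaningful once it is finished). -/
def estimTime (T : ℕ) (g : Fin t → Signal K) : ℕ := sInf {m | EstimDone T g m}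

/-- The average over the arms of the empirical collision probabilities at time `t_m`. -/
def avgCollision (T : ℕ) (g : Fin t → Signal K) : ℝ :=
  (1 / (K : ℝ)) * ∑ k : Fin K,
    (collisionCount g k (estimTime T g) : ℝ) / (sensedCount g k (estimTime T g) : ℝ)

/-- The estimate of the number of players,
`1 + round (log (1 - p̂) / log (1 - 1/K))` with `p̂` the averaged collision probability, capped at
`K` (this is also its value in the limit case `p̂ = 1`, where the formula gives `+∞`). -/
def estimM (T : ℕ) (g : Fin t → Signal K) : ℕ :=
  if avgCollision T g = 1 then K
  else min K
    (1 + (round (Real.log (1 - avgCollision T g) / Real.log (1 - 1 / (K : ℝ)))).toNat)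

/-- End of the first waiting room. -/
def waitEnd (tm : ℕ) : ℝ := γ₂ / γ₁ * tm

/-- End of the attribution of ranks. -/
def rankEnd (K T tm : ℕ) : ℝ := waitEnd tm + tm * Real.log T / (γ₁ * obsTarget K T)

/-- End of the second waiting room. -/
def initEnd (K tm : ℕ) : ℝ :=
  (γ₂ / (γ₁ ^ 2 * β ^ 2 * (K : ℝ) ^ 2) + γ₂ ^ 2 / γ₁ ^ 2) * tm

/-- The rounds of the attribution of ranks with a positive reward. Entry `i` is round `i + 1`. -/
def rankWins (T : ℕ) (g : Fin t → Signal K) : Finset (Fin t) :=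
  Finset.univ.filter fun i =>
    waitEnd (estimTime T g) < (i.val : ℝ) + 1 ∧
    (i.val : ℝ) + 1 ≤ rankEnd K T (estimTime T g) ∧ (g i).2.2 = true

/-- The rank: the arm pulled at the first positive reward, if there has been any. The arm with
index `a : Fin K` stands for the rank `a + 1`. -/
def rank (T : ℕ) (g : Fin t → Signal K) : Option (Fin K) :=
  if h : (rankWins T g).Nonempty then some (g ((rankWins T g).min' h)).1 else none

/-- The choice in round `t + 1` if the initialization is still running, and otherwise the
estimated number of players and the rank, with which the second phase is run. A player without a
rank after the attribution of ranks acts as if she had the first one. -/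
def initStep (T : ℕ) (g : Fin t → Signal K) : Choice K ⊕ (ℕ × Fin K) :=
  haveI := Classical.dec (EstimDone T g t)
  if EstimDone T g t then
    if (t : ℝ) + 1 ≤ waitEnd (estimTime T g) then .inl (.uniform Finset.univ)
    else if (t : ℝ) + 1 ≤ rankEnd K T (estimTime T g) then
      match rank T g with
      | none => .inl (.uniform (Finset.univ.filter fun k => k.val < estimM T g))
      | some a => .inl (.pull a)
    else if (t : ℝ) + 1 ≤ initEnd K (estimTime T g) then .inl (.pull ((rank T g).getD 0))
    else .inr (estimM T g, (rank T g).getD 0)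
  else .inl (.uniform Finset.univ)

end Init

/-! ## The algorithm: exploration and exploitation -/

section Explo

variable {t : ℕ}

/-- The number of pulls of `k` before round `u`. Entry `i` is round `i + 1`. -/
def pullCount (h : Fin t → Obs K) (u : ℕ) (k : Fin K) : ℕ :=
  (Finset.univ.filter fun i : Fin t => i.val + 1 < u ∧ (h i).1 = k).card

/-- The empirical mean of arm `k` before round `u`. -/
def empMean (h : Fin t → Obs K) (u : ℕ) (k : Fin K) : ℝ :=
  (∑ i : Fin t, if i.val + 1 < u ∧ (h i).1 = k then ((h i).2.1 : ℝ) else 0) / pullCount h u k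

/-- The number of arms with a larger empirical mean than `k` (ties are broken by the index), so
that `k` is the empirical `(place + 1)`-th best arm. -/
def place (m : Fin K → ℝ) (k : Fin K) : ℕ :=
  (Finset.univ.filter fun l => m k < m l ∨ (m l = m k ∧ l < k)).card

/-- The set of the empirical `Mh` best arms. -/
def topArms (Mh : ℕ) (m : Fin K → ℝ) : Finset (Fin K) :=
  Finset.univ.filter fun k => place m k < Mh

/-- The choice in round `τ` of a player with estimate `Mh` of the number of players and rank
`a + 1`, given the empirical means `m` and the indices `b`. The `Mh` best arms are listed by
increasing index; `l` is the arm of the list at (0-based) position `τ + (a + 1) mod Mh`. -/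
def exploChoice (Mh : ℕ) (a : Fin K) (τ : ℕ) (m b : Fin K → ℝ) : Choice K :=
  let l := ((topArms Mh m).sort (· ≤ ·)).getD ((τ + (a.val + 1)) % Mh) 0
  let B := Finset.univ.filter fun k => k ∉ topArms Mh m ∧ m l ≤ b k
  if place m l + 1 ≠ Mh then .pull l
  else if B = ∅ then .pull l
  else .half l B

/-- The last round `u ≤ τ` that is a multiple of `Mh`: statistics are updated only then. -/
def lastUpdate (Mh τ : ℕ) : ℕ := Mh * (τ / Mh)

/-- The choice in round `t + 1` of the second phase, run with estimate `Mh` and rank `a + 1`. -/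
def exploStep (Mh : ℕ) (a : Fin K) (h : Fin t → Obs K) : Choice K :=
  exploChoice Mh a (t + 1) (empMean h (lastUpdate Mh (t + 1)))
    (fun k => klIndex (pullCount h (lastUpdate Mh (t + 1)) k)
      (empMean h (lastUpdate Mh (t + 1)) k) (lastUpdate Mh (t + 1)))

/-- The choice of the algorithm with horizon `T` in round `t + 1`, given the observations `h` of
the previous rounds. -/
def choice (T : ℕ) (h : Fin t → Obs K) : Choice K :=
  match initStep T (fun i => signal (h i)) with
  | .inl c => c
  | .inr (Mh, a) => exploStep Mh a h

end Explo

end MPBandit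

namespace MPBandit
open Set
variable {K M : ℕ}

/-! ## Measurability of the algorithm -/

theorem measurable_kl (q : ℝ) : Measurable fun p : ℝ => kl p q := by
  unfold kl
  refine Measurable.ite ?_ measurable_const (by fun_prop)
  have h0 : MeasurableSet {p : ℝ | p ≠ 0} := (measurableSet_singleton 0).compl
  have h1 : MeasurableSet {p : ℝ | p ≠ 1} := (measurableSet_singleton 1).compl
  exact ((MeasurableSet.const _).inter h0).union ((MeasurableSet.const _).inter h1)

theorem continuousOn_kl (p : ℝ) : ContinuousOn (fun q : ℝ => kl p q) (Ioo 0 1) := by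
  have : ContinuousOn (fun q : ℝ => ENNReal.ofReal
      (p * Real.log (p / q) + (1 - p) * Real.log ((1 - p) / (1 - q)))) (Ioo 0 1) := by
    refine ENNReal.continuous_ofReal.comp_continuousOn ?_
    have hq : ∀ q ∈ Ioo (0 : ℝ) 1, q ≠ 0 := fun q hq => hq.1.ne'
    have hq' : ∀ q ∈ Ioo (0 : ℝ) 1, 1 - q ≠ 0 := fun q hq => (sub_pos.2 hq.2).ne'
    refine ContinuousOn.add ?_ ?_
    · rcases eq_or_ne p 0 with rfl | hp
      · simp only [zero_mul]; exact continuousOn_const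
      · exact continuousOn_const.mul ((continuousOn_const.div continuousOn_id hq).log
          fun q h => div_ne_zero hp (hq q h))
    · rcases eq_or_ne (1 - p) 0 with hp | hp
      · simp only [hp, zero_mul]; exact continuousOn_const
      · exact continuousOn_const.mul ((continuousOn_const.div
          (continuousOn_const.sub continuousOn_id) hq').log
          fun q h => div_ne_zero hp (hq' q h))
  refine this.congr fun q h => ?_
  simp [kl, h.1.ne', h.2.ne]

theorem measurable_klIndex (n t : ℕ) : Measurable fun p : ℝ => klIndex n p t := by
  set c : EReal := ((Real.log t + 4 * Real.log (Real.log t) : ℝ) : EReal) with hc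
  set G : ℝ → ℝ → EReal := fun p q => ((n * kl p q : ENNReal) : EReal) with hG
  have hGm : ∀ q, Measurable fun p => G p q := fun q =>
    ((measurable_kl q).const_mul _).coe_ereal_ennreal
  have hGc : ∀ p, ContinuousOn (G p) (Ioo 0 1) := fun p => by
    refine continuous_coe_ennreal_ereal.comp_continuousOn ?_
    exact (ENNReal.continuous_const_mul (ENNReal.natCast_ne_top n)).comp_continuousOn
      (continuousOn_kl p)
  have hbdd : ∀ p, BddAbove {q : ℝ | 0 ≤ q ∧ q ≤ 1 ∧ G p q ≤ c} :=
    fun p => ⟨1, fun q hq => hq.2.1⟩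
  refine measurable_of_Ioi fun a => ?_
  rcases lt_or_ge a 0 with ha | ha
  · convert MeasurableSet.univ
    refine eq_univ_of_forall fun p => ?_
    exact ha.trans_le (Real.sSup_nonneg fun q hq => hq.1)
  have key : (fun p => klIndex n p t) ⁻¹' Ioi a =
      {p | a < 1 ∧ G p 1 ≤ c} ∪ ⋃ r : ℚ, ⋃ s : ℚ,
        {p | (a < r ∧ r < s ∧ (s : ℝ) < 1) ∧
          ∀ d : ℚ, c < ((d : ℝ) : EReal) → ∃ q : ℚ, (r ≤ q ∧ q ≤ s) ∧ G p q < ((d : ℝ) : EReal)} := by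
    ext p
    simp only [mem_preimage, mem_Ioi, mem_union, mem_ofPred_eq, mem_iUnion]
    constructor
    · intro h
      have hne : {q : ℝ | 0 ≤ q ∧ q ≤ 1 ∧ G p q ≤ c}.Nonempty := by
        by_contra hne
        rw [not_nonempty_iff_eq_empty] at hne
        have : klIndex n p t = 0 := by
          have : klIndex n p t = sSup {q : ℝ | 0 ≤ q ∧ q ≤ 1 ∧ G p q ≤ c} := rfl
          rw [this, hne, Real.sSup_empty]
        linarith
      obtain ⟨q, ⟨hq0, hq1, hq⟩, haq⟩ := exists_lt_of_lt_csSup hne h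
      rcases hq1.eq_or_lt with rfl | hq1
      · exact Or.inl ⟨haq, hq⟩
      right
      obtain ⟨r, har, hrq⟩ := exists_rat_btwn haq
      obtain ⟨s, hqs, hs1⟩ := exists_rat_btwn hq1
      refine ⟨r, s, ⟨har, by exact_mod_cast hrq.trans hqs, hs1⟩, fun d hd => ?_⟩
      have hcont : ContinuousAt (G p) q :=
        (hGc p).continuousAt (Ioo_mem_nhds (ha.trans_lt haq) hq1)
      have h1 : ∀ᶠ x in nhds q, G p x < ((d : ℝ) : EReal) :=
        hcont.eventually_lt continuousAt_const (hq.trans_lt hd)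
      have h2 : ∀ᶠ x in nhds q, x ∈ Ioo (r : ℝ) s := Ioo_mem_nhds hrq hqs
      obtain ⟨ε, hε, hb⟩ := Metric.eventually_nhds_iff.1 (h1.and h2)
      obtain ⟨x, hx1, hx2⟩ := exists_rat_btwn (show q < q + ε by linarith)
      have := hb (y := (x : ℝ)) (by
        rw [Real.dist_eq, abs_of_pos (by linarith)]; linarith)
      exact ⟨x, ⟨by exact_mod_cast this.2.1.le, by exact_mod_cast this.2.2.le⟩, this.1⟩
    · rintro (⟨h1, h2⟩ | ⟨r, s, ⟨har, hrs, hs1⟩, h⟩)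
      · exact h1.trans_le (le_csSup (hbdd p) ⟨zero_le_one, le_rfl, h2⟩)
      · have hrs' : (r : ℝ) ≤ s := by exact_mod_cast hrs.le
        have hsub : Icc (r : ℝ) s ⊆ Ioo 0 1 := fun x hx =>
          ⟨ha.trans_lt (har.trans_le hx.1), hx.2.trans_lt hs1⟩
        obtain ⟨x, hx, hmin⟩ := isCompact_Icc.exists_isMinOn (nonempty_Icc.2 hrs')
          ((hGc p).mono hsub)
        have hxc : G p x ≤ c := by
          by_contra hlt
          rw [not_le] at hlt
          obtain ⟨d, hd1, hd2⟩ := EReal.exists_rat_btwn_of_lt hlt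
          obtain ⟨q, ⟨hq1, hq2⟩, hq⟩ := h d hd1
          have hq' : (q : ℝ) ∈ Icc (r : ℝ) s := ⟨by exact_mod_cast hq1, by exact_mod_cast hq2⟩
          exact absurd ((hmin hq').trans_lt hq) (not_lt.2 hd2.le)
        have hx' := hsub hx
        exact (har.trans_le hx.1).trans_le
          (le_csSup (hbdd p) ⟨hx'.1.le, hx'.2.le, hxc⟩)
  rw [key]
  refine MeasurableSet.union ?_ (MeasurableSet.iUnion fun r => MeasurableSet.iUnion fun s => ?_)
  · exact (MeasurableSet.const _).inter (measurableSet_le (hGm 1) measurable_const)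
  · refine (MeasurableSet.const _).inter ?_
    have : {p : ℝ | ∀ d : ℚ, c < ((d : ℝ) : EReal) →
        ∃ q : ℚ, (r ≤ q ∧ q ≤ s) ∧ G p q < ((d : ℝ) : EReal)} =
        ⋂ d : ℚ, ⋂ _ : c < ((d : ℝ) : EReal), ⋃ q : ℚ,
          {p | (r ≤ q ∧ q ≤ s) ∧ G p q < ((d : ℝ) : EReal)} := by
      ext p; simp
    change MeasurableSet {p : ℝ | ∀ d : ℚ, c < ((d : ℝ) : EReal) →
        ∃ q : ℚ, (r ≤ q ∧ q ≤ s) ∧ G p q < ((d : ℝ) : EReal)}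
    rw [this]
    refine MeasurableSet.iInter fun d => MeasurableSet.iInter fun _ => MeasurableSet.iUnion
      fun q => (MeasurableSet.const _).inter (measurableSet_lt (hGm q) measurable_const)

theorem measurable_signal : Measurable (signal : Obs K → Signal K) := by
  unfold signal
  refine measurable_fst.prodMk (Measurable.prodMk ?_ ?_)
  · refine measurable_to_bool ?_
    have : (fun o : Obs K => decide (0 < o.2.1)) ⁻¹' {true} = {o | 0 < o.2.1} := by ext; simp
    rw [this]
    exact measurableSet_lt measurable_const (by fun_prop)
  · refine measurable_to_bool ?_
    have : (fun o : Obs K => decide (0 < o.2.2)) ⁻¹' {true} = {o | 0 < o.2.2} := by ext; simp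
    rw [this]
    exact measurableSet_lt measurable_const (by fun_prop)

theorem measurable_pullCount {t : ℕ} (u : ℕ) (k : Fin K) :
    Measurable fun h : Fin t → Obs K => pullCount h u k := by
  have hf : Measurable fun h : Fin t → Obs K => fun i => (h i).1 := by fun_prop
  exact (measurable_of_countable fun g : Fin t → Fin K =>
    (Finset.univ.filter fun i : Fin t => i.val + 1 < u ∧ g i = k).card).comp hf

theorem measurable_empMean {t : ℕ} (u : ℕ) (k : Fin K) :
    Measurable fun h : Fin t → Obs K => empMean h u k := by
  unfold empMean
  refine Measurable.div ?_ (measurable_from_nat.comp (measurable_pullCount u k))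
  refine Finset.measurable_sum _ fun i _ => Measurable.ite ?_ ?_ measurable_const
  · refine (MeasurableSet.const _).inter ?_
    exact (by fun_prop : Measurable fun h : Fin t → Obs K => (h i).1) (measurableSet_singleton k)
  · exact measurable_subtype_coe.comp (by fun_prop)

theorem measurable_index {t : ℕ} (u : ℕ) (k : Fin K) :
    Measurable fun h : Fin t → Obs K => klIndex (pullCount h u k) (empMean h u k) u := by
  have h1 := (measurable_empMean (t := t) u k).prodMk (measurable_pullCount u k)
  have h2 : Measurable fun x : ℝ × ℕ => klIndex x.2 x.1 u :=
    measurable_from_prod_countable_left fun n => measurable_klIndex n _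
  have h3 := Measurable.comp h2 h1
  exact h3

theorem measurable_ofCmp {A : Type} [MeasurableSpace A] (F : (Fin K → ℝ) → (Fin K → ℝ) → A)
    (hF : ∀ m b m' b', (∀ k l, m k ≤ m l ↔ m' k ≤ m' l) → (∀ k l, m l ≤ b k ↔ m' l ≤ b' k) →
      F m b = F m' b') :
    Measurable fun x : (Fin K → ℝ) × (Fin K → ℝ) => F x.1 x.2 := by
  let D : (Fin K → ℝ) × (Fin K → ℝ) → (Fin K → Fin K → Prop) × (Fin K → Fin K → Prop) :=
    fun x => (fun k l => x.1 k ≤ x.1 l, fun k l => x.1 l ≤ x.2 k)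
  have hD : Measurable D := by
    refine Measurable.prodMk ?_ ?_ <;>
    refine measurable_pi_iff.2 fun k => measurable_pi_iff.2 fun l => measurableSet_setOfPred.1 ?_
    · exact measurableSet_le (by fun_prop) (by fun_prop)
    · exact measurableSet_le (by fun_prop) (by fun_prop)
  have hfac : Function.FactorsThrough (fun x : (Fin K → ℝ) × (Fin K → ℝ) => F x.1 x.2) D := by
    intro x y hxy
    refine hF _ _ _ _ (fun k l => ?_) (fun k l => ?_)
    · exact iff_of_eq (congrFun (congrFun (congrArg Prod.fst hxy) k) l)
    · exact iff_of_eq (congrFun (congrFun (congrArg Prod.snd hxy) k) l)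
  have : (fun x : (Fin K → ℝ) × (Fin K → ℝ) => F x.1 x.2) =
      Function.extend D (fun x => F x.1 x.2) (fun _ => F 0 0) ∘ D :=
    funext fun x => (hfac.extend_apply _ x).symm
  rw [this]
  exact (measurable_of_countable _).comp hD

variable [NeZero K]

theorem measurable_exploChoice (Mh : ℕ) (a : Fin K) (τ : ℕ) :
    Measurable fun x : (Fin K → ℝ) × (Fin K → ℝ) => exploChoice Mh a τ x.1 x.2 := by
  refine measurable_ofCmp _ fun m b m' b' h1 h2 => ?_
  have hlt : ∀ k l, m k < m l ↔ m' k < m' l := fun k l => by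
    rw [← not_le, ← not_le, h1]
  have heq : ∀ k l, m k = m l ↔ m' k = m' l := fun k l => by
    rw [le_antisymm_iff, le_antisymm_iff, h1, h1]
  have hp : place m = place m' := by
    funext k; simp only [place, hlt, heq]
  have ht : topArms Mh m = topArms Mh m' := by simp only [topArms, hp]
  simp only [exploChoice, hp, ht, h2]

theorem measurable_exploStep {t : ℕ} (Mh : ℕ) (a : Fin K) :
    Measurable fun h : Fin t → Obs K => exploStep Mh a h := by
  have hm : Measurable fun h : Fin t → Obs K => empMean h (lastUpdate Mh (t + 1)) :=
    measurable_pi_lambda _ fun k => measurable_empMean _ k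
  have hb : Measurable fun h : Fin t → Obs K => fun k : Fin K =>
      klIndex (pullCount h (lastUpdate Mh (t + 1)) k)
        (empMean h (lastUpdate Mh (t + 1)) k) (lastUpdate Mh (t + 1)) :=
    measurable_pi_lambda _ fun k => measurable_index _ k
  have h1 := Measurable.comp (measurable_exploChoice Mh a (t + 1)) (hm.prodMk hb)
  exact h1

theorem measurable_choice (T t : ℕ) :
    Measurable fun h : Fin t → Obs K => choice T h := by
  have hg : Measurable fun h : Fin t → Obs K => fun i => signal (h i) :=
    measurable_pi_lambda _ fun i => measurable_signal.comp (measurable_pi_apply i)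
  let F : Choice K ⊕ (ℕ × Fin K) → (Fin t → Obs K) → Choice K := fun c h => match c with
    | .inl c => c
    | .inr (Mh, a) => exploStep Mh a h
  have hF : ∀ c, Measurable (F c) := by
    rintro (c | ⟨Mh, a⟩)
    · exact measurable_const
    · exact measurable_exploStep Mh a
  have key : Measurable fun x : (Fin t → Obs K) × (Fin t → Signal K) => F (initStep T x.2) x.1 :=
    measurable_from_prod_countable_left fun g => hF (initStep T g)
  have h1 := Measurable.comp key (measurable_id.prodMk hg)
  exact h1

theorem measurable_pick (S : Finset (Fin K)) : Measurable (pick S) :=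
  (measurable_of_countable fun n : ℕ => (S.sort (· ≤ ·)).getD n 0).comp
    (Nat.measurable_floor.comp (measurable_id.mul_const _))

theorem measurable_draw (c : Choice K) : Measurable (Choice.draw c) := by
  cases c with
  | uniform S => exact measurable_pick S
  | half a B =>
    exact Measurable.ite measurableSet_Iio measurable_const
      ((measurable_pick B).comp ((measurable_id.const_mul 2).sub_const 1))

instance : Countable (Choice K) := by
  let f : Choice K → Option (Fin K) × Finset (Fin K) := fun c => match c with
    | .uniform S => (none, S)
    | .half a B => (some a, B)
  refine Function.Injective.countable (f := f) fun x y h => ?_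
  cases x <;> cases y <;> simp_all [f]

/-- The algorithm Selfish-Robust MMAB with horizon `T`: in each round, the current seed realizes
the randomized choice. -/
def selfishRobust (K T : ℕ) [NeZero K] : Strategy K where
  act t h u := (choice T h).draw (u (Fin.last t))
  measurable_act t := by
    have h1 : Measurable fun x : ℝ × Choice K => x.2.draw x.1 :=
      measurable_from_prod_countable_left fun c => measurable_draw c
    exact h1.comp (Measurable.prodMk
      (measurable_subtype_coe.comp ((measurable_pi_apply (Fin.last t)).comp measurable_snd))
      ((measurable_choice T t).comp measurable_fst))

end MPBandit

end

/-! Let v be T/M times the sum of the M best means: what a player earns by rotating over the M best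
arms. Two estimates suffice (`isNash_isStable_of_bounds`). If one player deviates and z is her
expected number of collisions, she earns at most v + E₂ - μ_(M) z, and every other player earns at
least v - E₁ - μ_(1) z; without a deviator everybody earns at least v - E₁. When E₁ + E₂ ≤ ε, the
Nash property follows from z ≥ 0. For stability, a victim who loses l forces z to be at least about
l / μ_(1), which costs the deviator about μ_(M) l / μ_(1). The victim and the deviator have the same
baseline because the profile is symmetric (`expReward_symm`).

The initialization withstands a deviator. The cooperative players pull uniformly, and their
estimation phases last nearly the same time τ, set by the arm that is least often positive
(`measure_not_stopsNear_le`). If the deviator pulls k with average frequency ρ_k, a cooperative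
player is alone on k with probability (1-1/K)^(M-2) (1-ρ_k). As the ρ_k sum to 1, averaging over the
arms gives (1-1/K)^(M-1), whatever the deviator does, and M is recovered by a logarithm
(`playersEstimate_meanCollision`). In the attribution of ranks, the M-1 others cannot cover M arms,
so a player is alone with probability at least 1/M (`le_sum_soloProb`). A player sits on her rank
until all cooperative players have one, so ranks are distinct (`InitSuccess.exists_initialized`).
All this lasts O(K³ log T / μ_(K)) rounds and fails with probability O(1/T).

In the second phase the cooperative players rotate over their empirical top lists. If all of them
have good statistics, they never collide with each other, and each leaves the rotation only to
explore, in place of the M-th best arm. The kl-UCB index limits the explorations of k to about log T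
/ kl(μ_k, μ_(M)), each at the price μ_(M) - μ_k (`Initialized.card_explorations_le`). The deviator
finds one slot of the rotation free; all else that she can get without a collision is worth at most
μ_(M) (`Initialized.sum_netMean_le`).

Rounds with bad statistics are bounded in expectation by a constant that depends on the means only.
A misjudged arm that the algorithm may pull is soon pulled and corrected
(`sum_measure_deviantSet_le`). An underestimated arm with too small an index is rare, because every
arm was observed at least a multiple of log T times in the initialization
(`sum_measure_indexFailure_le`). -/

noncomputable section

namespace MPBandit
open Set

/-! ## I.i.d. sequences: resampling one coordinate -/

section Iid

/-- `f` depends only on the coordinates before `t`. -/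
def DependsBefore {E A : Type*} (t : ℕ) (f : (ℕ → E) → A) : Prop :=
  ∀ r, t ≤ r → ∀ ω x, f (Function.update ω r x) = f ω

variable {E : Type*} [MeasurableSpace E] {D : Measure E} [IsProbabilityMeasure D]

theorem measurable_update_prod (t : ℕ) :
    Measurable fun z : (ℕ → E) × E => Function.update z.1 t z.2 := by
  refine measurable_pi_iff.2 fun r => ?_
  rcases eq_or_ne r t with rfl | h
  · simpa using measurable_snd
  · simp only [Function.update_of_ne h]; fun_prop

/-- A fresh copy of one coordinate leaves an i.i.d. law unchanged: on a box, the factor of index `t`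
merely changes its origin. This replaces conditioning on the past. For an adapted function,
integration over coordinate `t` alone is conditional expectation given the earlier rounds. -/
theorem map_update_infinitePi (t : ℕ) :
    ((Measure.infinitePi fun _ : ℕ => D).prod D).map (fun z => Function.update z.1 t z.2) =
      Measure.infinitePi fun _ : ℕ => D := by
  refine Measure.eq_infinitePi _ fun s S hS => ?_
  rw [Measure.map_apply (measurable_update_prod t)
    (MeasurableSet.pi s.countable_toSet fun i _ => hS i)]
  have hpre : (fun z : (ℕ → E) × E => Function.update z.1 t z.2) ⁻¹' (Set.pi (s : Set ℕ) S) =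
      (Set.pi ((s.erase t : Finset ℕ) : Set ℕ) S) ×ˢ (if t ∈ s then S t else univ) := by
    ext z
    simp only [mem_preimage, Set.mem_pi, Finset.mem_coe, mem_prod, Finset.mem_erase]
    constructor
    · intro h
      refine ⟨fun i hi => by simpa [Function.update_of_ne hi.1] using h i hi.2, ?_⟩
      split_ifs with ht
      · simpa using h t ht
      · trivial
    · rintro ⟨h1, h2⟩ i hi
      rcases eq_or_ne i t with rfl | hit
      · simpa [hi] using h2
      · simpa [Function.update_of_ne hit] using h1 i ⟨hit, hi⟩
  rw [hpre, Measure.prod_prod, Measure.infinitePi_pi _ fun i _ => hS i]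
  split_ifs with ht
  · rw [mul_comm, Finset.mul_prod_erase s (fun i => D (S i)) ht]
  · rw [measure_univ, mul_one, Finset.erase_eq_of_notMem ht]

theorem lintegral_update (t : ℕ) {f : (ℕ → E) → ENNReal} (hf : Measurable f) :
    ∫⁻ ω, f ω ∂(Measure.infinitePi fun _ : ℕ => D) =
      ∫⁻ ω, ∫⁻ x, f (Function.update ω t x) ∂D ∂(Measure.infinitePi fun _ : ℕ => D) := by
  conv_lhs => rw [← map_update_infinitePi (D := D) t]
  rw [lintegral_map hf (measurable_update_prod t)]
  exact lintegral_prod _ (hf.comp (measurable_update_prod t)).aemeasurable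

theorem integral_update (t : ℕ) {f : (ℕ → E) → ℝ} (hf : Measurable f)
    (hi : Integrable f (Measure.infinitePi fun _ : ℕ => D)) :
    ∫ ω, f ω ∂(Measure.infinitePi fun _ : ℕ => D) =
      ∫ ω, ∫ x, f (Function.update ω t x) ∂D ∂(Measure.infinitePi fun _ : ℕ => D) := by
  have hm := map_update_infinitePi (D := D) t
  conv_lhs => rw [← hm]
  rw [integral_map (measurable_update_prod t).aemeasurable hf.aestronglyMeasurable,
    integral_prod]
  have : Integrable f (((Measure.infinitePi fun _ : ℕ => D).prod D).map
      (fun z => Function.update z.1 t z.2)) := by rwa [hm]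
  exact this.comp_measurable (measurable_update_prod t)

/-- A product of adapted factors with conditional expectation at most `1` has expectation at
most `1`. -/
theorem lintegral_prod_le_one {G : ℕ → (ℕ → E) → ENNReal} (hm : ∀ t, Measurable (G t))
    (had : ∀ t, DependsBefore (t + 1) (G t))
    (h1 : ∀ t ω, ∫⁻ x, G t (Function.update ω t x) ∂D ≤ 1) (m : ℕ) :
    ∫⁻ ω, ∏ t ∈ Finset.range m, G t ω ∂(Measure.infinitePi fun _ : ℕ => D) ≤ 1 := by
  induction m with
  | zero => simp
  | succ m ih =>
    rw [lintegral_update m (Finset.measurable_prod _ fun t _ => hm t)]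
    refine le_trans (lintegral_mono fun ω => ?_) ih
    have hp : ∀ x, ∏ t ∈ Finset.range (m + 1), G t (Function.update ω m x) =
        (∏ t ∈ Finset.range m, G t ω) * G m (Function.update ω m x) := fun x => by
      rw [Finset.prod_range_succ]
      congr 1
      exact Finset.prod_congr rfl fun t ht => had t m (Finset.mem_range.1 ht) ω x
    simp only [hp]
    rw [lintegral_const_mul (μ := D) _
      (show Measurable fun x => G m (Function.update ω m x) from
        (hm m).comp (measurable_update ω))]
    exact (mul_le_mul_right (h1 m ω) _).trans (by rw [mul_one])

/-- Markov's inequality for products of adapted exponential factors. -/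
theorem measure_sum_ge_le {g : ℕ → (ℕ → E) → ℝ} (hm : ∀ t, Measurable (g t))
    (had : ∀ t, DependsBefore (t + 1) (g t))
    (h1 : ∀ t ω, ∫⁻ x, ENNReal.ofReal (Real.exp (g t (Function.update ω t x))) ∂D ≤ 1)
    (m : ℕ) (b : ℝ) :
    (Measure.infinitePi fun _ : ℕ => D) {ω | b ≤ ∑ t ∈ Finset.range m, g t ω} ≤
      ENNReal.ofReal (Real.exp (-b)) := by
  have hG := lintegral_prod_le_one (D := D) (G := fun t ω => ENNReal.ofReal (Real.exp (g t ω)))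
    (fun t => (Real.measurable_exp.comp (hm t)).ennreal_ofReal)
    (fun t r hr ω x => by simp only [had t r hr ω x]) h1 m
  have hpe : ∀ ω, ∏ t ∈ Finset.range m, ENNReal.ofReal (Real.exp (g t ω)) =
      ENNReal.ofReal (Real.exp (∑ t ∈ Finset.range m, g t ω)) := fun ω => by
    rw [Real.exp_sum, ENNReal.ofReal_prod_of_nonneg fun i _ => (Real.exp_pos _).le]
  simp only [hpe] at hG
  have hmk := mul_meas_ge_le_lintegral₀ (μ := Measure.infinitePi fun _ : ℕ => D)
    (f := fun ω => ENNReal.ofReal (Real.exp (∑ t ∈ Finset.range m, g t ω)))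
    (Real.measurable_exp.comp (Finset.measurable_sum _ fun t _ => hm t)).ennreal_ofReal.aemeasurable
    (ENNReal.ofReal (Real.exp b))
  have hsub : {ω : ℕ → E | b ≤ ∑ t ∈ Finset.range m, g t ω} ⊆
      {ω | ENNReal.ofReal (Real.exp b) ≤
        ENNReal.ofReal (Real.exp (∑ t ∈ Finset.range m, g t ω))} := fun ω hω =>
    ENNReal.ofReal_le_ofReal (Real.exp_le_exp.2 hω)
  have h2 : ENNReal.ofReal (Real.exp b) *
      (Measure.infinitePi fun _ : ℕ => D) {ω | b ≤ ∑ t ∈ Finset.range m, g t ω} ≤ 1 :=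
    (mul_le_mul_right (measure_mono hsub) _).trans (hmk.trans hG)
  have h3 : ENNReal.ofReal (Real.exp (-b)) * ENNReal.ofReal (Real.exp b) = 1 := by
    rw [← ENNReal.ofReal_mul (Real.exp_pos _).le, ← Real.exp_add]; simp
  calc (Measure.infinitePi fun _ : ℕ => D) {ω | b ≤ ∑ t ∈ Finset.range m, g t ω}
      = ENNReal.ofReal (Real.exp (-b)) * (ENNReal.ofReal (Real.exp b) *
        (Measure.infinitePi fun _ : ℕ => D) {ω | b ≤ ∑ t ∈ Finset.range m, g t ω}) := by
          rw [← mul_assoc, h3, one_mul]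
    _ ≤ ENNReal.ofReal (Real.exp (-b)) * 1 := mul_le_mul_right h2 _
    _ = _ := mul_one _

theorem exp_le_one_add_add_sq {x : ℝ} (hx : |x| ≤ 1) : Real.exp x ≤ 1 + x + x ^ 2 := by
  have := (abs_le.1 (Real.abs_exp_sub_one_sub_id_le hx)).2
  linarith

/-- A Bernoulli variable with parameter c has exponential moment 1 + c (e^l - 1) ≤ 1 + c (l + l²) ≤
exp(c (l + l²)). The exponent is proportional to c, so sums of adapted indicators are controlled by
their predictable compensator, as in Bernstein's inequality. -/
theorem lintegral_exp_indicator_le {S : Set E} (hS : MeasurableSet S) {c l : ℝ}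
    (hc : D.real S = c) (hl : |l| ≤ 1) :
    ∫⁻ x, ENNReal.ofReal (Real.exp (l * S.indicator 1 x - (l + l ^ 2) * c)) ∂D ≤ 1 := by
  have hc0 : 0 ≤ c := hc ▸ measureReal_nonneg
  have hint : Integrable (S.indicator (1 : E → ℝ)) D :=
    (integrable_const (1 : ℝ)).indicator hS
  have he : ∀ x, Real.exp (l * S.indicator 1 x - (l + l ^ 2) * c) =
      Real.exp (-((l + l ^ 2) * c)) * (1 + (Real.exp l - 1) * S.indicator 1 x) := fun x => by
    rw [sub_eq_neg_add, Real.exp_add]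
    congr 1
    by_cases hx : x ∈ S <;> simp [hx]
  have hint2 : Integrable (fun x =>
      Real.exp (-((l + l ^ 2) * c)) * (1 + (Real.exp l - 1) * S.indicator 1 x)) D :=
    (((integrable_const _).add (hint.const_mul _))).const_mul _
  simp only [he]
  rw [← ofReal_integral_eq_lintegral_ofReal hint2
    (Filter.Eventually.of_forall fun x => by simp only [← he]; exact (Real.exp_pos _).le)]
  rw [integral_const_mul, integral_add (integrable_const _) (hint.const_mul _),
    integral_const_mul, integral_indicator_one hS, hc, ← ENNReal.ofReal_one]
  refine ENNReal.ofReal_le_ofReal ?_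
  rw [Real.exp_neg, inv_mul_le_iff₀ (Real.exp_pos _), mul_one]
  have h1 := exp_le_one_add_add_sq hl
  have h2 := Real.add_one_le_exp ((l + l ^ 2) * c)
  simp only [integral_const, probReal_univ, smul_eq_mul, mul_one]
  nlinarith

/-- Bernstein type bounds for the number of occurrences of adapted events `Y t` with conditional
probabilities `c t`. -/
theorem measure_occurrences_le {Y : ℕ → Set (ℕ → E)} {c : ℕ → (ℕ → E) → ℝ}
    (hY : ∀ t, MeasurableSet (Y t)) (hYd : ∀ t, DependsBefore (t + 1) (fun ω => ω ∈ Y t))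
    (hcm : ∀ t, Measurable (c t)) (hcd : ∀ t, DependsBefore t (c t))
    (hc : ∀ t ω, D.real {x | Function.update ω t x ∈ Y t} = c t ω) (m : ℕ) {a v : ℝ}
    (ha : 0 ≤ a) (hv : 0 < v) (hav : a ≤ 2 * v) (σ : ℝ) (hσ : σ = 1 ∨ σ = -1) :
    (Measure.infinitePi fun _ : ℕ => D)
      {ω | a ≤ σ * ∑ t ∈ Finset.range m, ((Y t).indicator 1 ω - c t ω) ∧
        ∑ t ∈ Finset.range m, c t ω ≤ v} ≤ ENNReal.ofReal (Real.exp (-(a ^ 2 / (4 * v)))) := by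
  -- This value maximizes |l| a - l² v, with maximum a²/(4v). The assumption a ≤ 2v keeps |l| ≤ 1,
  -- the range of the quadratic bound on exp.
  set l : ℝ := σ * (a / (2 * v)) with hl
  have hl2 : l ^ 2 = (a / (2 * v)) ^ 2 := by rcases hσ with h | h <;> simp [hl, h]
  have hl1 : |l| ≤ 1 := by
    have h0 : 0 ≤ a / (2 * v) := by positivity
    have h1 : a / (2 * v) ≤ 1 := (div_le_one (by positivity)).2 hav
    rcases hσ with h | h <;> simp only [hl, h, one_mul, neg_mul, abs_neg, abs_of_nonneg h0, h1]
  have := measure_sum_ge_le (D := D)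
    (g := fun t ω => l * (Y t).indicator 1 ω - (l + l ^ 2) * c t ω)
    (fun t => ((measurable_one.indicator (hY t)).const_mul _).sub ((hcm t).const_mul _))
    (fun t r hr ω x => by
      have h1 : (Function.update ω r x ∈ Y t) = (ω ∈ Y t) := hYd t r hr ω x
      have h2 := hcd t r (by omega) ω x
      by_cases h3 : ω ∈ Y t
      · simp [h2, h3, h1.symm ▸ h3]
      · simp [h2, h3, h1.symm ▸ h3]) ?_ m (a ^ 2 / (4 * v))
  · refine (measure_mono ?_).trans this
    rintro ω ⟨h1, h2⟩
    simp only [mem_ofPred_eq]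
    have hs : ∑ t ∈ Finset.range m, (l * (Y t).indicator 1 ω - (l + l ^ 2) * c t ω) =
        (a / (2 * v)) * (σ * ∑ t ∈ Finset.range m, ((Y t).indicator 1 ω - c t ω)) -
          (a / (2 * v)) ^ 2 * ∑ t ∈ Finset.range m, c t ω := by
      rw [hl2, Finset.mul_sum, Finset.mul_sum, Finset.mul_sum, ← Finset.sum_sub_distrib]
      exact Finset.sum_congr rfl fun t _ => by rw [hl]; ring
    rw [hs]
    have h3 : (a / (2 * v)) * a ≤
        (a / (2 * v)) * (σ * ∑ t ∈ Finset.range m, ((Y t).indicator 1 ω - c t ω)) :=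
      mul_le_mul_of_nonneg_left h1 (by positivity)
    have h4 := mul_le_mul_of_nonneg_left h2 (sq_nonneg (a / (2 * v)))
    have h5 : a ^ 2 / (4 * v) = (a / (2 * v)) * a - (a / (2 * v)) ^ 2 * v := by
      field_simp; ring
    linarith
  · intro t ω
    have hS : MeasurableSet {x | Function.update ω t x ∈ Y t} := measurable_update ω (hY t)
    refine le_trans (le_of_eq (lintegral_congr fun x => ?_))
      (lintegral_exp_indicator_le hS (hc t ω) hl1)
    rw [hcd t t le_rfl]
    rfl

end Iid

end MPBandit

namespace MPBandit
open Set

/-! ## The law of one round and the process of actions -/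

section Game

variable {K M : ℕ}

/-- The law of the randomness of one round. -/
def roundLaw (ν : Fin K → ProbabilityMeasure unitInterval) (M : ℕ) : Measure (Draw K M) :=
  (Measure.pi fun k => (ν k : Measure unitInterval)).prod (Measure.pi fun _ : Fin M => volume)

instance (ν : Fin K → ProbabilityMeasure unitInterval) : IsProbabilityMeasure (roundLaw ν M) := by
  unfold roundLaw; infer_instance

instance (ν : Fin K → ProbabilityMeasure unitInterval) : IsProbabilityMeasure (gameLaw ν M) := by
  unfold gameLaw; infer_instance

theorem gameLaw_eq (ν : Fin K → ProbabilityMeasure unitInterval) (M : ℕ) :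
    gameLaw ν M = Measure.infinitePi fun _ : ℕ => roundLaw ν M := rfl

/-- The observations of player `i` in the first `t` rounds. -/
def history (s : Fin M → Strategy K) (ω : ℕ → Draw K M) (i : Fin M) (t : ℕ) : Fin t → Obs K :=
  fun r => observe (ω r.val).1 (actions s ω r.val) i

theorem actions_eq (s : Fin M → Strategy K) (ω : ℕ → Draw K M) (t : ℕ) (i : Fin M) :
    actions s ω t i = (s i).act t (history s ω i t) (fun r => (ω r.val).2 i) := by
  rw [actions]; rfl

/-- The arm pulled by player `i` in round `t + 1`, as a function of her seed in that round. -/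
def stepArm (s : Fin M → Strategy K) (ω : ℕ → Draw K M) (t : ℕ) (i : Fin M) (u : unitInterval) :
    Fin K :=
  (s i).act t (history s ω i t) (fun r => if r.val = t then u else (ω r.val).2 i)

theorem actions_eq_stepArm (s : Fin M → Strategy K) (ω : ℕ → Draw K M) (t : ℕ) (i : Fin M) :
    actions s ω t i = stepArm s ω t i ((ω t).2 i) := by
  rw [actions_eq, stepArm]
  congr 1
  funext r
  split_ifs with h
  · rw [h]
  · rfl

theorem actions_congr (s : Fin M → Strategy K) {ω ω' : ℕ → Draw K M} (t : ℕ)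
    (h : ∀ r, r < t + 1 → ω r = ω' r) : actions s ω t = actions s ω' t := by
  induction t using Nat.strong_induction_on with
  | _ t ih =>
    funext i
    rw [actions_eq, actions_eq]
    have h1 : history s ω i t = history s ω' i t := by
      funext r
      simp only [history]
      rw [h r.val (by omega), ih r.val r.isLt fun q hq => h q (by omega)]
    have h2 : (fun r : Fin (t + 1) => (ω r.val).2 i) = fun r => (ω' r.val).2 i := by
      funext r; rw [h r.val r.isLt]
    rw [h1, h2]

theorem dependsBefore_actions (s : Fin M → Strategy K) (t : ℕ) :
    DependsBefore (t + 1) fun ω => actions s ω t := fun r hr ω x =>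
  actions_congr s t fun q hq => Function.update_of_ne (by omega) _ _

theorem dependsBefore_history (s : Fin M → Strategy K) (i : Fin M) (t : ℕ) :
    DependsBefore t fun ω => history s ω i t := fun r hr ω x => by
  funext q
  have h : actions s (Function.update ω r x) q.val = actions s ω q.val :=
    dependsBefore_actions s q.val r (by omega) ω x
  simp only [history]
  rw [h, Function.update_of_ne (by omega)]

theorem dependsBefore_stepArm (s : Fin M → Strategy K) (i : Fin M) (t : ℕ) :
    DependsBefore t fun ω => stepArm s ω t i := fun r hr ω x => by
  funext u
  have h := dependsBefore_history s i t r hr ω x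
  simp only [stepArm] at h ⊢
  rw [h]
  congr 1
  funext q
  split_ifs with hq
  · rfl
  · rw [Function.update_of_ne (by omega)]

/-- With the past frozen, the arms of the round are functions of separate fresh seeds. Hence the
players act independently given the past, also when one of them deviates. -/
theorem actions_update (s : Fin M → Strategy K) (ω : ℕ → Draw K M) (t : ℕ) (x : Draw K M) :
    actions s (Function.update ω t x) t = fun i => stepArm s ω t i (x.2 i) := by
  funext i
  rw [actions_eq_stepArm, Function.update_self]
  have h := dependsBefore_stepArm s i t t le_rfl ω x
  exact congrFun h _

theorem measurable_observe (i : Fin M) :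
    Measurable fun z : (Fin K → unitInterval) × (Fin M → Fin K) => observe z.1 z.2 i := by
  refine measurable_from_prod_countable_left fun π => ?_
  simp only [observe, reward]
  refine measurable_const.prodMk ((measurable_pi_apply _).prodMk ?_)
  split_ifs
  · exact measurable_const
  · exact measurable_pi_apply _

theorem measurable_actions (s : Fin M → Strategy K) (t : ℕ) :
    Measurable fun ω => actions s ω t := by
  induction t using Nat.strong_induction_on with
  | _ t ih =>
    refine measurable_pi_iff.2 fun i => ?_
    have h1 : Measurable fun ω => history s ω i t := by
      refine measurable_pi_iff.2 fun r => ?_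
      exact (measurable_observe i).comp
        ((measurable_fst.comp (measurable_pi_apply r.val)).prodMk (ih r.val r.isLt))
    have h2 : Measurable fun (ω : ℕ → Draw K M) (r : Fin (t + 1)) => (ω r.val).2 i := by fun_prop
    simp only [actions_eq]
    exact ((s i).measurable_act t).comp (h1.prodMk h2)

theorem measurable_history (s : Fin M → Strategy K) (i : Fin M) (t : ℕ) :
    Measurable fun ω => history s ω i t := by
  refine measurable_pi_iff.2 fun r => ?_
  exact (measurable_observe i).comp
    ((measurable_fst.comp (measurable_pi_apply r.val)).prodMk (measurable_actions s r.val))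

theorem measurable_stepArm_prod (s : Fin M → Strategy K) (i : Fin M) (t : ℕ) :
    Measurable fun z : (ℕ → Draw K M) × unitInterval => stepArm s z.1 t i z.2 := by
  have h2 : Measurable fun (z : (ℕ → Draw K M) × unitInterval) (r : Fin (t + 1)) =>
      if r.val = t then z.2 else (z.1 r.val).2 i := by
    refine measurable_pi_iff.2 fun r => ?_
    split_ifs <;> fun_prop
  exact ((s i).measurable_act t).comp
    (((measurable_history s i t).comp measurable_fst).prodMk h2)

theorem measurable_stepArm (s : Fin M → Strategy K) (ω : ℕ → Draw K M) (i : Fin M) (t : ℕ) :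
    Measurable (stepArm s ω t i) :=
  (measurable_stepArm_prod s i t).comp (measurable_const.prodMk measurable_id)

/-- The conditional probability that player `i` pulls `k` in round `t + 1`. -/
def pullProb (s : Fin M → Strategy K) (t : ℕ) (i : Fin M) (k : Fin K) (ω : ℕ → Draw K M) : ℝ :=
  (volume : Measure unitInterval).real {u | stepArm s ω t i u = k}

theorem measurable_pullProb (s : Fin M → Strategy K) (t : ℕ) (i : Fin M) (k : Fin K) :
    Measurable (pullProb s t i k) := by
  refine Measurable.ennreal_toReal ?_
  exact measurable_measure_prodMk_left
    (s := {z : (ℕ → Draw K M) × unitInterval | stepArm s z.1 t i z.2 = k})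
    (measurable_stepArm_prod s i t (measurableSet_singleton k))

theorem dependsBefore_pullProb (s : Fin M → Strategy K) (t : ℕ) (i : Fin M) (k : Fin K) :
    DependsBefore t (pullProb s t i k) := fun r hr ω x => by
  have h := dependsBefore_stepArm s i t r hr ω x
  simp only [pullProb] at h ⊢
  rw [h]

theorem sum_pullProb (s : Fin M → Strategy K) (t : ℕ) (i : Fin M) (ω : ℕ → Draw K M) :
    ∑ k, pullProb s t i k ω = 1 := by
  have h := measureReal_biUnion_finset (μ := (volume : Measure unitInterval))
    (s := (Finset.univ : Finset (Fin K))) (f := fun k => {u | stepArm s ω t i u = k})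
    (fun k _ l _ hkl => Set.disjoint_left.2 fun u hu hu' => hkl (hu.symm.trans hu'))
    (fun k _ => measurable_stepArm s ω i t (measurableSet_singleton k))
  have h2 : (⋃ k ∈ (Finset.univ : Finset (Fin K)), {u | stepArm s ω t i u = k}) = univ := by
    ext u; simp
  rw [h2, probReal_univ] at h
  exact h.symm

/-! ## Conditional probabilities in one round -/

theorem roundLaw_real_prod (ν : Fin K → ProbabilityMeasure unitInterval)
    (S : Set (Fin K → unitInterval)) (B : Fin M → Set unitInterval) :
    (roundLaw ν M).real {x | x.1 ∈ S ∧ ∀ i, x.2 i ∈ B i} =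
      (Measure.pi fun k => (ν k : Measure unitInterval)).real S *
        ∏ i, (volume : Measure unitInterval).real (B i) := by
  have h : {x : Draw K M | x.1 ∈ S ∧ ∀ i, x.2 i ∈ B i} = S ×ˢ (Set.univ.pi B) := by
    ext x; simp [Set.mem_pi]
  rw [h, roundLaw, Measure.real, Measure.prod_prod, Measure.pi_pi, ENNReal.toReal_mul,
    ENNReal.toReal_prod]
  rfl

/-- The probability that arm `k` has positive quality. -/
def posProb (ν : Fin K → ProbabilityMeasure unitInterval) (k : Fin K) : ℝ :=
  (ν k : Measure unitInterval).real {x | 0 < x}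

theorem pi_real_eval (ν : Fin K → ProbabilityMeasure unitInterval) (k : Fin K)
    {S : Set unitInterval} (hS : MeasurableSet S) :
    (Measure.pi fun k => (ν k : Measure unitInterval)).real {x | x k ∈ S} =
      (ν k : Measure unitInterval).real S := by
  simp only [Measure.real]
  rw [← (measurePreserving_eval (fun k => (ν k : Measure unitInterval)) k).measure_preimage
    hS.nullMeasurableSet]
  rfl

theorem measurableSet_pos : MeasurableSet {x : unitInterval | 0 < x} := measurableSet_Ioi

theorem roundLaw_real_sensed (ν : Fin K → ProbabilityMeasure unitInterval) (k : Fin K)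
    (i : Fin M) (A : Set unitInterval) :
    (roundLaw ν M).real {x | 0 < x.1 k ∧ x.2 i ∈ A} =
      posProb ν k * (volume : Measure unitInterval).real A := by
  have h := roundLaw_real_prod (M := M) ν {x | x k ∈ {x : unitInterval | 0 < x}}
    (fun i' => if i' = i then A else univ)
  have hs : {x : Draw K M | 0 < x.1 k ∧ x.2 i ∈ A} = {x | x.1 ∈ {x | x k ∈ {x : unitInterval | 0 < x}} ∧
      ∀ i', x.2 i' ∈ if i' = i then A else univ} := by
    ext x
    simp only [mem_ofPred_eq]
    refine and_congr_right fun _ => ⟨fun h i' => ?_, fun h => by simpa using h i⟩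
    split_ifs with hi
    · rwa [hi]
    · trivial
  rw [hs, h, pi_real_eval ν k measurableSet_pos, Finset.prod_eq_single i]
  · simp [posProb]
  · intro b _ hb; simp [hb]
  · simp

theorem roundLaw_real_alone (ν : Fin K → ProbabilityMeasure unitInterval) (k : Fin K)
    (i : Fin M) (A : Fin M → Set unitInterval) :
    (roundLaw ν M).real {x | 0 < x.1 k ∧ x.2 i ∈ A i ∧ ∀ i', i' ≠ i → x.2 i' ∉ A i'} =
      posProb ν k * ((volume : Measure unitInterval).real (A i) *
        ∏ i' ∈ Finset.univ.erase i, (volume : Measure unitInterval).real (A i')ᶜ) := by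
  have h := roundLaw_real_prod (M := M) ν {x | x k ∈ {x : unitInterval | 0 < x}}
    (fun i' => if i' = i then A i' else (A i')ᶜ)
  have hs : {x : Draw K M | 0 < x.1 k ∧ x.2 i ∈ A i ∧ ∀ i', i' ≠ i → x.2 i' ∉ A i'} =
      {x | x.1 ∈ {x | x k ∈ {x : unitInterval | 0 < x}} ∧
      ∀ i', x.2 i' ∈ if i' = i then A i' else (A i')ᶜ} := by
    ext x
    simp only [mem_ofPred_eq]
    refine and_congr_right fun _ => ⟨fun h i' => ?_, fun h => ⟨by simpa using h i, fun i' hi => ?_⟩⟩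
    · split_ifs with hi
      · rw [hi]; exact h.1
      · exact h.2 i' hi
    · simpa [hi] using h i'
  rw [hs, h, pi_real_eval ν k measurableSet_pos, ← Finset.mul_prod_erase _ _ (Finset.mem_univ i)]
  simp only [if_true, posProb]
  congr 2
  exact Finset.prod_congr rfl fun i' hi' => by simp [Finset.ne_of_mem_erase hi']

/-! ## Expected rewards -/

/-- The expected reward of player `j` given the pulled arms. -/
def netMean (μ : Fin K → ℝ) (π : Fin M → Fin K) (j : Fin M) : ℝ :=
  if Collision π (π j) then 0 else μ (π j)

/-- Given the past, the arms depend on the seeds only, and the seeds are independent of the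
qualities; so a quality may be replaced by its mean, on each value of the seeds separately. -/
theorem integral_reward (ν : Fin K → ProbabilityMeasure unitInterval) {μ : Fin K → ℝ}
    (hμ : ∀ k, ∫ x : unitInterval, (x : ℝ) ∂(ν k : Measure unitInterval) = μ k)
    (π : (Fin M → unitInterval) → Fin M → Fin K) (hπ : Measurable π) (j : Fin M) :
    ∫ x : Draw K M, (reward x.1 (π x.2) j : ℝ) ∂(roundLaw ν M) =
      ∫ x : Draw K M, netMean μ (π x.2) j ∂(roundLaw ν M) := by
  have hmr : Measurable fun x : Draw K M => (reward x.1 (π x.2) j : ℝ) :=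
    measurable_subtype_coe.comp (measurable_snd.comp (measurable_snd.comp
      ((measurable_observe j).comp (measurable_fst.prodMk (hπ.comp measurable_snd)))))
  have hmn : Measurable fun x : Draw K M => netMean μ (π x.2) j :=
    (measurable_of_countable fun a : Fin M → Fin K => netMean μ a j).comp (hπ.comp measurable_snd)
  have hi1 : Integrable (fun x : Draw K M => (reward x.1 (π x.2) j : ℝ)) (roundLaw ν M) :=
    Integrable.of_bound hmr.aestronglyMeasurable 1 (Filter.Eventually.of_forall fun x => by
      rw [Real.norm_of_nonneg (reward x.1 (π x.2) j).2.1]; exact (reward x.1 (π x.2) j).2.2)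
  have hi2 : Integrable (fun x : Draw K M => netMean μ (π x.2) j) (roundLaw ν M) := by
    refine Integrable.of_bound hmn.aestronglyMeasurable (∑ k, |μ k|)
      (Filter.Eventually.of_forall fun x => ?_)
    rw [Real.norm_eq_abs, netMean]
    split_ifs
    · simpa using Finset.sum_nonneg fun k _ => abs_nonneg (μ k)
    · exact Finset.single_le_sum (f := fun k => |μ k|) (fun k _ => abs_nonneg _)
        (Finset.mem_univ _)
  unfold roundLaw at hi1 hi2 ⊢
  rw [integral_prod_symm _ hi1, integral_prod_symm _ hi2]
  refine integral_congr_ae (Filter.Eventually.of_forall fun u => ?_)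
  simp only [reward, netMean]
  split_ifs
  · simp
  · rw [integral_comp_eval (μ := fun k => (ν k : Measure unitInterval)) (i := π u j)
      (f := fun x : unitInterval => (x : ℝ)) measurable_subtype_coe.aestronglyMeasurable]
    simp [hμ]

theorem measurable_netMean (s : Fin M → Strategy K) (μ : Fin K → ℝ) (t : ℕ) (j : Fin M) :
    Measurable fun ω => netMean μ (actions s ω t) j :=
  (measurable_of_countable fun a : Fin M → Fin K => netMean μ a j).comp (measurable_actions s t)

theorem integrable_netMean (ν : Fin K → ProbabilityMeasure unitInterval)
    (s : Fin M → Strategy K) (μ : Fin K → ℝ) (t : ℕ) (j : Fin M) :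
    Integrable (fun ω => netMean μ (actions s ω t) j) (gameLaw ν M) := by
  refine Integrable.of_bound (measurable_netMean s μ t j).aestronglyMeasurable (∑ k, |μ k|)
    (Filter.Eventually.of_forall fun x => ?_)
  rw [Real.norm_eq_abs, netMean]
  split_ifs
  · simpa using Finset.sum_nonneg fun k _ => abs_nonneg (μ k)
  · exact Finset.single_le_sum (f := fun k => |μ k|) (fun k _ => abs_nonneg _)
      (Finset.mem_univ _)

/-- From here on rewards are counted with the means, so that pathwise bounds need no control of the
realized qualities. -/
theorem expReward_eq (ν : Fin K → ProbabilityMeasure unitInterval) {μ : Fin K → ℝ}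
    (hμ : ∀ k, ∫ x : unitInterval, (x : ℝ) ∂(ν k : Measure unitInterval) = μ k)
    (T : ℕ) (s : Fin M → Strategy K) (j : Fin M) :
    expReward ν T s j =
      ∫ ω, ∑ t ∈ Finset.range T, netMean μ (actions s ω t) j ∂(gameLaw ν M) := by
  have hmr : ∀ t, Measurable fun ω : ℕ → Draw K M => (reward (ω t).1 (actions s ω t) j : ℝ) :=
    fun t => measurable_subtype_coe.comp (measurable_snd.comp (measurable_snd.comp
      ((measurable_observe j).comp
        ((measurable_fst.comp (measurable_pi_apply t)).prodMk (measurable_actions s t)))))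
  have hi1 : ∀ t, Integrable (fun ω : ℕ → Draw K M => (reward (ω t).1 (actions s ω t) j : ℝ))
      (gameLaw ν M) := fun t =>
    Integrable.of_bound (hmr t).aestronglyMeasurable 1 (Filter.Eventually.of_forall fun x => by
      rw [Real.norm_of_nonneg (reward _ _ j).2.1]; exact (reward _ _ j).2.2)
  rw [expReward, integral_finsetSum _ fun t _ => hi1 t,
    integral_finsetSum _ fun t _ => integrable_netMean ν s μ t j]
  refine Finset.sum_congr rfl fun t _ => ?_
  rw [gameLaw_eq, integral_update (D := roundLaw ν M) t (hmr t) (hi1 t),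
    integral_update (D := roundLaw ν M) t (measurable_netMean s μ t j)
      (integrable_netMean ν s μ t j)]
  refine integral_congr_ae (Filter.Eventually.of_forall fun ω => ?_)
  simp only [actions_update, Function.update_self]
  exact integral_reward ν hμ (fun u i => stepArm s ω t i (u i))
    (measurable_pi_iff.2 fun i => (measurable_stepArm s ω i t).comp (measurable_pi_apply i)) j

/-! ## Symmetry between the players -/

theorem collision_comp (e : Equiv.Perm (Fin M)) (π : Fin M → Fin K) (k : Fin K) :
    Collision (fun i => π (e i)) k ↔ Collision π k := by
  unfold Collision
  rw [show (Finset.univ.filter fun j => π (e j) = k).card =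
    (Finset.univ.filter fun j => π j = k).card from
    Finset.card_equiv e fun i => by simp]

theorem observe_comp (e : Equiv.Perm (Fin M)) (x : Fin K → unitInterval) (π : Fin M → Fin K)
    (i : Fin M) : observe x (fun i => π (e i)) i = observe x π (e i) := by
  simp only [observe, reward, collision_comp]

theorem actions_permute (σ : Strategy K) (e : Equiv.Perm (Fin M)) (ω : ℕ → Draw K M) (t : ℕ) :
    actions (fun _ => σ) (fun r => ((ω r).1, fun i => (ω r).2 (e i))) t =
      fun i => actions (fun _ => σ) ω t (e i) := by
  induction t using Nat.strong_induction_on with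
  | _ t ih =>
    funext i
    rw [actions_eq, actions_eq]
    congr 1
    funext r
    simp only [history]
    rw [ih r.val r.isLt, observe_comp]

theorem measurePreserving_permute (ν : Fin K → ProbabilityMeasure unitInterval)
    (e : Equiv.Perm (Fin M)) :
    MeasurePreserving (fun (ω : ℕ → Draw K M) r => ((ω r).1, fun i => (ω r).2 (e i)))
      (gameLaw ν M) (gameLaw ν M) := by
  have hf : Measurable fun x : Draw K M => ((x.1, fun i => x.2 (e i)) : Draw K M) := by fun_prop
  refine ⟨by fun_prop, ?_⟩
  have h1 : (roundLaw ν M).map (fun x : Draw K M => ((x.1, fun i => x.2 (e i)) : Draw K M)) =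
      roundLaw ν M := by
    have h2 := Measure.map_prod_map (Measure.pi fun k => (ν k : Measure unitInterval))
      (Measure.pi fun _ : Fin M => (volume : Measure unitInterval)) (f := id)
      (g := fun u i => u (e i)) measurable_id (by fun_prop)
    have h3 : (Measure.pi fun _ : Fin M => (volume : Measure unitInterval)).map
        (fun u i => u (e i)) = Measure.pi fun _ : Fin M => (volume : Measure unitInterval) := by
      refine (Measure.pi_eq fun S hS => ?_).symm
      rw [Measure.map_apply (by fun_prop) (MeasurableSet.univ_pi hS)]
      have : (fun (u : Fin M → unitInterval) i => u (e i)) ⁻¹' (Set.univ.pi S) =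
          Set.univ.pi fun i => S (e.symm i) := by
        ext u
        simp only [mem_preimage, Set.mem_pi, mem_univ, true_imp_iff]
        exact ⟨fun h i => by simpa using h (e.symm i), fun h i => by simpa using h (e i)⟩
      rw [this, Measure.pi_pi]
      exact Equiv.prod_comp e.symm fun i => (volume : Measure unitInterval) (S i)
    rw [h3, Measure.map_id] at h2
    exact h2.symm
  have h4 := Measure.infinitePi_map_pi (fun _ : ℕ => roundLaw ν M) (fun _ => hf)
  rw [gameLaw_eq, h4]
  simp only [h1]

/-- Swapping the seeds of two players preserves the law of the game and, in a symmetric profile,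
swaps their actions. The stability proof uses this to measure the victim's loss against the
deviator's baseline. -/
theorem expReward_symm (ν : Fin K → ProbabilityMeasure unitInterval) (T : ℕ) (σ : Strategy K)
    (i j : Fin M) : expReward ν T (fun _ => σ) i = expReward ν T (fun _ => σ) j := by
  have hmr : Measurable fun ω : ℕ → Draw K M =>
      ∑ t ∈ Finset.range T, (reward (ω t).1 (actions (fun _ => σ) ω t) i : ℝ) :=
    Finset.measurable_sum _ fun t _ => measurable_subtype_coe.comp (measurable_snd.comp
      (measurable_snd.comp ((measurable_observe i).comp
        ((measurable_fst.comp (measurable_pi_apply t)).prodMk (measurable_actions _ t)))))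
  have hp := measurePreserving_permute ν (M := M) (Equiv.swap i j)
  rw [expReward, ← hp.map_eq, integral_map hp.measurable.aemeasurable hmr.aestronglyMeasurable,
    expReward]
  refine integral_congr_ae (Filter.Eventually.of_forall fun ω => Finset.sum_congr rfl fun t _ => ?_)
  simp only [actions_permute]
  simp only [reward, collision_comp, Equiv.swap_apply_left]

end Game

end MPBandit

namespace MPBandit
open Set

/-! ## Lists of arms and random choices -/

section Choices

variable {K : ℕ} [NeZero K]

/-- The element at position `c` of the increasing enumeration of `S`. -/
def listArm (S : Finset (Fin K)) (c : ℕ) : Fin K := (S.sort (· ≤ ·)).getD c 0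

theorem listArm_mem {S : Finset (Fin K)} {c : ℕ} (hc : c < S.card) : listArm S c ∈ S := by
  have h : c < (S.sort (· ≤ ·)).length := by rwa [Finset.length_sort]
  rw [listArm, List.getD_eq_getElem _ _ h, ← Finset.mem_sort (· ≤ ·)]
  exact List.getElem_mem h

theorem listArm_inj {S : Finset (Fin K)} {c d : ℕ} (hc : c < S.card) (hd : d < S.card)
    (h : listArm S c = listArm S d) : c = d := by
  have hc' : c < (S.sort (· ≤ ·)).length := by rwa [Finset.length_sort]
  have hd' : d < (S.sort (· ≤ ·)).length := by rwa [Finset.length_sort]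
  rw [listArm, listArm, List.getD_eq_getElem _ _ hc', List.getD_eq_getElem _ _ hd'] at h
  exact (List.Nodup.getElem_inj_iff (S.sort_nodup (· ≤ ·))).1 h

theorem exists_listArm_eq {S : Finset (Fin K)} {k : Fin K} (hk : k ∈ S) :
    ∃ c < S.card, listArm S c = k := by
  rw [← Finset.mem_sort (· ≤ ·)] at hk
  obtain ⟨c, hc, h⟩ := List.getElem_of_mem hk
  refine ⟨c, by rwa [Finset.length_sort] at hc, ?_⟩
  rw [listArm, List.getD_eq_getElem _ _ hc, h]

theorem pick_eq_listArm (S : Finset (Fin K)) (u : ℝ) : pick S u = listArm S ⌊u * S.card⌋₊ := rfl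

theorem pick_mem {S : Finset (Fin K)} {u : ℝ} (hS : S.Nonempty) (h1 : u < 1) : pick S u ∈ S := by
  refine listArm_mem ?_
  have hS' : (0 : ℝ) < S.card := by exact_mod_cast hS.card_pos
  rcases le_or_gt 0 u with h0 | h0
  · rw [Nat.floor_lt (by positivity)]; nlinarith
  · rw [Nat.floor_of_nonpos (by nlinarith)]; exact hS.card_pos

theorem volume_real_Ico {a b : ℝ} (ha : 0 ≤ a) (hab : a ≤ b) (hb : b ≤ 1) :
    (volume : Measure unitInterval).real {u | (u : ℝ) ∈ Ico a b} = b - a := by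
  have h : {u : unitInterval | (u : ℝ) ∈ Ico a b} =
    Ico (⟨a, ha, hab.trans hb⟩ : unitInterval) ⟨b, ha.trans hab, hb⟩ := rfl
  rw [h, Measure.real, unitInterval.volume_Ico, ENNReal.toReal_ofReal]
  · simpa using hab

theorem pick_eq_of_mem_Ico {S : Finset (Fin K)} {c : ℕ} (hc : c < S.card) {u : ℝ}
    (hu : u ∈ Ico ((c : ℝ) / S.card) (((c : ℝ) + 1) / S.card)) : pick S u = listArm S c := by
  have hS : (0 : ℝ) < S.card := by exact_mod_cast (Nat.zero_le c).trans_lt hc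
  have h1 := (div_le_iff₀ hS).1 hu.1
  have h2 := (lt_div_iff₀ hS).1 hu.2
  rw [pick_eq_listArm, (Nat.floor_eq_iff ((Nat.cast_nonneg c).trans h1)).2 ⟨h1, h2⟩]

theorem volume_pick_ge {S : Finset (Fin K)} {k : Fin K} (hk : k ∈ S) :
    (1 : ℝ) / S.card ≤ (volume : Measure unitInterval).real {u | pick S (u : ℝ) = k} := by
  obtain ⟨c, hc, rfl⟩ := exists_listArm_eq hk
  have hS : (0 : ℝ) < S.card := by exact_mod_cast (Nat.zero_le c).trans_lt hc
  have h1 : ((c : ℝ) + 1) / S.card ≤ 1 := by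
    rw [div_le_one hS]; exact_mod_cast hc
  rw [show (1 : ℝ) / S.card = ((c : ℝ) + 1) / S.card - c / S.card by ring,
    ← volume_real_Ico (by positivity) (by gcongr; linarith) h1]
  exact measureReal_mono fun u hu => pick_eq_of_mem_Ico hc hu

/-- Each element owns an interval of seeds of length 1/|S|. These lower bounds already sum to 1, so
they are equalities, and the seed 1, at which the list takes its default value, needs no separate
treatment. -/
theorem volume_pick {S : Finset (Fin K)} {k : Fin K} (hk : k ∈ S) :
    (volume : Measure unitInterval).real {u | pick S (u : ℝ) = k} = 1 / S.card := by
  have hS : (0 : ℝ) < S.card := by exact_mod_cast Finset.card_pos.2 ⟨k, hk⟩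
  have hm : ∀ l, MeasurableSet {u : unitInterval | pick S (u : ℝ) = l} := fun l =>
    ((measurable_pick S).comp measurable_subtype_coe) (measurableSet_singleton l)
  have h := measureReal_biUnion_finset (μ := (volume : Measure unitInterval))
    (s := S) (f := fun k => {u | pick S (u : ℝ) = k})
    (fun k _ l _ hkl => Set.disjoint_left.2 fun u hu hu' => hkl (hu.symm.trans hu'))
    (fun k _ => hm k)
  have h1 : ∑ l ∈ S, (volume : Measure unitInterval).real {u | pick S (u : ℝ) = l} ≤ 1 := by
    rw [← h]; exact measureReal_le_one
  refine le_antisymm ?_ (volume_pick_ge hk)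
  rw [← Finset.add_sum_erase _ _ hk] at h1
  have h2 : ((S.erase k).card : ℝ) * (1 / S.card) ≤
      ∑ l ∈ S.erase k, (volume : Measure unitInterval).real {u | pick S (u : ℝ) = l} := by
    rw [← nsmul_eq_mul]
    exact Finset.card_nsmul_le_sum _ _ _ fun l hl => volume_pick_ge (Finset.mem_of_mem_erase hl)
  have h3 : ((S.erase k).card : ℝ) = S.card - 1 := by
    rw [Finset.card_erase_of_mem hk, Nat.cast_sub (Finset.card_pos.2 ⟨k, hk⟩)]; simp
  rw [h3] at h2
  have h4 : ((S.card : ℝ) - 1) * (1 / S.card) = 1 - 1 / S.card := by field_simp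
  linarith

theorem volume_half_left (a : Fin K) (B : Finset (Fin K)) :
    (1 : ℝ) / 2 ≤ (volume : Measure unitInterval).real {u | (Choice.half a B).draw (u : ℝ) = a} := by
  rw [show (1 : ℝ) / 2 = 1 / 2 - 0 by ring,
    ← volume_real_Ico (le_refl (0 : ℝ)) (by norm_num) (by norm_num)]
  refine measureReal_mono fun u hu => ?_
  simp only [mem_ofPred_eq, Choice.draw]
  rw [if_pos hu.2]

theorem volume_half_right {a k : Fin K} {B : Finset (Fin K)} (hk : k ∈ B) :
    (1 : ℝ) / (2 * B.card) ≤
      (volume : Measure unitInterval).real {u | (Choice.half a B).draw (u : ℝ) = k} := by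
  obtain ⟨c, hc, rfl⟩ := exists_listArm_eq hk
  have hS : (0 : ℝ) < B.card := by exact_mod_cast (Nat.zero_le c).trans_lt hc
  have h1 : ((c : ℝ) + 1) / B.card ≤ 1 := by
    rw [div_le_one hS]; exact_mod_cast hc
  have h0 : (0 : ℝ) ≤ c / B.card := by positivity
  -- The seeds in question are the preimage under u ↦ 2u - 1 of the interval that `pick` assigns to
  -- position `c`.
  rw [show (1 : ℝ) / (2 * B.card) = (1 + ((c : ℝ) + 1) / B.card) / 2 - (1 + c / B.card) / 2 by
      field_simp; ring,
    ← volume_real_Ico (by positivity) (by gcongr; linarith) (by linarith)]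
  refine measureReal_mono fun u hu => ?_
  have h2 := hu.1
  have h3 := hu.2
  simp only [mem_ofPred_eq, Choice.draw]
  rw [if_neg (by linarith)]
  exact pick_eq_of_mem_Ico hc ⟨by linarith, by linarith⟩

end Choices

end MPBandit

namespace MPBandit
open Set

/-! ## Rankings of arms -/

section Places

variable {K : ℕ}

theorem place_lt_place {m : Fin K → ℝ} {k l : Fin K} (h : m l < m k ∨ (m k = m l ∧ k < l)) :
    place m k < place m l := by
  refine Finset.card_lt_card ⟨fun i hi => ?_, fun hsub => ?_⟩
  · simp only [Finset.mem_filter, Finset.mem_univ, true_and] at hi ⊢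
    rcases h with h | ⟨h1, h2⟩ <;> rcases hi with hi | ⟨hi1, hi2⟩
    · exact Or.inl (h.trans hi)
    · exact Or.inl (by rwa [hi1])
    · exact Or.inl (by rwa [← h1])
    · exact Or.inr ⟨hi1.trans h1, hi2.trans h2⟩
  · have hk : k ∈ Finset.univ.filter fun i => m l < m i ∨ (m i = m l ∧ i < l) := by
      simp only [Finset.mem_filter, Finset.mem_univ, true_and]; exact h
    have := hsub hk
    simp at this

theorem place_le_imp {m : Fin K → ℝ} {k l : Fin K} (h : place m k ≤ place m l) : m l ≤ m k := by
  by_contra hlt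
  exact absurd (place_lt_place (Or.inl (not_le.1 hlt))) (not_lt.2 h)

theorem place_injective (m : Fin K → ℝ) : Function.Injective (place m) := by
  intro k l h
  by_contra hne
  rcases lt_trichotomy (m k) (m l) with h1 | h1 | h1
  · exact absurd (place_lt_place (Or.inl h1)) (by omega)
  · rcases lt_or_gt_of_ne hne with h2 | h2
    · exact absurd (place_lt_place (Or.inr ⟨h1, h2⟩)) (by omega)
    · exact absurd (place_lt_place (Or.inr ⟨h1.symm, h2⟩)) (by omega)
  · exact absurd (place_lt_place (Or.inl h1)) (by omega)

theorem place_lt (m : Fin K → ℝ) (k : Fin K) : place m k < K := by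
  have h : (Finset.univ.filter fun l => m k < m l ∨ (m l = m k ∧ l < k)) ⊂ Finset.univ := by
    refine Finset.filter_ssubset.2 ⟨k, Finset.mem_univ _, ?_⟩
    simp
  simpa [place] using Finset.card_lt_card h

theorem exists_place_eq (m : Fin K → ℝ) {r : ℕ} (hr : r < K) : ∃ k, place m k = r := by
  have hinj : Function.Injective fun k => (⟨place m k, place_lt m k⟩ : Fin K) := fun k l h =>
    place_injective m (Fin.mk.inj h)
  obtain ⟨k, hk⟩ := (Finite.injective_iff_surjective.1 hinj) ⟨r, hr⟩
  exact ⟨k, Fin.mk.inj hk⟩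

theorem mem_topArms {M : ℕ} {m : Fin K → ℝ} {k : Fin K} : k ∈ topArms M m ↔ place m k < M := by
  simp [topArms]

theorem card_topArms {M : ℕ} (hM : M ≤ K) (m : Fin K → ℝ) : (topArms M m).card = M := by
  have h : (topArms M m).map ⟨place m, place_injective m⟩ = Finset.range M := by
    ext r
    simp only [Finset.mem_map, Function.Embedding.coeFn_mk, Finset.mem_range, mem_topArms]
    constructor
    · rintro ⟨k, hk, rfl⟩; exact hk
    · intro hr
      obtain ⟨k, hk⟩ := exists_place_eq m (hr.trans_le hM)
      exact ⟨k, hk ▸ hr, hk⟩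
  rw [← Finset.card_map, h, Finset.card_range]

theorem le_of_mem_topArms {M : ℕ} {m : Fin K → ℝ} {k l : Fin K} (hk : k ∈ topArms M m)
    (hl : l ∉ topArms M m) : m l ≤ m k :=
  place_le_imp (by rw [mem_topArms] at hk hl; omega)

theorem exists_mem_sdiff_topArms {M : ℕ} (hM : M ≤ K) {m m' : Fin K → ℝ}
    (h : topArms M m ≠ topArms M m') :
    (∃ k ∈ topArms M m', k ∉ topArms M m) ∧ ∃ l ∈ topArms M m, l ∉ topArms M m' := by
  have hc : (topArms M m).card = (topArms M m').card := by rw [card_topArms hM, card_topArms hM]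
  constructor
  · by_contra! hh
    exact h (Finset.eq_of_subset_of_card_le (fun k hk => hh k hk) hc.le).symm
  · by_contra! hh
    exact h (Finset.eq_of_subset_of_card_le (fun k hk => hh k hk) hc.ge)

theorem place_sort {μ : Fin K → ℝ} (hμ : Function.Injective μ) (i : Fin K) :
    place μ (Tuple.sort (fun k => -μ k) i) = i.val := by
  set σ := Tuple.sort (fun k => -μ k) with hσ
  have hmono : StrictMono ((fun k => -μ k) ∘ σ) :=
    (Tuple.monotone_sort (fun k => -μ k)).strictMono_of_injective
      ((neg_injective.comp hμ).comp σ.injective)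
  have hiff : ∀ i', μ (σ i) < μ (σ i') ↔ i' < i := fun i' => by
    rw [← hmono.lt_iff_lt]; simp
  have h1 : (Finset.univ.filter fun l => μ (σ i) < μ l ∨ (μ l = μ (σ i) ∧ l < σ i)) =
      (Finset.univ.filter fun i' => i' < i).map σ.toEmbedding := by
    ext l
    simp only [Finset.mem_filter, Finset.mem_univ, true_and, Finset.mem_map,
      Equiv.coe_toEmbedding]
    constructor
    · rintro (h | ⟨h2, h3⟩)
      · exact ⟨σ.symm l, (hiff _).1 (by simpa using h), by simp⟩
      · exact absurd h3 (by rw [hμ h2]; simp)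
    · rintro ⟨i', hi', rfl⟩
      exact Or.inl ((hiff _).2 hi')
  rw [place, h1, Finset.card_map]
  have : (Finset.univ.filter fun i' => i' < i) = Finset.Iio i := by ext; simp
  rw [this, Fin.card_Iio]

theorem sortedMean_place {μ : Fin K → ℝ} (hμ : Function.Injective μ) (k : Fin K) :
    sortedMean μ ⟨place μ k, place_lt μ k⟩ = μ k := by
  unfold sortedMean
  congr 1
  exact place_injective μ (place_sort hμ _)

theorem sortedMean_eq {μ : Fin K → ℝ} (hμ : Function.Injective μ) {k : Fin K} {i : Fin K}
    (h : place μ k = i.val) : sortedMean μ i = μ k := by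
  rw [← sortedMean_place hμ k]
  congr 1
  exact Fin.ext h.symm

/-- Translates the sum over positions in the final bound into a sum over the arms outside the top
set, the form in which explorations are counted. -/
theorem sum_sortedMean_ge {μ : Fin K → ℝ} (hμ : Function.Injective μ) (M : ℕ) (F : ℝ → ℝ) :
    ∑ i ∈ Finset.univ.filter (fun i : Fin K => M ≤ i.val), F (sortedMean μ i) =
      ∑ k ∈ Finset.univ.filter (fun k => k ∉ topArms M μ), F (μ k) := by
  refine Finset.sum_equiv (Tuple.sort fun k => -μ k) (fun i => ?_) (fun i _ => rfl)
  simp [mem_topArms, place_sort hμ]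

theorem lt_of_place_lt {μ : Fin K → ℝ} (hμ : Function.Injective μ) {k l : Fin K}
    (h : place μ k < place μ l) : μ l < μ k :=
  lt_of_le_of_ne (place_le_imp h.le) fun he => by rw [hμ he] at h; exact lt_irrefl _ h

end Places

end MPBandit

namespace MPBandit
open Set

/-! ## Real-valued Kullback-Leibler divergence -/

/-- The Kullback-Leibler divergence between Bernoulli laws as a real number. -/
def klReal (p q : ℝ) : ℝ := p * Real.log (p / q) + (1 - p) * Real.log ((1 - p) / (1 - q))

theorem kl_eq_ofReal {p q : ℝ} (h0 : 0 < q) (h1 : q < 1) :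
    kl p q = ENNReal.ofReal (klReal p q) := by
  simp [kl, h0.ne', h1.ne, klReal]

theorem mul_log_div (p : ℝ) {q : ℝ} (hq : q ≠ 0) :
    p * Real.log (p / q) = p * Real.log p - p * Real.log q := by
  rcases eq_or_ne p 0 with rfl | hp
  · simp
  · rw [Real.log_div hp hq]; ring

theorem klReal_eq (p : ℝ) {q : ℝ} (h0 : 0 < q) (h1 : q < 1) :
    klReal p q = p * Real.log p + (1 - p) * Real.log (1 - p) - p * Real.log q -
      (1 - p) * Real.log (1 - q) := by
  rw [klReal, mul_log_div p h0.ne', mul_log_div (1 - p) (by linarith : (1 : ℝ) - q ≠ 0)]; ring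

theorem klReal_self (p : ℝ) (h0 : 0 < p) (h1 : p < 1) : klReal p p = 0 := by
  rw [klReal_eq p h0 h1]; ring

/-- Both terms are bounded by x log(x/y) ≥ x - y, and the two differences cancel. -/
theorem klReal_nonneg {p q : ℝ} (hp0 : 0 ≤ p) (hp1 : p ≤ 1) (h0 : 0 < q) (h1 : q < 1) :
    0 ≤ klReal p q := by
  have key : ∀ {x y : ℝ}, 0 ≤ x → 0 < y → x - y ≤ x * Real.log (x / y) := by
    intro x y hx hy
    rcases hx.eq_or_lt with rfl | hx
    · simpa using hy.le
    · have := Real.add_one_le_exp (Real.log (y / x))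
      rw [Real.exp_log (by positivity), Real.log_div hy.ne' hx.ne'] at this
      rw [Real.log_div hx.ne' hy.ne']
      have h2 : y / x * x = y := by field_simp
      nlinarith
  have h2 := key hp0 h0
  have h3 := key (x := 1 - p) (y := 1 - q) (by linarith) (by linarith)
  rw [klReal]; linarith

/-- The difference of the two sides is (q - p) times (log r - log q) + (log(1-q) - log(1-r)), a
product of nonnegative factors. The inequality provides monotonicity of the divergence in both
arguments and, in `measure_klIndex_deviation_le`, the extra exponent gained from slack. -/
theorem klReal_add_le {p q r : ℝ} (hpq : p ≤ q) (hqr : q ≤ r) (h0 : 0 < q)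
    (h1 : r < 1) : klReal p q + klReal q r ≤ klReal p r := by
  have hq1 : q < 1 := hqr.trans_lt h1
  have hr0 : 0 < r := h0.trans_le hqr
  rw [klReal_eq p h0 hq1, klReal_eq q hr0 h1, klReal_eq p hr0 h1]
  have h2 : Real.log q ≤ Real.log r := Real.log_le_log h0 hqr
  have h3 : Real.log (1 - r) ≤ Real.log (1 - q) := Real.log_le_log (by linarith) (by linarith)
  nlinarith [mul_nonneg (sub_nonneg.2 hpq) (sub_nonneg.2 h2),
    mul_nonneg (sub_nonneg.2 hpq) (sub_nonneg.2 h3)]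

theorem continuous_klReal_left {q : ℝ} (h0 : 0 < q) (h1 : q < 1) :
    Continuous fun p => klReal p q := by
  have h : (fun p => klReal p q) = fun p => p * Real.log p + (1 - p) * Real.log (1 - p) -
      p * Real.log q - (1 - p) * Real.log (1 - q) := funext fun p => klReal_eq p h0 h1
  rw [h]
  have h2 : Continuous fun p : ℝ => (1 - p) * Real.log (1 - p) :=
    Real.continuous_mul_log.comp (continuous_const.sub continuous_id)
  exact ((Real.continuous_mul_log.add h2).sub (by fun_prop)).sub (by fun_prop)

theorem klReal_pos {p q : ℝ} (hp0 : 0 < p) (hpq : p < q) (h1 : q < 1) : 0 < klReal p q := by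
  have key : ∀ {x y : ℝ}, 0 < x → 0 < y → x ≠ y → x - y < x * Real.log (x / y) := by
    intro x y hx hy hxy
    have h2 : Real.log (y / x) ≠ 0 := by
      rw [Real.log_div hy.ne' hx.ne']
      intro h
      exact hxy (Real.log_injOn_pos hx hy (by linarith))
    have := Real.add_one_lt_exp h2
    rw [Real.exp_log (by positivity), Real.log_div hy.ne' hx.ne'] at this
    rw [Real.log_div hx.ne' hy.ne']
    have h3 : y / x * x = y := by field_simp
    nlinarith
  have h2 := key hp0 (hp0.trans hpq) hpq.ne
  have h3 := key (x := 1 - p) (y := 1 - q) (by linarith) (by linarith) (by linarith)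
  rw [klReal]; linarith

/-! ## The kl-UCB index -/

/-- The exploration function `log t + 4 log log t`. -/
def explorationLevel (t : ℕ) : ℝ := Real.log t + 4 * Real.log (Real.log t)

theorem lt_of_klIndex_lt {n t : ℕ} {p q : ℝ} (h0 : 0 < q) (h1 : q < 1) (hf : 0 ≤ explorationLevel t)
    (h : klIndex n p t < q) : explorationLevel t < n * klReal p q := by
  by_contra hle
  rw [not_lt] at hle
  refine absurd h (not_lt.2 ?_)
  refine le_csSup ⟨1, fun x hx => hx.2.1⟩ ⟨h0.le, h1.le, ?_⟩
  rw [kl_eq_ofReal h0 h1, ← ENNReal.ofReal_natCast n, ← ENNReal.ofReal_mul (Nat.cast_nonneg n),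
    EReal.coe_ennreal_ofReal]
  -- The extended divergence is truncated at 0, so membership in the index set also needs a
  -- nonnegative exploration level.
  exact EReal.coe_le_coe_iff.2 (max_le hle hf)

/-- The slack between x and y gives an admissible q > x, so it does not matter whether the supremum
is attained. The value q = 1 is impossible since the divergence is infinite there; for q < 1 the
divergence increases in q and decreases in p below q. -/
theorem le_of_le_klIndex {n t : ℕ} (hn : n ≠ 0) {p p' x y : ℝ} (hp0 : 0 ≤ p) (hpp : p ≤ p')
    (hp' : 0 < p') (hpx : p' ≤ x) (hxy : x < y) (hx1 : x < 1) (h : y ≤ klIndex n p t) :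
    n * klReal p' x ≤ explorationLevel t := by
  have hx0 : 0 < x := hp'.trans_le hpx
  have hne : {q : ℝ | 0 ≤ q ∧ q ≤ 1 ∧ ((n * kl p q : ENNReal) : EReal) ≤
      ((Real.log t + 4 * Real.log (Real.log t) : ℝ) : EReal)}.Nonempty := by
    by_contra hne
    rw [not_nonempty_iff_eq_empty] at hne
    have : klIndex n p t = 0 := by rw [klIndex, hne, Real.sSup_empty]
    linarith
  obtain ⟨q, ⟨hq0, hq1, hq⟩, hxq⟩ := exists_lt_of_lt_csSup hne (hxy.trans_le h)
  have hp1 : p ≠ 1 := by linarith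
  rcases hq1.eq_or_lt with rfl | hq1
  · have : kl p 1 = ⊤ := by simp [kl, hp1]
    rw [this, ENNReal.mul_top (by exact_mod_cast hn)] at hq
    rw [EReal.coe_ennreal_top, top_le_iff] at hq
    exact absurd hq (EReal.coe_ne_top _)
  · have hq0' : 0 < q := hx0.trans hxq
    rw [kl_eq_ofReal hq0' hq1, ← ENNReal.ofReal_natCast n,
      ← ENNReal.ofReal_mul (Nat.cast_nonneg n), EReal.coe_ennreal_ofReal,
      EReal.coe_le_coe_iff] at hq
    have h1 : n * klReal p q ≤ explorationLevel t := (le_max_left _ _).trans hq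
    have h2 := klReal_add_le (hpp.trans hpx) hxq.le hx0 hq1
    have h3 := klReal_nonneg hx0.le hx1.le hq0' hq1
    have h4 := klReal_add_le hpp hpx hp' hx1
    have h5 := klReal_nonneg hp0 (by linarith) hp' (hpx.trans_lt hx1)
    have h6 : klReal p' x ≤ klReal p q := by linarith
    exact (mul_le_mul_of_nonneg_left h6 (Nat.cast_nonneg n)).trans h1

/-! ## Exponential moments of the qualities -/

/-- Once the exponential lies below an affine function on [0,1], only the mean of the law matters.
Therefore all concentration bounds hold for every law with the given mean. -/
theorem lintegral_exp_le_one {ν : Measure unitInterval} [IsProbabilityMeasure ν] {F : ℝ → ℝ}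
    {a b l : ℝ} (hF : ∀ x ∈ Icc (0 : ℝ) 1, Real.exp (F x) ≤ a + b * x)
    (hl : ∫ x : unitInterval, (x : ℝ) ∂ν = l) (h1 : a + b * l ≤ 1) :
    ∫⁻ x : unitInterval, ENNReal.ofReal (Real.exp (F x)) ∂ν ≤ 1 := by
  have hi : Integrable (fun x : unitInterval => (x : ℝ)) ν :=
    Integrable.of_bound measurable_subtype_coe.aestronglyMeasurable 1
      (Filter.Eventually.of_forall fun x => by rw [Real.norm_of_nonneg x.2.1]; exact x.2.2)
  have hi2 : Integrable (fun x : unitInterval => a + b * (x : ℝ)) ν :=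
    (integrable_const a).add (hi.const_mul b)
  calc ∫⁻ x : unitInterval, ENNReal.ofReal (Real.exp (F x)) ∂ν
      ≤ ∫⁻ x : unitInterval, ENNReal.ofReal (a + b * (x : ℝ)) ∂ν :=
        lintegral_mono fun x => ENNReal.ofReal_le_ofReal (hF x x.2)
    _ = ENNReal.ofReal (∫ x : unitInterval, (a + b * (x : ℝ)) ∂ν) := by
        rw [ofReal_integral_eq_lintegral_ofReal hi2 (Filter.Eventually.of_forall fun x =>
          (Real.exp_pos _).le.trans (hF x x.2))]
    _ ≤ 1 := by
        rw [integral_add (integrable_const a) (hi.const_mul b), integral_const_mul, hl]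
        simpa using h1

theorem lintegral_exp_centered_le_one {ν : Measure unitInterval} [IsProbabilityMeasure ν]
    {m l : ℝ} (hm : ∫ x : unitInterval, (x : ℝ) ∂ν = m) (hl : |l| ≤ 1) :
    ∫⁻ x : unitInterval, ENNReal.ofReal (Real.exp (l * x - (l * m + l ^ 2))) ∂ν ≤ 1 := by
  have hm0 : 0 ≤ m := hm ▸ integral_nonneg fun x => x.2.1
  have hm1 : m ≤ 1 := by
    rw [← hm]
    have := integral_mono_of_nonneg (μ := ν) (f := fun x : unitInterval => (x : ℝ)) (g := 1)
      (Filter.Eventually.of_forall fun x => x.2.1) (integrable_const 1)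
      (Filter.Eventually.of_forall fun x => x.2.2)
    simpa using this
  -- The coefficients come from exp(y) ≤ 1 + y + y² at y = l (x - m), with y² replaced by l².
  refine lintegral_exp_le_one (F := fun x => l * x - (l * m + l ^ 2))
    (a := Real.exp (-l ^ 2) * (1 - l * m + l ^ 2)) (b := Real.exp (-l ^ 2) * l)
    (fun x hx => ?_) hm ?_
  · have h1 : |l * (x - m)| ≤ 1 := by
      rw [abs_mul]
      have : |x - m| ≤ 1 := abs_le.2 ⟨by linarith [hx.1], by linarith [hx.2]⟩
      nlinarith [abs_nonneg l, abs_nonneg (x - m)]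
    have h2 := exp_le_one_add_add_sq h1
    have h3 : (l * (x - m)) ^ 2 ≤ l ^ 2 := by
      have : (x - m) ^ 2 ≤ 1 := by nlinarith [hx.1, hx.2]
      nlinarith [sq_nonneg l]
    rw [show l * x - (l * m + l ^ 2) = -l ^ 2 + l * (x - m) by ring, Real.exp_add]
    nlinarith [Real.exp_pos (-l ^ 2)]
  · have h2 := Real.add_one_le_exp (l ^ 2)
    have h3 : Real.exp (-l ^ 2) * Real.exp (l ^ 2) = 1 := by rw [← Real.exp_add]; simp
    nlinarith [Real.exp_pos (-l ^ 2)]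

/-- Convexity gives exp(lx) ≤ 1 - x + x exp(l) on [0,1], so a law on [0,1] is dominated by the
Bernoulli law with its mean. For l ≤ 0 that moment decreases in the mean, so any q ≤ m may be used.
-/
theorem lintegral_exp_bernoulli_le_one {ν : Measure unitInterval} [IsProbabilityMeasure ν]
    {m l q : ℝ} (hm : ∫ x : unitInterval, (x : ℝ) ∂ν = m) (hl : l ≤ 0) (h0 : 0 < q) (h1 : q < 1)
    (hq : q ≤ m) :
    ∫⁻ x : unitInterval, ENNReal.ofReal
      (Real.exp (l * x - Real.log (1 - q + q * Real.exp l))) ∂ν ≤ 1 := by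
  have hp : 0 < 1 - q + q * Real.exp l := by
    have := Real.exp_pos l
    nlinarith [mul_pos h0 this]
  have hel : Real.exp l ≤ 1 := Real.exp_le_one_iff.2 hl
  refine lintegral_exp_le_one (F := fun x => l * x - Real.log (1 - q + q * Real.exp l))
    (a := (1 - q + q * Real.exp l)⁻¹) (b := (1 - q + q * Real.exp l)⁻¹ * (Real.exp l - 1))
    (fun x hx => ?_) hm ?_
  · have hc := convexOn_exp.2 (mem_univ (0 : ℝ)) (mem_univ l) (sub_nonneg.2 hx.2) hx.1 (by ring)
    simp only [smul_eq_mul, mul_zero, zero_add, Real.exp_zero, mul_one] at hc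
    rw [sub_eq_neg_add, Real.exp_add, Real.exp_neg, Real.exp_log hp, mul_comm l x]
    have h2 : 0 < (1 - q + q * Real.exp l)⁻¹ := inv_pos.2 hp
    nlinarith
  · rw [mul_assoc, ← mul_one_add, inv_mul_le_iff₀ hp]
    nlinarith

/-- The witness is the optimal exponential tilt for lower deviations of a Bernoulli variable with
mean q; it is nonpositive because x ≤ q. -/
theorem klReal_eq_chernoff {x q : ℝ} (hx0 : 0 < x) (hxq : x ≤ q) (h1 : q < 1) :
    ∃ l ≤ (0 : ℝ), l * x - Real.log (1 - q + q * Real.exp l) = klReal x q := by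
  have hq0 : 0 < q := hx0.trans_le hxq
  have hx1 : 0 < 1 - x := by linarith
  have hq1 : 0 < 1 - q := by linarith
  refine ⟨Real.log (x * (1 - q) / (q * (1 - x))), Real.log_nonpos (by positivity) ?_, ?_⟩
  · rw [div_le_one (by positivity)]; nlinarith
  · rw [Real.exp_log (by positivity)]
    have h2 : 1 - q + q * (x * (1 - q) / (q * (1 - x))) = (1 - q) / (1 - x) := by
      field_simp; ring
    rw [h2, klReal_eq x hq0 h1, Real.log_div (by positivity) (by positivity),
      Real.log_mul hx0.ne' hq1.ne', Real.log_mul hq0.ne' hx1.ne', Real.log_div hq1.ne' hx1.ne']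
    ring

open Filter Topology in
-- Makes it possible to choose δ so small that the exploration constant is almost the ideal one. If
-- q = 1, the divergence blows up like -(1-p) log(2δ), which matches the convention that the summand
-- is then 0.
theorem tendsto_gap_div_klReal {p q : ℝ} (hp : 0 < p) (hpq : p < q) (hq : q ≤ 1) :
    Tendsto (fun δ => (q - p) / klReal (p + δ) (q - 2 * δ)) (𝓝[>] 0)
      (𝓝 (ENNReal.ofReal (q - p) / kl p q).toReal) := by
  have hq0 : 0 < q := hp.trans hpq
  have hgap : 0 < q - p := sub_pos.2 hpq
  rcases hq.lt_or_eq with hq1 | rfl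
  · have hv : (ENNReal.ofReal (q - p) / kl p q).toReal = (q - p) / klReal (p + 0) (q - 2 * 0) := by
      rw [kl_eq_ofReal hq0 hq1, ENNReal.toReal_div, ENNReal.toReal_ofReal hgap.le,
        ENNReal.toReal_ofReal (klReal_pos hp hpq hq1).le]
      simp
    rw [hv]
    have hpos : klReal (p + 0) (q - 2 * 0) ≠ 0 := by simpa using (klReal_pos hp hpq hq1).ne'
    have hc : ContinuousAt (fun δ : ℝ => (q - p) / klReal (p + δ) (q - 2 * δ)) 0 := by
      refine continuousAt_const.div ?_ hpos
      unfold klReal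
      have h1 : ContinuousAt (fun δ : ℝ => p + δ) 0 := by fun_prop
      have h2 : ContinuousAt (fun δ : ℝ => q - 2 * δ) 0 := by fun_prop
      have h3 : ContinuousAt (fun δ : ℝ => 1 - (p + δ)) 0 := by fun_prop
      have h4 : ContinuousAt (fun δ : ℝ => 1 - (q - 2 * δ)) 0 := by fun_prop
      have e2 : q - 2 * 0 ≠ 0 := by simpa using hq0.ne'
      have e4 : 1 - (q - 2 * 0) ≠ 0 := by simpa using (sub_pos.2 hq1).ne'
      have e1 : p + 0 ≠ 0 := by simpa using hp.ne'
      have e3 : 1 - (p + 0) ≠ 0 := by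
        have : (0 : ℝ) < 1 - p := by linarith
        simpa using this.ne'
      exact (h1.mul ((h1.div h2 e2).log (div_ne_zero e1 e2))).add
        (h3.mul ((h3.div h4 e4).log (div_ne_zero e3 e4)))
    exact hc.tendsto.mono_left nhdsWithin_le_nhds
  · have hk : kl p 1 = ⊤ := by simp [kl, hpq.ne]
    rw [hk, ENNReal.div_top, ENNReal.toReal_zero]
    refine Tendsto.const_div_atTop ?_ _
    have h1 : Tendsto (fun δ : ℝ => 2 * δ) (𝓝[>] 0) (𝓝[>] 0) := by
      refine tendsto_nhdsWithin_iff.2 ⟨?_, ?_⟩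
      · have : Tendsto (fun δ : ℝ => 2 * δ) (𝓝 0) (𝓝 (2 * 0)) :=
        (show Continuous fun δ : ℝ => 2 * δ by fun_prop).tendsto 0
        rw [mul_zero] at this
        exact this.mono_left nhdsWithin_le_nhds
      · filter_upwards [self_mem_nhdsWithin] with δ hδ
        have : (0 : ℝ) < δ := hδ
        exact mem_Ioi.2 (by linarith)
    have h2 : Tendsto (fun δ : ℝ => -Real.log (2 * δ)) (𝓝[>] 0) atTop :=
      tendsto_neg_atBot_atTop.comp (Real.tendsto_log_nhdsGT_zero.comp h1)
    have h3 : Tendsto (fun δ : ℝ => 1 - (p + δ)) (𝓝[>] 0) (𝓝 (1 - (p + 0))) :=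
      (show ContinuousAt (fun δ : ℝ => 1 - (p + δ)) 0 by fun_prop).tendsto.mono_left
        nhdsWithin_le_nhds
    have h4 := Tendsto.pos_mul_atTop (by linarith : 0 < 1 - (p + 0)) h3 h2
    have h5 : Tendsto (fun δ : ℝ => (p + δ) * Real.log (p + δ) +
        (1 - (p + δ)) * Real.log (1 - (p + δ)) - (p + δ) * Real.log (1 - 2 * δ)) (𝓝[>] 0)
        (𝓝 ((p + 0) * Real.log (p + 0) +
        (1 - (p + 0)) * Real.log (1 - (p + 0)) - (p + 0) * Real.log (1 - 2 * 0))) := by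
      have hc : ContinuousAt (fun δ : ℝ => (p + δ) * Real.log (p + δ) +
          (1 - (p + δ)) * Real.log (1 - (p + δ)) - (p + δ) * Real.log (1 - 2 * δ)) 0 := by
        have h1 : ContinuousAt (fun δ : ℝ => p + δ) 0 := by fun_prop
        have h3 : ContinuousAt (fun δ : ℝ => 1 - (p + δ)) 0 := by fun_prop
        have h4 : ContinuousAt (fun δ : ℝ => 1 - 2 * δ) 0 := by fun_prop
        exact ((h1.mul (h1.log (by simpa using hp.ne'))).add
          (h3.mul (h3.log (by simpa using (sub_pos.2 hpq).ne')))).sub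
          (h1.mul (h4.log (by simp)))
      exact hc.tendsto.mono_left nhdsWithin_le_nhds
    refine (h5.add_atTop h4).congr' ?_
    filter_upwards [Ioo_mem_nhdsGT (show (0 : ℝ) < 1 / 2 by norm_num)] with δ hδ
    rw [klReal_eq (p + δ) (by linarith [hδ.2]) (by linarith [hδ.1])]
    rw [show 1 - (1 - 2 * δ) = 2 * δ by ring]
    ring

end MPBandit

namespace MPBandit
open Set

/-! ## Empirical statistics of one player -/

section Statistics

variable {K M : ℕ}

/-- The number of pulls of `k` by player `i` in the first `n` rounds. -/
def pulls (s : Fin M → Strategy K) (i : Fin M) (k : Fin K) (n : ℕ) (ω : ℕ → Draw K M) : ℕ :=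
  ((Finset.range n).filter fun r => actions s ω r i = k).card

/-- The sum of the qualities of `k` observed by player `i` in the first `n` rounds. -/
def pullSum (s : Fin M → Strategy K) (i : Fin M) (k : Fin K) (n : ℕ) (ω : ℕ → Draw K M) : ℝ :=
  ∑ r ∈ Finset.range n, if actions s ω r i = k then ((ω r).1 k : ℝ) else 0

/-- The empirical mean of `k` for player `i` after `n` rounds. -/
def pullMean (s : Fin M → Strategy K) (i : Fin M) (k : Fin K) (n : ℕ) (ω : ℕ → Draw K M) : ℝ :=
  pullSum s i k n ω / pulls s i k n ω

variable {s : Fin M → Strategy K} {i : Fin M} {k : Fin K}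

theorem sum_fin_lt {t u : ℕ} (hu : u ≤ t + 1) (f : ℕ → ℝ) :
    (∑ r : Fin t, if r.val + 1 < u then f r.val else 0) = ∑ r ∈ Finset.range (u - 1), f r := by
  rw [Fin.sum_univ_eq_sum_range (fun r => if r + 1 < u then f r else 0) t, ← Finset.sum_filter]
  refine Finset.sum_congr ?_ fun _ _ => rfl
  ext r; simp only [Finset.mem_filter, Finset.mem_range]; omega

theorem card_fin_filter {t u : ℕ} (hu : u ≤ t) (p : ℕ → Prop) [DecidablePred p] :
    (Finset.univ.filter fun r : Fin t => r.val < u ∧ p r.val).card =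
      ((Finset.range u).filter p).card := by
  rw [← Finset.card_map Fin.valEmbedding]
  congr 1
  ext r
  simp only [Finset.mem_map, Finset.mem_filter, Finset.mem_univ, true_and, Fin.valEmbedding_apply,
    Finset.mem_range]
  constructor
  · rintro ⟨a, h, rfl⟩; exact h
  · intro h; exact ⟨⟨r, by omega⟩, h, rfl⟩

theorem pullCount_history (ω : ℕ → Draw K M) {t u : ℕ} (hu : u ≤ t + 1) :
    pullCount (history s ω i t) u k = pulls s i k (u - 1) ω := by
  rw [pulls, ← card_fin_filter (t := t) (by omega)]
  unfold pullCount
  congr 1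
  ext r
  rw [Finset.mem_filter, Finset.mem_filter]
  simp only [Finset.mem_univ, true_and, history, observe]
  exact and_congr_left fun _ => by omega

theorem empMean_history (ω : ℕ → Draw K M) {t u : ℕ} (hu : u ≤ t + 1) :
    empMean (history s ω i t) u k = pullMean s i k (u - 1) ω := by
  rw [pullMean, empMean, pullCount_history ω hu, pullSum, ← sum_fin_lt hu]
  congr 1
  refine Finset.sum_congr rfl fun r _ => ?_
  simp only [history, observe]
  by_cases h1 : r.val + 1 < u
  · by_cases h2 : actions s ω r.val i = k
    · simp [h1, h2]
    · simp [h1, h2]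
  · simp [h1]

theorem pulls_succ (n : ℕ) (ω : ℕ → Draw K M) :
    pulls s i k (n + 1) ω = pulls s i k n ω + if actions s ω n i = k then 1 else 0 := by
  unfold pulls
  rw [Finset.range_add_one, Finset.filter_insert]
  split_ifs with h
  · rw [Finset.card_insert_of_notMem (by simp)]
  · rfl

theorem pulls_mono (ω : ℕ → Draw K M) : Monotone fun n => pulls s i k n ω := fun _ _ h =>
  Finset.card_le_card (Finset.filter_subset_filter _ (Finset.range_mono h))

theorem pulls_lt {n n' t : ℕ} {ω : ℕ → Draw K M} (h1 : n ≤ t) (h2 : t < n')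
    (h : actions s ω t i = k) : pulls s i k n ω < pulls s i k n' ω := by
  have h3 : pulls s i k (t + 1) ω = pulls s i k t ω + 1 := by rw [pulls_succ, if_pos h]
  have h4 : pulls s i k n ω ≤ pulls s i k t ω := pulls_mono ω h1
  have h5 : pulls s i k (t + 1) ω ≤ pulls s i k n' ω := pulls_mono ω h2
  omega

theorem measurableSet_actions_eq (s : Fin M → Strategy K) (t : ℕ) (i : Fin M) (k : Fin K) :
    MeasurableSet {ω : ℕ → Draw K M | actions s ω t i = k} :=
  ((measurable_pi_apply i).comp (measurable_actions s t)) (measurableSet_singleton k)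

theorem measurable_pulls (s : Fin M → Strategy K) (i : Fin M) (k : Fin K) (n : ℕ) :
    Measurable (pulls s i k n) := by
  induction n with
  | zero => exact measurable_const
  | succ n ih =>
    have : pulls s i k (n + 1) = fun ω => pulls s i k n ω + if actions s ω n i = k then 1 else 0 :=
      funext fun ω => pulls_succ n ω
    rw [this]
    exact ih.add (Measurable.ite (measurableSet_actions_eq s n i k) measurable_const
      measurable_const)

theorem measurable_pullSum (s : Fin M → Strategy K) (i : Fin M) (k : Fin K) (n : ℕ) :
    Measurable (pullSum s i k n) :=
  Finset.measurable_sum _ fun r _ => Measurable.ite (measurableSet_actions_eq s r i k)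
    (by fun_prop) measurable_const

theorem measurable_pullMean (s : Fin M → Strategy K) (i : Fin M) (k : Fin K) (n : ℕ) :
    Measurable (pullMean s i k n) :=
  (measurable_pullSum s i k n).div (measurable_from_nat.comp (measurable_pulls s i k n))

theorem dependsBefore_pulls (s : Fin M → Strategy K) (i : Fin M) (k : Fin K) (n : ℕ) :
    DependsBefore n (pulls s i k n) := fun r hr ω x => by
  unfold pulls
  congr 1
  refine Finset.filter_congr fun q hq => ?_
  have h : actions s (Function.update ω r x) q = actions s ω q :=
    dependsBefore_actions s q r (by have := Finset.mem_range.1 hq; omega) ω x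
  rw [h]

theorem dependsBefore_pullSum (s : Fin M → Strategy K) (i : Fin M) (k : Fin K) (n : ℕ) :
    DependsBefore n (pullSum s i k n) := fun r hr ω x => by
  unfold pullSum
  refine Finset.sum_congr rfl fun q hq => ?_
  have hq' := Finset.mem_range.1 hq
  have h : actions s (Function.update ω r x) q = actions s ω q :=
    dependsBefore_actions s q r (by omega) ω x
  rw [h, Function.update_of_ne (by omega)]

theorem dependsBefore_pullMean (s : Fin M → Strategy K) (i : Fin M) (k : Fin K) (n : ℕ) :
    DependsBefore n (pullMean s i k n) := fun r hr ω x => by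
  unfold pullMean
  rw [dependsBefore_pulls s i k n r hr ω x, dependsBefore_pullSum s i k n r hr ω x]

theorem pullSum_nonneg (n : ℕ) (ω : ℕ → Draw K M) : 0 ≤ pullSum s i k n ω :=
  Finset.sum_nonneg fun r _ => by
    split_ifs
    · exact ((ω r).1 k).2.1
    · exact le_rfl

theorem pullMean_nonneg (n : ℕ) (ω : ℕ → Draw K M) : 0 ≤ pullMean s i k n ω :=
  div_nonneg (pullSum_nonneg n ω) (Nat.cast_nonneg _)

/-! ## Deviations of the empirical means -/

theorem lintegral_roundLaw_le {ν : Fin K → ProbabilityMeasure unitInterval}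
    {f : Draw K M → ENNReal} (hf : Measurable f)
    (h : ∀ u, ∫⁻ x, f (x, u) ∂(Measure.pi fun k => (ν k : Measure unitInterval)) ≤ 1) :
    ∫⁻ x, f x ∂(roundLaw ν M) ≤ 1 := by
  unfold roundLaw
  rw [lintegral_prod_symm _ hf.aemeasurable]
  calc _ ≤ ∫⁻ _, 1 ∂(Measure.pi fun _ : Fin M => (volume : Measure unitInterval)) :=
        lintegral_mono h
    _ = 1 := by simp

/-- The exponential supermartingale is stopped at the `c`-th pull. Afterwards it is constant, so at
time `H` it still has its value at each time `n` with exactly `c` pulls; no union over `n` is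
needed, and the bound does not depend on `H`. -/
theorem measure_exists_pullSum_le {ν : Fin K → ProbabilityMeasure unitInterval} {l φ : ℝ}
    (hl : ∫⁻ x : unitInterval, ENNReal.ofReal (Real.exp (l * x - φ))
      ∂(ν k : Measure unitInterval) ≤ 1) (H c : ℕ) (b : ℝ) :
    gameLaw ν M {ω | ∃ n ≤ H, pulls s i k n ω = c ∧ b ≤ l * pullSum s i k n ω - c * φ} ≤
      ENNReal.ofReal (Real.exp (-b)) := by
  classical
  have hmS : ∀ t, MeasurableSet {ω : ℕ → Draw K M | actions s ω t i = k ∧ pulls s i k t ω < c} :=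
    fun t => (measurableSet_actions_eq s t i k).inter
      (measurableSet_lt (measurable_pulls s i k t) measurable_const)
  -- The condition on the number of earlier pulls is the stopping rule: only the first `c` pulls
  -- contribute.
  set g : ℕ → (ℕ → Draw K M) → ℝ := fun t ω =>
    if actions s ω t i = k ∧ pulls s i k t ω < c then l * (ω t).1 k - φ else 0 with hg
  have hgm : ∀ t, Measurable (g t) := fun t =>
    Measurable.ite (hmS t) (by fun_prop) measurable_const
  have hgd : ∀ t, DependsBefore (t + 1) (g t) := fun t r hr ω x => by
    have h1 : actions s (Function.update ω r x) t = actions s ω t :=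
      dependsBefore_actions s t r hr ω x
    have h2 := dependsBefore_pulls s i k t r (by omega) ω x
    simp only [hg, h1, h2]
    rw [Function.update_of_ne (by omega)]
  refine (measure_mono ?_).trans (measure_sum_ge_le (D := roundLaw ν M) hgm hgd ?_ H b)
  · rintro ω ⟨n, hn, hc, hb⟩
    refine hb.trans (le_of_eq ?_)
    have hsub : Finset.range n ⊆ Finset.range H := Finset.range_mono hn
    rw [← Finset.sum_subset hsub fun t _ ht => ?_]
    · have h1 : ∀ t ∈ Finset.range n, g t ω =
          l * (if actions s ω t i = k then ((ω t).1 k : ℝ) else 0) -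
            (if actions s ω t i = k then 1 else 0) * φ := fun t ht => by
        simp only [hg]
        by_cases ha : actions s ω t i = k
        · have : pulls s i k t ω < c := hc ▸ pulls_lt le_rfl (Finset.mem_range.1 ht) ha
          simp [ha, this]
        · simp [ha]
      rw [Finset.sum_congr rfl h1, Finset.sum_sub_distrib, ← Finset.mul_sum, ← Finset.sum_mul,
        Finset.sum_boole, ← hc]
      rfl
    · simp only [hg]
      rw [if_neg]
      rintro ⟨_, h2⟩
      have h3 : pulls s i k n ω ≤ pulls s i k t ω := pulls_mono ω (by simpa using ht)
      omega
  · intro t ω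
    have hst := measurable_stepArm s ω i t
    have hgu : ∀ x : Draw K M, g t (Function.update ω t x) =
        if stepArm s ω t i (x.2 i) = k ∧ pulls s i k t ω < c then l * x.1 k - φ else 0 :=
      fun x => by
        simp only [hg, actions_update, dependsBefore_pulls s i k t t le_rfl ω x,
          Function.update_self]
    refine lintegral_roundLaw_le
      (((Real.measurable_exp.comp ((hgm t).comp (measurable_update ω)))).ennreal_ofReal)
      fun u => ?_
    simp only [hgu]
    by_cases hu : stepArm s ω t i (u i) = k ∧ pulls s i k t ω < c
    · simp only [hu, if_true, and_self]
      have hmf : Measurable fun x : unitInterval =>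
          ENNReal.ofReal (Real.exp (l * (x : ℝ) - φ)) := by fun_prop
      have := (measurePreserving_eval (fun k => (ν k : Measure unitInterval)) k).lintegral_comp hmf
      exact this.le.trans hl
    · simp [if_neg hu]

theorem measure_exists_deviation_le {ν : Fin K → ProbabilityMeasure unitInterval} {m δ : ℝ}
    (hm : ∫ x : unitInterval, (x : ℝ) ∂(ν k : Measure unitInterval) = m) (hδ : 0 < δ)
    (hδ1 : δ ≤ 1) (H c : ℕ) (hc : c ≠ 0) :
    gameLaw ν M {ω | ∃ n ≤ H, pulls s i k n ω = c ∧ δ ≤ |pullMean s i k n ω - m|} ≤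
      ENNReal.ofReal (2 * Real.exp (-(c * (δ ^ 2 / 4)))) := by
  -- The tilt ±δ/2 maximizes lδ - l², with value δ²/4.
  have hl1 : |δ / 2| ≤ 1 := by rw [abs_of_pos (by positivity)]; linarith
  have hl2 : |-(δ / 2)| ≤ 1 := by rwa [abs_neg]
  have h1 := measure_exists_pullSum_le (s := s) (i := i) (lintegral_exp_centered_le_one hm hl1) H c
    (c * (δ ^ 2 / 4))
  have h2 := measure_exists_pullSum_le (s := s) (i := i) (lintegral_exp_centered_le_one hm hl2) H c
    (c * (δ ^ 2 / 4))
  rw [two_mul, ENNReal.ofReal_add (Real.exp_pos _).le (Real.exp_pos _).le]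
  refine (measure_mono ?_).trans ((measure_union_le _ _).trans (add_le_add h1 h2))
  rintro ω ⟨n, hn, hcn, hd⟩
  have hc0 : (0 : ℝ) < c := by exact_mod_cast Nat.pos_of_ne_zero hc
  have hS : pullSum s i k n ω = c * pullMean s i k n ω := by
    rw [pullMean, hcn]; field_simp
  rcases le_abs'.1 hd with h | h
  · right
    refine ⟨n, hn, hcn, ?_⟩
    rw [hS]
    nlinarith [mul_le_mul_of_nonneg_left h (mul_nonneg hc0.le (half_pos hδ).le)]
  · left
    refine ⟨n, hn, hcn, ?_⟩
    rw [hS]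
    nlinarith [mul_le_mul_of_nonneg_left h (mul_nonneg hc0.le (half_pos hδ).le)]

/-- A sub-optimal kl-UCB index of an arm with mean at least `q'` is unlikely. -/
theorem measure_klIndex_deviation_le {ν : Fin K → ProbabilityMeasure unitInterval} {m q q' f : ℝ}
    (hm : ∫ x : unitInterval, (x : ℝ) ∂(ν k : Measure unitInterval) = m) (hq0 : 0 < q)
    (hqq : q ≤ q') (hq1 : q' < 1) (hqm : q' ≤ m) (hf : 0 < f) (n c : ℕ) (hc : c ≠ 0) :
    gameLaw ν M {ω | pulls s i k n ω = c ∧ pullMean s i k n ω ≤ q ∧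
        f < c * klReal (pullMean s i k n ω) q} ≤
      ENNReal.ofReal (Real.exp (-(f + c * klReal q q'))) := by
  have hc0 : (0 : ℝ) < c := by exact_mod_cast Nat.pos_of_ne_zero hc
  have hq1' : q < 1 := hqq.trans_lt hq1
  rcases le_or_gt (c * klReal 0 q) f with h0 | h0
  · refine (measure_mono_null ?_ measure_empty).le.trans zero_le
    rintro ω ⟨h1, h2, h3⟩
    have h4 : klReal (pullMean s i k n ω) q ≤ klReal 0 q := by
      have hp := pullMean_nonneg (s := s) (i := i) (k := k) n ω
      rcases hp.eq_or_lt with he | hp'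
      · rw [he]
      · have h5 := klReal_add_le hp h2 hp' hq1'
        have h6 := klReal_nonneg le_rfl zero_le_one hp' (h2.trans_lt hq1')
        linarith
    exact absurd (h3.trans_le (mul_le_mul_of_nonneg_left h4 hc0.le)) (not_lt.2 h0)
  · have hcont : ContinuousOn (fun x => c * klReal x q) (Icc 0 q) :=
      (continuous_const.mul (continuous_klReal_left hq0 hq1')).continuousOn
    -- The level `x` satisfies c kl(x, q) = f, so the event says that the empirical mean is at most
    -- `x`. The Chernoff bound is then taken relative to the larger mean q', whose exponent c kl(x,
    -- q') is at least f + c kl(q, q').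
    obtain ⟨x, hx, hxf⟩ := intermediate_value_Icc' hq0.le hcont
      (show f ∈ Icc (c * klReal q q) (c * klReal 0 q) from
        ⟨by rw [klReal_self q hq0 hq1', mul_zero]; exact hf.le, h0.le⟩)
    simp only at hxf
    have hx0 : 0 < x := by
      rcases hx.1.eq_or_lt with rfl | h
      · linarith
      · exact h
    obtain ⟨l, hl, hlx⟩ := klReal_eq_chernoff hx0 (hx.2.trans hqq) hq1
    have hq0' : 0 < q' := hq0.trans_le hqq
    have hmain := measure_exists_pullSum_le (s := s) (i := i)
      (lintegral_exp_bernoulli_le_one hm hl hq0' hq1 hqm) n c (c * klReal x q')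
    refine (measure_mono ?_).trans (hmain.trans (ENNReal.ofReal_le_ofReal
      (Real.exp_le_exp.2 ?_)))
    · rintro ω ⟨h1, h2, h3⟩
      refine ⟨n, le_rfl, h1, ?_⟩
      have hS : pullSum s i k n ω = c * pullMean s i k n ω := by
        rw [pullMean, h1]; field_simp
      have hmx : pullMean s i k n ω ≤ x := by
        by_contra hlt
        rw [not_le] at hlt
        have hp' := hx0.trans hlt
        have h5 := klReal_add_le hlt.le h2 hp' hq1'
        have h6 := klReal_nonneg hx0.le (hx.2.trans hq1'.le) hp' (h2.trans_lt hq1')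
        have h7 : klReal (pullMean s i k n ω) q ≤ klReal x q := by linarith
        have h8 := mul_le_mul_of_nonneg_left h7 hc0.le
        linarith
      rw [hS, ← hlx]
      have := mul_le_mul_of_nonpos_left hmx hl
      nlinarith
    · have h5 := klReal_add_le hx.2 hqq hq0 hq1
      have h6 := mul_le_mul_of_nonneg_left h5 hc0.le
      linarith

/-! ## Rounds in which a badly estimated arm is likely to be pulled -/

theorem roundLaw_seed (ν : Fin K → ProbabilityMeasure unitInterval) (i : Fin M)
    {A : Set unitInterval} (hA : MeasurableSet A) :
    roundLaw ν M {x | x.2 i ∈ A} = volume A := by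
  have h1 : MeasurePreserving (fun x : Draw K M => x.2 i) (roundLaw ν M) volume :=
    (measurePreserving_eval (fun _ : Fin M => (volume : Measure unitInterval)) i).comp
      measurePreserving_snd
  exact h1.measure_preimage hA.nullMeasurableSet

/-- The event `A` is decided before the round, so integrating over the seed of that round alone
gives a factor of at least ρ at each point of `A`. -/
theorem mul_measure_le_measure_inter (ν : Fin K → ProbabilityMeasure unitInterval)
    (s : Fin M → Strategy K) (i : Fin M) (k : Fin K) {t : ℕ} {A : Set (ℕ → Draw K M)}
    (hA : MeasurableSet A) (hAd : DependsBefore t fun ω => ω ∈ A) {ρ : ℝ}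
    (hρ : ∀ ω ∈ A, ρ ≤ pullProb s t i k ω) :
    ENNReal.ofReal ρ * gameLaw ν M A ≤ gameLaw ν M (A ∩ {ω | actions s ω t i = k}) := by
  have hB := hA.inter (measurableSet_actions_eq s t i k)
  rw [← lintegral_indicator_one hB, gameLaw_eq, lintegral_update (D := roundLaw ν M) t
    (measurable_one.indicator hB), ← setLIntegral_const, ← lintegral_indicator hA]
  refine lintegral_mono fun ω => ?_
  by_cases hω : ω ∈ A
  · rw [Set.indicator_of_mem hω]
    have h1 : ∀ x, (A ∩ {ω | actions s ω t i = k}).indicator (1 : (ℕ → Draw K M) → ENNReal)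
        (Function.update ω t x) =
        ({x : Draw K M | x.2 i ∈ {u | stepArm s ω t i u = k}}).indicator 1 x := fun x => by
      have h2 : Function.update ω t x ∈ A := (iff_of_eq (hAd t le_rfl ω x)).2 hω
      have h3 : Function.update ω t x ∈ {ω | actions s ω t i = k} ↔
          x.2 i ∈ {u | stepArm s ω t i u = k} := by
        simp only [mem_ofPred_eq, actions_update]
      by_cases h4 : x.2 i ∈ {u | stepArm s ω t i u = k}
      · rw [Set.indicator_of_mem (show _ ∈ A ∩ _ from ⟨h2, h3.2 h4⟩), Set.indicator_of_mem (by exact h4)]; rfl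
      · rw [Set.indicator_of_notMem (show _ ∉ A ∩ _ from fun h => h4 (h3.1 h.2)),
          Set.indicator_of_notMem (by exact h4)]
    have hm : MeasurableSet {u | stepArm s ω t i u = k} :=
      measurable_stepArm s ω i t (measurableSet_singleton k)
    have hm2 : MeasurableSet {x : Draw K M | x.2 i ∈ {u | stepArm s ω t i u = k}} :=
      (show Measurable fun x : Draw K M => x.2 i by fun_prop) hm
    simp only [h1]
    rw [lintegral_indicator_one hm2, roundLaw_seed ν i hm]
    exact ENNReal.ofReal_le_of_le_toReal (hρ ω hω)
  · rw [Set.indicator_of_notMem hω]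
    exact zero_le

/-- After round `t` (with statistics from the last multiple of `L`), the empirical mean of `k` is
off by `δ`, although `k` is pulled in round `t + 1` with probability at least `ρ`. -/
def deviantSet (s : Fin M → Strategy K) (i : Fin M) (k : Fin K) (L : ℕ) (m δ ρ : ℝ) (t : ℕ) :
    Set (ℕ → Draw K M) :=
  {ω | pulls s i k (lastUpdate L (t + 1) - 1) ω ≠ 0 ∧
    δ ≤ |pullMean s i k (lastUpdate L (t + 1) - 1) ω - m| ∧ ρ ≤ pullProb s t i k ω}

theorem lastUpdate_le (L t : ℕ) : lastUpdate L t ≤ t := Nat.mul_div_le t L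

theorem measurableSet_deviantSet (L : ℕ) (m δ ρ : ℝ) (t : ℕ) :
    MeasurableSet (deviantSet s i k L m δ ρ t) := by
  refine MeasurableSet.inter ?_ (MeasurableSet.inter ?_ ?_)
  · exact (measurable_pulls s i k _) (measurableSet_singleton 0).compl
  · exact measurableSet_le measurable_const
      (((measurable_pullMean s i k _).sub_const m).abs)
  · exact measurableSet_le measurable_const (measurable_pullProb s t i k)

/-- A misjudged arm corrects itself. Each deviant round produces a pull with conditional probability
at least ρ, and a pull raises the count seen at the next update. So the deviant rounds with a pull
in different blocks have different counts c, and the mean is off at count c with probability at most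
2 exp(-cδ²/4). Summing the geometric series gives a bound independent of `H`. -/
theorem sum_measure_deviantSet_le {ν : Fin K → ProbabilityMeasure unitInterval} {m δ ρ : ℝ}
    (hm : ∫ x : unitInterval, (x : ℝ) ∂(ν k : Measure unitInterval) = m) (hδ : 0 < δ)
    (hδ1 : δ ≤ 1) (hρ : 0 < ρ) {L : ℕ} (hL : 0 < L) (H : ℕ) :
    ∑ t ∈ Finset.range H, (gameLaw ν M).real (deviantSet s i k L m δ ρ t) ≤
      L / ρ * (2 * (1 - Real.exp (-(δ ^ 2 / 4)))⁻¹) := by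
  classical
  set A := fun t => deviantSet s i k L m δ ρ t with hA
  set B : ℕ → Set (ℕ → Draw K M) := fun c =>
    {ω | ∃ n ≤ H, pulls s i k n ω = c ∧ δ ≤ |pullMean s i k n ω - m|} with hB
  have hBm : ∀ c, MeasurableSet (B c) := fun c => by
    have : B c = ⋃ n ∈ Finset.range (H + 1), {ω | pulls s i k n ω = c} ∩
        {ω | δ ≤ |pullMean s i k n ω - m|} := by
      ext ω; simp only [hB, mem_ofPred_eq, mem_iUnion, Finset.mem_range, Nat.lt_succ_iff, mem_inter_iff,
        exists_prop]
    rw [this]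
    exact Finset.measurableSet_biUnion _ fun n _ =>
      ((measurable_pulls s i k n) (measurableSet_singleton c)).inter
        (measurableSet_le measurable_const ((measurable_pullMean s i k n).sub_const m).abs)
  have hAm : ∀ t, MeasurableSet (A t ∩ {ω | actions s ω t i = k}) := fun t =>
    (measurableSet_deviantSet L m δ ρ t).inter (measurableSet_actions_eq s t i k)
  have hpath : ∀ ω, ∑ t ∈ Finset.range H,
      (A t ∩ {ω | actions s ω t i = k}).indicator (1 : (ℕ → Draw K M) → ENNReal) ω ≤
      L * ∑ c ∈ Finset.Icc 1 H, (B c).indicator (1 : (ℕ → Draw K M) → ENNReal) ω := by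
    intro ω
    simp only [Set.indicator_apply, Pi.one_apply, Finset.sum_boole]
    have hcard : ((Finset.range H).filter fun t => ω ∈ A t ∩ {ω | actions s ω t i = k}).card ≤
        (((Finset.Icc 1 H).filter fun c => ω ∈ B c) ×ˢ Finset.range L).card := by
      -- The count determines the block of `L` rounds, because a pull separates the counts of
      -- different blocks; the residue determines the round inside the block.
      refine Finset.card_le_card_of_injOn
        (fun t => (pulls s i k (lastUpdate L (t + 1) - 1) ω, (t + 1) % L)) ?_ ?_
      · intro t ht
        simp only [Finset.coe_filter, Finset.mem_range, mem_ofPred_eq] at ht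
        obtain ⟨htH, ⟨h1, h2, _⟩, _⟩ := ht
        have h3 : lastUpdate L (t + 1) ≤ t + 1 := lastUpdate_le L (t + 1)
        have h4 : pulls s i k (lastUpdate L (t + 1) - 1) ω ≤ lastUpdate L (t + 1) - 1 :=
          (Finset.card_filter_le _ _).trans (by simp)
        simp only [Finset.coe_product, mem_prod, Finset.coe_filter, mem_ofPred_eq, Finset.mem_Icc,
          Finset.coe_range, mem_Iio]
        exact ⟨⟨⟨Nat.one_le_iff_ne_zero.2 h1, by omega⟩, _, by omega, rfl, h2⟩, Nat.mod_lt _ hL⟩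
      · have key : ∀ t t', ω ∈ A t → actions s ω t i = k →
            pulls s i k (lastUpdate L (t + 1) - 1) ω = pulls s i k (lastUpdate L (t' + 1) - 1) ω →
            (t + 1) / L < (t' + 1) / L → False := by
          intro t t' h1 h2 h3 h4
          have h5 : lastUpdate L (t + 1) ≤ t + 1 := lastUpdate_le L (t + 1)
          have h6 : t + 1 < lastUpdate L (t' + 1) := by
            unfold lastUpdate
            calc t + 1 < L * ((t + 1) / L + 1) := Nat.lt_mul_div_succ _ hL
              _ ≤ L * ((t' + 1) / L) := Nat.mul_le_mul_left L h4
          have := pulls_lt (s := s) (i := i) (k := k) (ω := ω) (n := lastUpdate L (t + 1) - 1)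
            (n' := lastUpdate L (t' + 1) - 1) (t := t) (by omega) (by omega) h2
          omega
        intro t ht t' ht' h
        simp only [Finset.coe_filter, Finset.mem_range, mem_ofPred_eq] at ht ht'
        simp only [Prod.mk.injEq] at h
        rcases lt_trichotomy ((t + 1) / L) ((t' + 1) / L) with h1 | h1 | h1
        · exact (key t t' ht.2.1 ht.2.2 h.1 h1).elim
        · have h2 := Nat.div_add_mod (t + 1) L
          have h3 := Nat.div_add_mod (t' + 1) L
          rw [h1, h.2] at h2
          omega
        · exact (key t' t ht'.2.1 ht'.2.2 h.1.symm h1).elim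
    rw [Finset.card_product, Finset.card_range, mul_comm] at hcard
    rw [Finset.sum_boole (R := ENNReal) (p := fun c => ω ∈ B c)]
    exact_mod_cast hcard
  have h1 : ENNReal.ofReal ρ * ∑ t ∈ Finset.range H, gameLaw ν M (A t) ≤
      L * ∑ c ∈ Finset.Icc 1 H, gameLaw ν M (B c) := by
    calc ENNReal.ofReal ρ * ∑ t ∈ Finset.range H, gameLaw ν M (A t)
        ≤ ∑ t ∈ Finset.range H, gameLaw ν M (A t ∩ {ω | actions s ω t i = k}) := by
          rw [Finset.mul_sum]
          refine Finset.sum_le_sum fun t _ => ?_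
          refine mul_measure_le_measure_inter ν s i k (measurableSet_deviantSet L m δ ρ t)
            (fun r hr ω x => ?_) fun ω hω => hω.2.2
          have h2 : lastUpdate L (t + 1) - 1 ≤ r := by
            have : lastUpdate L (t + 1) ≤ t + 1 := lastUpdate_le L (t + 1)
            omega
          simp only [deviantSet, mem_ofPred_eq]
          rw [dependsBefore_pulls s i k _ r h2 ω x, dependsBefore_pullMean s i k _ r h2 ω x,
            dependsBefore_pullProb s t i k r hr ω x]
      _ = ∫⁻ ω, ∑ t ∈ Finset.range H, (A t ∩ {ω | actions s ω t i = k}).indicator 1 ω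
            ∂(gameLaw ν M) := by
          rw [lintegral_finsetSum _ fun t _ => measurable_one.indicator (hAm t)]
          exact Finset.sum_congr rfl fun t _ => (lintegral_indicator_one (hAm t)).symm
      _ ≤ ∫⁻ ω, L * ∑ c ∈ Finset.Icc 1 H, (B c).indicator 1 ω ∂(gameLaw ν M) :=
          lintegral_mono hpath
      _ = L * ∑ c ∈ Finset.Icc 1 H, gameLaw ν M (B c) := by
          rw [lintegral_const_mul _ (Finset.measurable_sum _ fun c _ =>
            measurable_one.indicator (hBm c)),
            lintegral_finsetSum _ fun c _ => measurable_one.indicator (hBm c)]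
          congr 1
          exact Finset.sum_congr rfl fun c _ => lintegral_indicator_one (hBm c)
  have h2 : ∑ c ∈ Finset.Icc 1 H, (gameLaw ν M).real (B c) ≤
      2 * (1 - Real.exp (-(δ ^ 2 / 4)))⁻¹ := by
    have hx1 : Real.exp (-(δ ^ 2 / 4)) < 1 := Real.exp_lt_one_iff.2 (by have := pow_pos hδ 2; linarith)
    have hx0 := (Real.exp_pos (-(δ ^ 2 / 4))).le
    calc ∑ c ∈ Finset.Icc 1 H, (gameLaw ν M).real (B c)
        ≤ ∑ c ∈ Finset.Icc 1 H, 2 * Real.exp (-(δ ^ 2 / 4)) ^ c := by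
          refine Finset.sum_le_sum fun c hc => ?_
          have := measure_exists_deviation_le (s := s) (i := i) (M := M) hm hδ hδ1 H c
            (by have := (Finset.mem_Icc.1 hc).1; omega)
          refine ENNReal.toReal_le_of_le_ofReal (by positivity) (this.trans_eq ?_)
          rw [← Real.exp_nat_mul]
          ring_nf
      _ ≤ 2 * (1 - Real.exp (-(δ ^ 2 / 4)))⁻¹ := by
          rw [← Finset.mul_sum]
          refine mul_le_mul_of_nonneg_left ?_ zero_le_two
          rw [← tsum_geometric_of_lt_one hx0 hx1]
          exact (summable_geometric_of_lt_one hx0 hx1).sum_le_tsum _ fun c _ => pow_nonneg hx0 c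
  have h3 : ρ * ∑ t ∈ Finset.range H, (gameLaw ν M).real (A t) ≤
      L * ∑ c ∈ Finset.Icc 1 H, (gameLaw ν M).real (B c) := by
    have hfin : (L : ENNReal) * ∑ c ∈ Finset.Icc 1 H, gameLaw ν M (B c) ≠ ⊤ :=
      ENNReal.mul_ne_top (ENNReal.natCast_ne_top L)
        (ENNReal.sum_ne_top.2 fun c _ => measure_ne_top _ _)
    have := ENNReal.toReal_mono hfin h1
    rw [ENNReal.toReal_mul, ENNReal.toReal_mul, ENNReal.toReal_ofReal hρ.le,
      ENNReal.toReal_sum fun t _ => measure_ne_top _ _,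
      ENNReal.toReal_sum fun c _ => measure_ne_top _ _, ENNReal.toReal_natCast] at this
    exact this
  have h4 : ρ * ∑ t ∈ Finset.range H, (gameLaw ν M).real (A t) ≤
      L * (2 * (1 - Real.exp (-(δ ^ 2 / 4)))⁻¹) :=
    h3.trans (mul_le_mul_of_nonneg_left h2 (Nat.cast_nonneg L))
  rw [div_mul_eq_mul_div, le_div_iff₀ hρ, mul_comm]
  exact h4

end Statistics

end MPBandit

namespace MPBandit
open Set

/-! ## The exploration phase with given statistics -/

section Exploration

variable {K : ℕ} {M : ℕ} {μ m b : Fin K → ℝ} {δ : ℝ}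

/-- The empirical means `m` and indices `b` identify the `M` best arms and the `M`-th best one, and
do not overestimate the arms that remain to be explored. -/
structure GoodStats (M : ℕ) (μ : Fin K → ℝ) (δ : ℝ) (m b : Fin K → ℝ) : Prop where
  top : topArms M m = topArms M μ
  last : ∀ k, place m k + 1 = M ↔ place μ k + 1 = M
  last_ge : ∀ k, place μ k + 1 = M → μ k - δ ≤ m k
  explored : ∀ k l, k ∉ topArms M μ → place μ l + 1 = M → m l ≤ b k → m k ≤ μ k + δ

/-- The arms that are pulled with positive probability in a period with statistics `m`, `b`. -/
def IsCandidate (M : ℕ) (m b : Fin K → ℝ) (k : Fin K) : Prop :=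
  k ∈ topArms M m ∨ (k ∉ topArms M m ∧ ∃ l, place m l + 1 = M ∧ m l ≤ b k)

/-- Accuracy is assumed only for arms that may be pulled, and the indices bring in the others. If a
true top arm k is missing from the list, some worse arm l is in it with an accurate mean, so m_k ≤
m_e ≤ m_l < μ_l + δ ≤ μ_k - 3δ, where e is the empirical M-th arm. As the index does not fail, b_k ≥
μ_k - 2δ > m_e, so k is a candidate for exploration and its mean must be accurate: a contradiction.
-/
theorem goodStats_of_accurate (hM : 1 ≤ M) (hMK : M ≤ K) (hμ : Function.Injective μ) (hδ : 0 < δ)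
    (hgap : ∀ k l, μ k < μ l → μ k + 4 * δ ≤ μ l)
    (hc : ∀ k, IsCandidate M m b k → |m k - μ k| < δ)
    (hi : ∀ k, m k ≤ μ k - 3 * δ → ¬ b k < μ k - 2 * δ) : GoodStats M μ δ m b := by
  obtain ⟨e, he⟩ := exists_place_eq m (show M - 1 < K by omega)
  have he1 : place m e + 1 = M := by omega
  have heT : e ∈ topArms M m := mem_topArms.2 (by omega)
  have htop : topArms M m = topArms M μ := by
    by_contra hne
    obtain ⟨⟨k, hkμ, hkm⟩, l, hlm, hlμ⟩ := exists_mem_sdiff_topArms hMK hne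
    have h1 : μ l < μ k := lt_of_place_lt hμ (by rw [mem_topArms] at hkμ hlμ; omega)
    have h2 := hgap l k h1
    have h3 := (abs_lt.1 (hc l (Or.inl hlm))).2
    have h4 : m e ≤ m l := place_le_imp (by rw [mem_topArms] at hlm; omega)
    have h5 : m k ≤ m e := le_of_mem_topArms heT hkm
    have h6 := hi k (by linarith)
    have h7 := (abs_lt.1 (hc k (Or.inr ⟨hkm, e, he1, by linarith⟩))).1
    linarith
  obtain ⟨e', he'⟩ := exists_place_eq μ (show M - 1 < K by omega)
  have he1' : place μ e' + 1 = M := by omega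
  have hee : e = e' := by
    by_contra hne
    have h1 : e ∈ topArms M μ := htop ▸ heT
    have h2 : e' ∈ topArms M m := htop ▸ mem_topArms.2 (by omega)
    have h3 : place μ e < place μ e' := by
      have := mem_topArms.1 h1
      rcases (show place μ e ≤ place μ e' by omega).lt_or_eq with h | h
      · exact h
      · exact absurd (place_injective μ h) hne
    have h4 := hgap e' e (lt_of_place_lt hμ h3)
    have h5 := (abs_lt.1 (hc e (Or.inl heT))).1
    have h6 := (abs_lt.1 (hc e' (Or.inl h2))).2
    have h7 : m e ≤ m e' := place_le_imp (by have := mem_topArms.1 h2; omega)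
    linarith
  subst hee
  have hlast : ∀ k, place m k + 1 = M ↔ place μ k + 1 = M := fun k => by
    constructor
    · intro h
      have : k = e := place_injective m (by omega)
      rw [this]; exact he1'
    · intro h
      have : k = e := place_injective μ (by omega)
      rw [this]; exact he1
  refine ⟨htop, hlast, fun k hk => ?_, fun k l hk hl hb => ?_⟩
  · have := (abs_lt.1 (hc k (Or.inl (htop ▸ mem_topArms.2 (by omega))))).1
    linarith
  · have := (abs_lt.1 (hc k (Or.inr ⟨by rwa [htop], l, (hlast l).2 hl, hb⟩))).2
    linarith

theorem exists_mod_eq {c : ℕ} (hc : c < M) (d U : ℕ) : ∃ r < M, (U + r + d) % M = c := by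
  have hM : 0 < M := by omega
  refine ⟨(c + (M - (U + d) % M)) % M, Nat.mod_lt _ hM, ?_⟩
  have h1 : (U + d) % M < M := Nat.mod_lt _ hM
  rw [show U + (c + (M - (U + d) % M)) % M + d = (U + d) + (c + (M - (U + d) % M)) % M by ring,
    Nat.add_mod_mod, Nat.add_mod, ← Nat.add_mod]
  have h2 := Nat.div_add_mod (U + d) M
  rw [show U + d + (c + (M - (U + d) % M)) = c + M * ((U + d) / M + 1) by
    rw [mul_add]; omega, Nat.add_mul_mod_self_left, Nat.mod_eq_of_lt hc]

variable [NeZero K]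

/-- In M consecutive rounds the rotation visits every position of the list. A top arm is thus pulled
with probability at least 1/2 when its turn comes; an arm under exploration is pulled with
probability at least 1/(2K) when the turn of the M-th empirical arm comes. -/
theorem exists_volume_exploChoice_ge (hMK : M ≤ K) {k : Fin K}
    (hk : IsCandidate M m b k) (a : Fin K) (U : ℕ) :
    ∃ r < M, (1 : ℝ) / (2 * K) ≤ (volume : Measure unitInterval).real
      {u | (exploChoice M a (U + r) m b).draw (u : ℝ) = k} := by
  have hK : (0 : ℝ) < K := by exact_mod_cast Nat.pos_of_ne_zero (NeZero.ne K)
  have hK1 : (1 : ℝ) ≤ K := by exact_mod_cast Nat.one_le_iff_ne_zero.2 (NeZero.ne K)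
  have hcard := card_topArms hMK m
  have hhalf : (1 : ℝ) / (2 * K) ≤ 1 / 2 := by
    apply one_div_le_one_div_of_le <;> linarith
  rcases hk with hk | ⟨hk, l, hl, hlb⟩
  · obtain ⟨c, hc, hck⟩ := exists_listArm_eq hk
    rw [hcard] at hc
    obtain ⟨r, hr, hrc⟩ := exists_mod_eq hc (a.val + 1) U
    refine ⟨r, hr, ?_⟩
    have hpull : (1 : ℝ) / (2 * K) ≤ (volume : Measure unitInterval).real
        {u | (Choice.pull k).draw (u : ℝ) = k} := by
      have : (volume : Measure unitInterval).real {u | (Choice.pull k).draw (u : ℝ) = k} = 1 := by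
        have := volume_pick (S := {k}) (Finset.mem_singleton_self k)
        simpa [Choice.pull, Choice.draw] using this
      rw [this]; linarith
    have hl : ((topArms M m).sort (· ≤ ·)).getD ((U + r + (a.val + 1)) % M) 0 = k := by
      rw [hrc]; exact hck
    unfold exploChoice
    simp only [hl]
    split_ifs
    · exact hpull
    · exact hpull
    · exact hhalf.trans (volume_half_left _ _)
  · have hlT : l ∈ topArms M m := mem_topArms.2 (by omega)
    obtain ⟨c, hc, hck⟩ := exists_listArm_eq hlT
    rw [hcard] at hc
    obtain ⟨r, hr, hrc⟩ := exists_mod_eq hc (a.val + 1) U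
    refine ⟨r, hr, ?_⟩
    have hl' : ((topArms M m).sort (· ≤ ·)).getD ((U + r + (a.val + 1)) % M) 0 = l := by
      rw [hrc]; exact hck
    have hkB : k ∈ Finset.univ.filter fun k => k ∉ topArms M m ∧ m l ≤ b k := by
      simp [hk, hlb]
    unfold exploChoice
    simp only [hl']
    rw [if_neg (by simpa using hl), if_neg (Finset.ne_empty_of_mem hkB)]
    refine le_trans ?_ (volume_half_right hkB)
    have hB1 : (0 : ℝ) < (Finset.univ.filter fun k => k ∉ topArms M m ∧ m l ≤ b k).card := by
      exact_mod_cast Finset.card_pos.2 ⟨k, hkB⟩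
    have hB2 : ((Finset.univ.filter fun k => k ∉ topArms M m ∧ m l ≤ b k).card : ℝ) ≤ K := by
      exact_mod_cast (Finset.card_le_univ _).trans_eq (Fintype.card_fin K)
    apply one_div_le_one_div_of_le <;> linarith

/-- The arm of the true top list assigned to rank `a + 1` in round `τ`. -/
def target (M : ℕ) (μ : Fin K → ℝ) (a τ : ℕ) : Fin K := listArm (topArms M μ) ((τ + (a + 1)) % M)

theorem target_mem (hM : 1 ≤ M) (hMK : M ≤ K) (a τ : ℕ) : target M μ a τ ∈ topArms M μ :=
  listArm_mem (by rw [card_topArms hMK]; exact Nat.mod_lt _ hM)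

theorem target_inj (hM : 1 ≤ M) (hMK : M ≤ K) {a a' τ τ' : ℕ}
    (h : target M μ a τ = target M μ a' τ') : (τ + (a + 1)) % M = (τ' + (a' + 1)) % M :=
  listArm_inj (by rw [card_topArms hMK]; exact Nat.mod_lt _ hM)
    (by rw [card_topArms hMK]; exact Nat.mod_lt _ hM) h

theorem target_inj_rank (hM : 1 ≤ M) (hMK : M ≤ K) {a a' τ : ℕ} (ha : a < M) (ha' : a' < M)
    (h : target M μ a τ = target M μ a' τ) : a = a' := by
  have h1 : τ + 1 + a ≡ τ + 1 + a' [MOD M] := by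
    have := target_inj hM hMK h
    rwa [show τ + 1 + a = τ + (a + 1) by ring, show τ + 1 + a' = τ + (a' + 1) by ring]
  exact Nat.ModEq.eq_of_lt_of_lt (Nat.ModEq.add_left_cancel' _ h1) ha ha'

theorem exists_target_eq (hMK : M ≤ K) {k : Fin K} (hk : k ∈ topArms M μ) (τ : ℕ) :
    ∃ a < M, target M μ a τ = k := by
  obtain ⟨c, hc, hck⟩ := exists_listArm_eq hk
  rw [card_topArms hMK] at hc
  obtain ⟨r, hr, hrc⟩ := exists_mod_eq hc 1 τ
  exact ⟨r, hr, by rw [target, ← add_assoc, hrc, hck]⟩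

/-- With good statistics the play is the rotation over the true top list, apart from explorations in
place of the M-th best arm. Later counting arguments use only this dichotomy. -/
theorem draw_exploChoice (hg : GoodStats M μ δ m b) (a : Fin K) (τ : ℕ) {u : ℝ} (hu : u < 1) :
    (exploChoice M a τ m b).draw u = target M μ a τ ∨
      (place μ (target M μ a τ) + 1 = M ∧ (exploChoice M a τ m b).draw u ∉ topArms M μ ∧
        m (target M μ a τ) ≤ b ((exploChoice M a τ m b).draw u)) := by
  have hl : ((topArms M m).sort (· ≤ ·)).getD ((τ + (a.val + 1)) % M) 0 = target M μ a τ := by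
    rw [hg.top]; rfl
  have hpull : (Choice.pull (target M μ a τ)).draw u = target M μ a τ := by
    have := pick_mem (S := {target M μ a τ}) (Finset.singleton_nonempty _) hu
    exact Finset.mem_singleton.1 this
  unfold exploChoice
  simp only [hl]
  split_ifs with h1 h2
  · exact Or.inl hpull
  · exact Or.inl hpull
  · simp only [Choice.draw]
    split_ifs with h3
    · exact Or.inl rfl
    · right
      have := pick_mem (u := 2 * u - 1) (Finset.nonempty_iff_ne_empty.2 h2) (by linarith)
      simp only [Finset.mem_filter, Finset.mem_univ, true_and] at this
      rw [hg.top] at this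
      simp only [hg.top]
      exact ⟨(hg.last _).1 (not_not.1 h1), this.1, this.2⟩

end Exploration

end MPBandit

namespace MPBandit
open Set

/-! ## The second phase along a trajectory -/

section Pathwise

/-- Sums of a function along the residues of a shifted interval. -/
theorem sum_range_mul_mod (f : ℕ → ℝ) {M : ℕ} (hM : 0 < M) (c q : ℕ) :
    ∑ t ∈ Finset.range (q * M), f ((t + c) % M) = q * ∑ r ∈ Finset.range M, f r := by
  have hblock : ∀ d, ∑ r ∈ Finset.range M, f ((r + d) % M) = ∑ r ∈ Finset.range M, f r := by
    intro d
    refine Finset.sum_bij (fun r _ => (r + d) % M)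
      (fun r _ => Finset.mem_range.2 (Nat.mod_lt _ hM)) ?_ ?_ fun _ _ => rfl
    · intro r hr r' hr' h
      exact Nat.ModEq.eq_of_lt_of_lt (Nat.ModEq.add_right_cancel' d h) (Finset.mem_range.1 hr)
        (Finset.mem_range.1 hr')
    · intro x hx
      obtain ⟨r, hr, h⟩ := exists_mod_eq (Finset.mem_range.1 hx) d 0
      exact ⟨r, Finset.mem_range.2 hr, by simpa using h⟩
  induction q with
  | zero => simp
  | succ q ih =>
    rw [Nat.succ_mul, Finset.sum_range_add, ih]
    have : ∀ r, f ((q * M + r + c) % M) = f ((r + (q * M + c)) % M) := fun r => by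
      rw [show q * M + r + c = r + (q * M + c) by ring]
    simp only [this]
    rw [hblock]; push_cast; ring

/-- Complete periods contribute equally, whatever the shift; the error comes from the incomplete
last period. -/
theorem abs_sum_mod_sub_le {f : ℕ → ℝ} {M : ℕ} (hM : 0 < M) {B : ℝ} (h0 : ∀ r < M, 0 ≤ f r)
    (hB : ∀ r < M, f r ≤ B) (c T : ℕ) :
    |∑ t ∈ Finset.range T, f ((t + c) % M) - T / M * ∑ r ∈ Finset.range M, f r| ≤ M * B := by
  have hM' : (0 : ℝ) < M := by exact_mod_cast hM
  set S := ∑ r ∈ Finset.range M, f r with hS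
  have hS0 : 0 ≤ S := Finset.sum_nonneg fun r hr => h0 r (Finset.mem_range.1 hr)
  have hSB : S ≤ M * B := by
    have := Finset.sum_le_card_nsmul (Finset.range M) f B fun r hr => hB r (Finset.mem_range.1 hr)
    simpa using this
  have hlt := Nat.mod_lt T hM
  have hT : T = T / M * M + T % M := by rw [mul_comm]; exact (Nat.div_add_mod T M).symm
  have hsum : ∑ t ∈ Finset.range T, f ((t + c) % M) = ((T / M : ℕ) : ℝ) * S +
      ∑ r ∈ Finset.range (T % M), f ((T / M * M + r + c) % M) := by
    conv_lhs => rw [hT]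
    rw [Finset.sum_range_add, sum_range_mul_mod f hM]
  have hr0 : 0 ≤ ∑ r ∈ Finset.range (T % M), f ((T / M * M + r + c) % M) :=
    Finset.sum_nonneg fun r _ => h0 _ (Nat.mod_lt _ hM)
  have hB0 : 0 ≤ B := (h0 0 hM).trans (hB 0 hM)
  have hrB : ∑ r ∈ Finset.range (T % M), f ((T / M * M + r + c) % M) ≤ M * B := by
    have := Finset.sum_le_card_nsmul (Finset.range (T % M))
      (fun r => f ((T / M * M + r + c) % M)) B fun r _ => hB _ (Nat.mod_lt _ hM)
    simp only [Finset.card_range, nsmul_eq_mul] at this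
    refine this.trans (mul_le_mul_of_nonneg_right ?_ hB0)
    exact_mod_cast hlt.le
  have hdiv : (T : ℝ) / M * S = ((T / M : ℕ) : ℝ) * S + (T % M : ℕ) / M * S := by
    conv_lhs => rw [hT]
    push_cast
    field_simp
  have h3 : ((T % M : ℕ) : ℝ) / M * S ≤ S := by
    refine mul_le_of_le_one_left hS0 ((div_le_one hM').2 ?_)
    exact_mod_cast hlt.le
  have h4 : 0 ≤ ((T % M : ℕ) : ℝ) / M * S := by positivity
  rw [hsum, hdiv, abs_le]
  constructor <;> linarith

theorem exists_of_collision {K M : ℕ} {i : Fin M} {π : Fin M → Fin K} (h : Collision π (π i)) : ∃ i' ≠ i, π i' = π i := by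
  obtain ⟨i', h1, h2⟩ := Finset.exists_mem_ne h i
  exact ⟨i', h2, (Finset.mem_filter.1 h1).2⟩

theorem collision_of_eq {K M : ℕ} {π : Fin M → Fin K} {i i' : Fin M} (hne : i' ≠ i) (h : π i' = π i) :
    Collision π (π i) :=
  Finset.one_lt_card.2 ⟨i', by simp [h], i, by simp, hne⟩

theorem netMean_nonneg {K M : ℕ} {μ : Fin K → ℝ} (hμ0 : ∀ k, 0 < μ k) (π : Fin M → Fin K) (j : Fin M) :
    0 ≤ netMean μ π j := by
  unfold netMean
  split_ifs
  · exact le_rfl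
  · exact (hμ0 _).le

variable {K M : ℕ} [NeZero K]

/-- The rotation makes all ranks equally valuable up to one period, which is what allows a common
value v for all players. -/
theorem abs_sum_target_sub_le {μ : Fin K → ℝ} (hM : 1 ≤ M) (hMK : M ≤ K) {B : ℝ}
    (h0 : ∀ k, 0 ≤ μ k) (hB : ∀ k, μ k ≤ B) (a T : ℕ) :
    |∑ t ∈ Finset.range T, μ (target M μ a (t + 1)) -
      T / M * ∑ k ∈ topArms M μ, μ k| ≤ M * B := by
  have h1 : ∑ k ∈ topArms M μ, μ k = ∑ r ∈ Finset.range M, μ (listArm (topArms M μ) r) := by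
    have hcard := card_topArms hMK μ
    refine (Finset.sum_bij (fun r _ => listArm (topArms M μ) r) ?_ ?_ ?_ fun _ _ => rfl).symm
    · intro r hr; exact listArm_mem (by rw [hcard]; exact Finset.mem_range.1 hr)
    · intro r hr r' hr' h
      exact listArm_inj (by rw [hcard]; exact Finset.mem_range.1 hr)
        (by rw [hcard]; exact Finset.mem_range.1 hr') h
    · intro k hk
      obtain ⟨c, hc, h⟩ := exists_listArm_eq hk
      exact ⟨c, Finset.mem_range.2 (by rwa [hcard] at hc), h⟩
  rw [h1]
  have := abs_sum_mod_sub_le (f := fun r => μ (listArm (topArms M μ) r)) hM (B := B)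
    (fun r _ => h0 _) (fun r _ => hB _) (1 + (a + 1)) T
  simpa only [target, add_assoc] using this

/-- A trajectory along which the players of `A` have finished the initialization after `L₀` rounds,
with the correct estimate of the number of players and distinct ranks `a`. -/
structure Initialized (s : Fin M → Strategy K) (T : ℕ) (A : Finset (Fin M)) (L₀ : ℝ)
    (a : Fin M → Fin K) (ω : ℕ → Draw K M) : Prop where
  coop : ∀ i ∈ A, s i = selfishRobust K T
  seed : ∀ t i, ((ω t).2 i : ℝ) < 1
  inj : ∀ i ∈ A, ∀ i' ∈ A, a i = a i' → i = i'
  lt : ∀ i ∈ A, (a i).val < M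
  init : ∀ i ∈ A, ∀ t : ℕ, L₀ < (t : ℝ) + 1 →
    initStep T (fun r => signal (history s ω i t r)) = .inr (M, a i)

/-- The index of arm `k` for player `i` at round `U`. -/
def pullIndex (s : Fin M → Strategy K) (i : Fin M) (U : ℕ) (ω : ℕ → Draw K M) (k : Fin K) : ℝ :=
  klIndex (pulls s i k (U - 1) ω) (pullMean s i k (U - 1) ω) U

/-- The statistics of player `i` before round `U` are good. -/
def StatsGood (s : Fin M → Strategy K) (i : Fin M) (μ : Fin K → ℝ) (δ : ℝ) (U : ℕ)
    (ω : ℕ → Draw K M) : Prop :=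
  GoodStats M μ δ (fun k => pullMean s i k (U - 1) ω) (pullIndex s i U ω)

/-- Round `t + 1` comes after the initialization, and all players of `A` have good statistics. -/
def GoodRound (s : Fin M → Strategy K) (A : Finset (Fin M)) (μ : Fin K → ℝ) (δ L₀ : ℝ) (t : ℕ)
    (ω : ℕ → Draw K M) : Prop :=
  L₀ + M < (t : ℝ) + 1 ∧ ∀ i ∈ A, StatsGood s i μ δ (lastUpdate M (t + 1)) ω

/-- The index of `k` is too small although `k` is underestimated. -/
def indexFailure (s : Fin M → Strategy K) (i : Fin M) (T : ℕ) (k : Fin K) (m δ : ℝ) (U : ℕ) :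
    Set (ℕ → Draw K M) :=
  {ω | obsTarget K T ≤ pulls s i k (U - 1) ω ∧ pullMean s i k (U - 1) ω ≤ m - 3 * δ ∧
    pullIndex s i U ω k < m - 2 * δ}

theorem stepArm_coop {s : Fin M → Strategy K} {i : Fin M} {T : ℕ} (h : s i = selfishRobust K T)
    (ω : ℕ → Draw K M) (t : ℕ) (u : unitInterval) :
    stepArm s ω t i u = (choice T (history s ω i t)).draw (u : ℝ) := by
  rw [stepArm, h]
  simp [selfishRobust]

theorem actions_coop {s : Fin M → Strategy K} {i : Fin M} {T : ℕ} (h : s i = selfishRobust K T)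
    (ω : ℕ → Draw K M) (t : ℕ) :
    actions s ω t i = (choice T (history s ω i t)).draw ((ω t).2 i : ℝ) := by
  rw [actions_eq_stepArm, stepArm_coop h]

/-- The second phase cannot start before the estimation is done, so every arm enters it with at
least n pulls. This head start makes the index failures summable. -/
theorem obsTarget_le_pulls {s : Fin M → Strategy K} {i : Fin M} {T t : ℕ} {ω : ℕ → Draw K M}
    {x : ℕ × Fin K} (h : initStep T (fun r => signal (history s ω i t r)) = .inr x) (k : Fin K) :
    obsTarget K T ≤ pulls s i k t ω := by
  have hd : EstimDone T (fun r => signal (history s ω i t r)) t := by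
    by_contra hd
    simp [initStep, hd] at h
  refine (hd k).trans ?_
  have : sensedCount (fun r => signal (history s ω i t r)) k t ≤ pulls s i k t ω := by
    rw [pulls, ← card_fin_filter (t := t) le_rfl]
    refine Finset.card_le_card fun r hr => ?_
    simp only [Finset.mem_filter, Finset.mem_univ, true_and] at hr ⊢
    exact ⟨hr.1, hr.2.1⟩
  exact_mod_cast this

variable {s : Fin M → Strategy K} {T : ℕ} {A : Finset (Fin M)} {L₀ : ℝ} {a : Fin M → Fin K}
  {ω : ℕ → Draw K M} {μ : Fin K → ℝ} {δ : ℝ} {i : Fin M}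

theorem lt_lastUpdate (hM : 1 ≤ M) (t : ℕ) : t < lastUpdate M t + M := by
  have := Nat.div_add_mod t M
  have := Nat.mod_lt t hM
  unfold lastUpdate; omega

theorem lt_lastUpdate_of_lt (hM : 1 ≤ M) {t : ℕ} (h : L₀ + M < (t : ℝ) + 1) :
    L₀ < lastUpdate M (t + 1) := by
  have h1 : ((t + 1 : ℕ) : ℝ) < lastUpdate M (t + 1) + M := by
    exact_mod_cast lt_lastUpdate hM (t + 1)
  push_cast at h1
  linarith

theorem Initialized.choice_eq (hI : Initialized s T A L₀ a ω) (hi : i ∈ A) {t : ℕ}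
    (h : L₀ < (t : ℝ) + 1) :
    choice T (history s ω i t) = exploChoice M (a i) (t + 1)
      (fun k => pullMean s i k (lastUpdate M (t + 1) - 1) ω)
      (pullIndex s i (lastUpdate M (t + 1)) ω) := by
  have hU : lastUpdate M (t + 1) ≤ t + 1 := lastUpdate_le M (t + 1)
  unfold choice
  rw [hI.init i hi t h]
  simp only [exploStep]
  congr 1
  · funext k; exact empMean_history ω hU
  · funext k; rw [pullCount_history ω hU, empMean_history ω hU]; rfl

theorem Initialized.obsTarget_le (hI : Initialized s T A L₀ a ω) (hi : i ∈ A) {U : ℕ}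
    (hL : 0 ≤ L₀) (h : L₀ < U) (k : Fin K) : obsTarget K T ≤ pulls s i k (U - 1) ω := by
  have hU : 0 < U := by exact_mod_cast hL.trans_lt h
  refine obsTarget_le_pulls (hI.init i hi (U - 1) ?_) k
  rw [Nat.cast_sub (by omega)]; simpa using h

/-- The contrapositive of `goodStats_of_accurate`. The statistics are frozen during a block, so a
badly estimated candidate can be charged to the round of the block in which it has a real chance of
being pulled. -/
theorem Initialized.exists_of_not_statsGood (hI : Initialized s T A L₀ a ω) (hi : i ∈ A)
    (hM : 1 ≤ M) (hMK : M ≤ K) (hμ : Function.Injective μ) (hδ : 0 < δ)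
    (hgap : ∀ k l, μ k < μ l → μ k + 4 * δ ≤ μ l) (hL : 0 ≤ L₀) (hn : 0 < obsTarget K T) {t : ℕ}
    (ht : L₀ + M < (t : ℝ) + 1) (hbad : ¬ StatsGood s i μ δ (lastUpdate M (t + 1)) ω) :
    ∃ k, (∃ t', lastUpdate M (t' + 1) = lastUpdate M (t + 1) ∧
        ω ∈ deviantSet s i k M (μ k) δ (1 / (2 * K)) t') ∨
      ω ∈ indexFailure s i T k (μ k) δ (lastUpdate M (t + 1)) := by
  set U := lastUpdate M (t + 1) with hU
  have hUL : L₀ < U := lt_lastUpdate_of_lt hM ht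
  have hU0 : 0 < U := by exact_mod_cast hL.trans_lt hUL
  have hobs := hI.obsTarget_le hi hL hUL
  by_contra! hcon
  refine hbad (goodStats_of_accurate hM hMK hμ hδ hgap (fun k hk => ?_) fun k h1 h2 => ?_)
  · by_contra hdev
    rw [not_lt] at hdev
    -- Round U + r has time index U + r - 1, since index t stands for round t + 1.
    obtain ⟨r, hr, hv⟩ := exists_volume_exploChoice_ge hMK hk (a i) U
    have ht' : U + r - 1 + 1 = U + r := by omega
    have hUr : lastUpdate M (U + r) = U := by
      rw [hU, lastUpdate, lastUpdate, Nat.mul_add_div hM, Nat.div_eq_of_lt hr, add_zero]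
    refine (hcon k).1 (U + r - 1) (by rw [ht', hUr]) ⟨?_, ?_, ?_⟩
    · rw [ht', hUr]
      have := hn.trans_le (hobs k)
      exact_mod_cast this.ne'
    · rw [ht', hUr]; exact hdev
    · have hlt : L₀ < ((U + r - 1 : ℕ) : ℝ) + 1 := by
        have : ((U + r - 1 + 1 : ℕ) : ℝ) = U + r := by rw [ht']; push_cast; ring
        push_cast at this
        have hr0 : (0 : ℝ) ≤ r := Nat.cast_nonneg r
        linarith
      have hce := hI.choice_eq hi hlt
      rw [ht', hUr] at hce
      simp only [pullProb, stepArm_coop (hI.coop i hi), hce]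
      exact hv
  · exact (hcon k).2 ⟨hobs k, h1, h2⟩

theorem card_sameBlock_le (hM : 1 ≤ M) (T V : ℕ) :
    ((Finset.range T).filter fun t => lastUpdate M (t + 1) = V).card ≤ M := by
  calc ((Finset.range T).filter fun t => lastUpdate M (t + 1) = V).card
      ≤ (Finset.Ico V (V + M)).card := by
        refine Finset.card_le_card_of_injOn (fun t => t + 1) (fun t ht => ?_)
          fun t _ t' _ h => Nat.succ_injective h
        simp only [Finset.coe_filter, mem_ofPred_eq] at ht
        have h1 : lastUpdate M (t + 1) ≤ t + 1 := lastUpdate_le M (t + 1)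
        have h2 := lt_lastUpdate hM (t + 1)
        simp only [Finset.coe_Ico, mem_Ico]
        omega
    _ = M := by simp

open Classical in
-- One deviant round is charged by all rounds of its block, at most M of them. It may come after the
-- bad round in question, possibly beyond `T`, hence the longer range `T + M`.
theorem Initialized.card_bad_le (hI : Initialized s T A L₀ a ω) (hi : i ∈ A)
    (hM : 1 ≤ M) (hMK : M ≤ K) (hμ : Function.Injective μ) (hδ : 0 < δ)
    (hgap : ∀ k l, μ k < μ l → μ k + 4 * δ ≤ μ l) (hL : 0 ≤ L₀) (hn : 0 < obsTarget K T) :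
    ((Finset.range T).filter fun t : ℕ => L₀ + M < (t : ℝ) + 1 ∧
        ¬ StatsGood s i μ δ (lastUpdate M (t + 1)) ω).card ≤
      ∑ k, (M * ((Finset.range (T + M)).filter fun t =>
          ω ∈ deviantSet s i k M (μ k) δ (1 / (2 * K)) t).card +
        ((Finset.range T).filter fun t : ℕ => L₀ + M < (t : ℝ) + 1 ∧
          ω ∈ indexFailure s i T k (μ k) δ (lastUpdate M (t + 1))).card) := by
  set Dv : Fin K → Finset ℕ := fun k => (Finset.range (T + M)).filter fun t =>
    ω ∈ deviantSet s i k M (μ k) δ (1 / (2 * K)) t with hDv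
  set Fl : Fin K → Finset ℕ := fun k => (Finset.range T).filter fun t : ℕ =>
    L₀ + M < (t : ℝ) + 1 ∧ ω ∈ indexFailure s i T k (μ k) δ (lastUpdate M (t + 1)) with hFl
  have hsub : ((Finset.range T).filter fun t : ℕ => L₀ + M < (t : ℝ) + 1 ∧
      ¬ StatsGood s i μ δ (lastUpdate M (t + 1)) ω) ⊆
      Finset.univ.biUnion fun k => ((Dv k).biUnion fun t' => (Finset.range T).filter fun t =>
        lastUpdate M (t + 1) = lastUpdate M (t' + 1)) ∪ Fl k := by
    intro t ht
    simp only [Finset.mem_filter, Finset.mem_range] at ht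
    obtain ⟨k, hk⟩ := hI.exists_of_not_statsGood hi hM hMK hμ hδ hgap hL hn ht.2.1 ht.2.2
    refine Finset.mem_biUnion.2 ⟨k, Finset.mem_univ k, Finset.mem_union.2 ?_⟩
    rcases hk with ⟨t', h1, h2⟩ | h
    · left
      have h3 := lt_lastUpdate hM (t' + 1)
      have h4 : lastUpdate M (t + 1) ≤ t + 1 := lastUpdate_le M (t + 1)
      refine Finset.mem_biUnion.2 ⟨t', Finset.mem_filter.2 ⟨Finset.mem_range.2 (by omega), h2⟩,
        Finset.mem_filter.2 ⟨Finset.mem_range.2 ht.1, h1.symm⟩⟩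
    · exact Or.inr (Finset.mem_filter.2 ⟨Finset.mem_range.2 ht.1, ht.2.1, h⟩)
  refine (Finset.card_le_card hsub).trans (Finset.card_biUnion_le.trans
    (Finset.sum_le_sum fun k _ => (Finset.card_union_le _ _).trans (Nat.add_le_add_right ?_ _)))
  refine Finset.card_biUnion_le.trans ((Finset.sum_le_card_nsmul _ _ M fun t' _ =>
    card_sameBlock_le hM T _).trans ?_)
  rw [smul_eq_mul, mul_comm]

theorem Initialized.action_cases (hI : Initialized s T A L₀ a ω) (hi : i ∈ A)
    {t : ℕ} (ht : L₀ + M < (t : ℝ) + 1) (hg : StatsGood s i μ δ (lastUpdate M (t + 1)) ω) :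
    actions s ω t i = target M μ (a i) (t + 1) ∨
      (place μ (target M μ (a i) (t + 1)) + 1 = M ∧ actions s ω t i ∉ topArms M μ ∧
        pullMean s i (target M μ (a i) (t + 1)) (lastUpdate M (t + 1) - 1) ω ≤
          pullIndex s i (lastUpdate M (t + 1)) ω (actions s ω t i)) := by
  have hlt : L₀ < (t : ℝ) + 1 := by
    have : (0 : ℝ) ≤ M := Nat.cast_nonneg M
    linarith
  rw [actions_coop (hI.coop i hi), hI.choice_eq hi hlt]
  exact draw_exploChoice hg (a i) (t + 1) (hI.seed t i)

open Classical in
-- An exploration requires that the index of k reach the mean of the M-th arm, hence that (number of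
-- pulls) × kl ≤ F. Since the M-th arm is the target once per block, a player explores k at most
-- once per block, so the counts at the respective updates are distinct integers between 0 and F/kl.
theorem Initialized.card_explorations_le (hI : Initialized s T A L₀ a ω) (hi : i ∈ A)
    (hM : 1 ≤ M) (hMK : M ≤ K) (hδ : 0 < δ) (hμ0 : ∀ k, 0 < μ k) (hμ1 : ∀ k, μ k ≤ 1)
    (hgap : ∀ k l, μ k < μ l → μ k + 4 * δ ≤ μ l) (hL : 0 ≤ L₀) (hn : 0 < obsTarget K T)
    {F : ℝ} (hF : ∀ U : ℕ, L₀ < U → U ≤ T → explorationLevel U ≤ F) {e k : Fin K}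
    (he : place μ e + 1 = M) (hk : k ∉ topArms M μ) (hke : μ k < μ e) (hF0 : 0 ≤ F) :
    (((Finset.range T).filter fun t : ℕ => (L₀ + M < (t : ℝ) + 1 ∧
        StatsGood s i μ δ (lastUpdate M (t + 1)) ω) ∧ actions s ω t i = k).card : ℝ) ≤
      F / klReal (μ k + δ) (μ e - 2 * δ) + 1 := by
  have hg4 := hgap k e hke
  have hk0 := hμ0 k
  have he1 := hμ1 e
  have hkl : 0 < klReal (μ k + δ) (μ e - 2 * δ) := klReal_pos (by linarith) (by linarith)
    (by linarith)
  have hcard : ((Finset.range T).filter fun t : ℕ => (L₀ + M < (t : ℝ) + 1 ∧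
        StatsGood s i μ δ (lastUpdate M (t + 1)) ω) ∧ actions s ω t i = k).card ≤
      (Finset.range (⌊F / klReal (μ k + δ) (μ e - 2 * δ)⌋₊ + 1)).card := by
    have hprop : ∀ t ∈ ((Finset.range T).filter fun t : ℕ => (L₀ + M < (t : ℝ) + 1 ∧
        StatsGood s i μ δ (lastUpdate M (t + 1)) ω) ∧ actions s ω t i = k),
        target M μ (a i) (t + 1) = e ∧
        (pulls s i k (lastUpdate M (t + 1) - 1) ω : ℝ) * klReal (μ k + δ) (μ e - 2 * δ) ≤ F := by
      intro t ht
      simp only [Finset.mem_filter, Finset.mem_range] at ht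
      obtain ⟨htT, ⟨ht, hg⟩, hact⟩ := ht
      have hUL : L₀ < lastUpdate M (t + 1) := lt_lastUpdate_of_lt hM ht
      have hUT : lastUpdate M (t + 1) ≤ T := (lastUpdate_le M (t + 1)).trans htT
      rcases hI.action_cases hi ht hg with h | ⟨h1, h2, h3⟩
      · exact absurd (target_mem hM hMK (a i) (t + 1)) (by rw [← h, hact]; exact hk)
      · have hte : target M μ (a i) (t + 1) = e := place_injective μ (by omega)
        rw [hte, hact] at h3
        refine ⟨hte, ?_⟩
        have h4 := hg.explored k e hk he h3
        have h5 := hg.last_ge e he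
        have hne : pulls s i k (lastUpdate M (t + 1) - 1) ω ≠ 0 := by
          have := hn.trans_le (hI.obsTarget_le hi hL hUL k)
          exact_mod_cast this.ne'
        refine le_trans ?_ (hF _ hUL hUT)
        exact le_of_le_klIndex hne (pullMean_nonneg _ ω) h4 (by linarith) (by linarith)
          (show μ e - 2 * δ < μ e - δ by linarith) (by linarith) (h5.trans h3)
    refine Finset.card_le_card_of_injOn (fun t => pulls s i k (lastUpdate M (t + 1) - 1) ω) ?_ ?_
    · intro t ht
      have h1 := (hprop t ht).2
      simp only [Finset.coe_range, mem_Iio, Nat.lt_succ_iff]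
      exact Nat.le_floor ((le_div_iff₀ hkl).2 h1)
    · have key : ∀ t t', actions s ω t i = k →
          pulls s i k (lastUpdate M (t + 1) - 1) ω = pulls s i k (lastUpdate M (t' + 1) - 1) ω →
          0 < lastUpdate M (t + 1) → (t + 1) / M < (t' + 1) / M → False := by
        intro t t' h2 h3 h5 h4
        have h6 : t + 1 < lastUpdate M (t' + 1) := by
          unfold lastUpdate
          calc t + 1 < M * ((t + 1) / M + 1) := Nat.lt_mul_div_succ _ hM
            _ ≤ M * ((t' + 1) / M) := Nat.mul_le_mul_left M h4
        have h7 : lastUpdate M (t + 1) ≤ t + 1 := lastUpdate_le M (t + 1)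
        have := pulls_lt (s := s) (i := i) (k := k) (ω := ω) (n := lastUpdate M (t + 1) - 1)
          (n' := lastUpdate M (t' + 1) - 1) (t := t) (by omega) (by omega) h2
        omega
      intro t ht t' ht' h
      have h1 := (hprop t ht).1
      have h1' := (hprop t' ht').1
      simp only [Finset.coe_filter, Finset.mem_range, mem_ofPred_eq] at ht ht'
      have hp : 0 < lastUpdate M (t + 1) := by
        exact_mod_cast hL.trans_lt (lt_lastUpdate_of_lt hM ht.2.1.1)
      have hp' : 0 < lastUpdate M (t' + 1) := by
        exact_mod_cast hL.trans_lt (lt_lastUpdate_of_lt hM ht'.2.1.1)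
      rcases lt_trichotomy ((t + 1) / M) ((t' + 1) / M) with h2 | h2 | h2
      · exact (key t t' ht.2.2 h hp h2).elim
      · have h3 : (t + 1) % M = (t' + 1) % M :=
          Nat.ModEq.add_right_cancel' _ (target_inj hM hMK (h1.trans h1'.symm))
        have h4 := Nat.div_add_mod (t + 1) M
        have h5 := Nat.div_add_mod (t' + 1) M
        rw [h2, h3] at h4
        omega
      · exact (key t' t ht'.2.2 h.symm hp' h2).elim
  rw [Finset.card_range] at hcard
  have h1 : ((⌊F / klReal (μ k + δ) (μ e - 2 * δ)⌋₊ : ℕ) : ℝ) ≤ F / klReal (μ k + δ) (μ e - 2 * δ) :=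
    Nat.floor_le (by positivity)
  have h2 : (((Finset.range T).filter fun t : ℕ => (L₀ + M < (t : ℝ) + 1 ∧
        StatsGood s i μ δ (lastUpdate M (t + 1)) ω) ∧ actions s ω t i = k).card : ℝ) ≤
        ⌊F / klReal (μ k + δ) (μ e - 2 * δ)⌋₊ + 1 := by exact_mod_cast hcard
  linarith

/-- Cooperative players do not collide with each other in a good round. Distinct ranks have distinct
targets, explorers go to arms outside the top list, and only one rank has the M-th best arm as
target, so at most one of them explores. -/
theorem Initialized.exists_collision (hI : Initialized s T A L₀ a ω) (hi : i ∈ A) (hM : 1 ≤ M)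
    (hMK : M ≤ K) {t : ℕ} (hg : GoodRound s A μ δ L₀ t ω)
    (h : Collision (actions s ω t) (actions s ω t i)) :
    ∃ j ∉ A, Collision (actions s ω t) (actions s ω t j) := by
  obtain ⟨i', hne, he⟩ := exists_of_collision h
  by_cases hi' : i' ∈ A
  · exfalso
    have hane : target M μ (a i) (t + 1) ≠ target M μ (a i') (t + 1) := fun hh =>
      hne (hI.inj i' hi' i hi (Fin.ext (target_inj_rank hM hMK (hI.lt i' hi') (hI.lt i hi) hh.symm)))
    rcases hI.action_cases hi hg.1 (hg.2 i hi) with h1 | ⟨h1, h2, -⟩ <;>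
    rcases hI.action_cases hi' hg.1 (hg.2 i' hi') with h1' | ⟨h1', h2', -⟩
    · exact hane (h1.symm.trans (he.symm.trans h1'))
    · exact h2' (by rw [he, h1]; exact target_mem hM hMK _ _)
    · exact h2 (by rw [← he, h1']; exact target_mem hM hMK _ _)
    · exact hane (place_injective μ (by omega))
  · exact ⟨i', hi', by rw [he]; exact h⟩

open Classical in
-- Each round is compared with the target of the rotation: a bad round or a collision costs at most
-- B, an exploration costs the gap to the M-th best mean.
theorem Initialized.sum_netMean_ge (hI : Initialized s T A L₀ a ω) (hi : i ∈ A)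
    (hM : 1 ≤ M) (hMK : M ≤ K) (hδ : 0 < δ) (hμ0 : ∀ k, 0 < μ k)
    (hμ1 : ∀ k, μ k ≤ 1) {B : ℝ} (hB : ∀ k, μ k ≤ B)
    (hgap : ∀ k l, μ k < μ l → μ k + 4 * δ ≤ μ l) (hL : 0 ≤ L₀) (hn : 0 < obsTarget K T)
    {F : ℝ} (hF : ∀ U : ℕ, L₀ < U → U ≤ T → explorationLevel U ≤ F) {e : Fin K}
    (he : place μ e + 1 = M) (hke : ∀ k ∉ topArms M μ, μ k < μ e) (hF0 : 0 ≤ F) (Z : Finset ℕ)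
    (hZ : ∀ t < T, GoodRound s A μ δ L₀ t ω → Collision (actions s ω t) (actions s ω t i) →
      t ∈ Z) :
    T / M * ∑ k ∈ topArms M μ, μ k - M * B -
        B * ((Finset.range T).filter fun t => ¬ GoodRound s A μ δ L₀ t ω).card -
        (∑ k ∈ Finset.univ.filter (fun k => k ∉ topArms M μ),
          (μ e - μ k) * (F / klReal (μ k + δ) (μ e - 2 * δ) + 1)) - B * Z.card ≤
      ∑ t ∈ Finset.range T, netMean μ (actions s ω t) i := by
  have hB0 : 0 ≤ B := (hμ0 e).le.trans (hB e)
  have htarget := (abs_le.1 (abs_sum_target_sub_le hM hMK (fun k => (hμ0 k).le) hB (a i) T)).1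
  set X : Fin K → ℕ → Prop := fun k t => (L₀ + M < (t : ℝ) + 1 ∧
    StatsGood s i μ δ (lastUpdate M (t + 1)) ω) ∧ actions s ω t i = k with hX
  have hround : ∀ t ∈ Finset.range T, μ (target M μ (a i) (t + 1)) -
      B * (if ¬ GoodRound s A μ δ L₀ t ω then 1 else 0) -
      (∑ k ∈ Finset.univ.filter (fun k => k ∉ topArms M μ),
        (μ e - μ k) * (if X k t then 1 else 0)) - B * (if t ∈ Z then 1 else 0) ≤
      netMean μ (actions s ω t) i := by
    intro t htT
    have hX0 : ∀ k ∈ Finset.univ.filter (fun k => k ∉ topArms M μ),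
        0 ≤ (μ e - μ k) * (if X k t then (1 : ℝ) else 0) := fun k hk =>
      mul_nonneg (sub_nonneg.2 (hke k (Finset.mem_filter.1 hk).2).le) (by split_ifs <;> norm_num)
    have hXs := Finset.sum_nonneg hX0
    have hZ0 : 0 ≤ B * (if t ∈ Z then (1 : ℝ) else 0) :=
      mul_nonneg hB0 (by split_ifs <;> norm_num)
    have hnn := netMean_nonneg hμ0 (actions s ω t) i
    have htB := hB (target M μ (a i) (t + 1))
    by_cases hg : GoodRound s A μ δ L₀ t ω
    · rw [if_neg (not_not.2 hg)]
      have hcase : μ (target M μ (a i) (t + 1)) -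
          (∑ k ∈ Finset.univ.filter (fun k => k ∉ topArms M μ),
            (μ e - μ k) * (if X k t then 1 else 0)) ≤ μ (actions s ω t i) := by
        rcases hI.action_cases hi hg.1 (hg.2 i hi) with h | ⟨h1, h2, -⟩
        · have := congrArg μ h; linarith
        · have hte : target M μ (a i) (t + 1) = e := place_injective μ (by omega)
          have h3 := Finset.single_le_sum hX0
            (Finset.mem_filter.2 ⟨Finset.mem_univ (actions s ω t i), h2⟩)
          rw [if_pos (show X (actions s ω t i) t from ⟨⟨hg.1, hg.2 i hi⟩, rfl⟩), mul_one] at h3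
          rw [hte]; linarith
      by_cases hcol : Collision (actions s ω t) (actions s ω t i)
      · rw [if_pos (hZ t (Finset.mem_range.1 htT) hg hcol)]
        linarith
      · rw [netMean, if_neg hcol]; linarith
    · rw [if_pos hg]; linarith
  have hsum := Finset.sum_le_sum hround
  rw [Finset.sum_sub_distrib, Finset.sum_sub_distrib, Finset.sum_sub_distrib, ← Finset.mul_sum,
    ← Finset.mul_sum, Finset.sum_boole, Finset.sum_boole, Finset.sum_comm] at hsum
  have hexp : ∑ k ∈ Finset.univ.filter (fun k => k ∉ topArms M μ), ∑ t ∈ Finset.range T,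
      (μ e - μ k) * (if X k t then (1 : ℝ) else 0) ≤
      ∑ k ∈ Finset.univ.filter (fun k => k ∉ topArms M μ),
          (μ e - μ k) * (F / klReal (μ k + δ) (μ e - 2 * δ) + 1) := by
    refine Finset.sum_le_sum fun k hk => ?_
    have hk' := (Finset.mem_filter.1 hk).2
    rw [← Finset.mul_sum, Finset.sum_boole]
    exact mul_le_mul_of_nonneg_left (hI.card_explorations_le hi hM hMK hδ hμ0 hμ1 hgap hL hn hF he
      hk' (hke k hk') hF0) (sub_nonneg.2 (hke k hk').le)
  have hZc : B * (((Finset.range T).filter fun t => t ∈ Z).card : ℝ) ≤ B * Z.card := by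
    refine mul_le_mul_of_nonneg_left ?_ hB0
    exact_mod_cast Finset.card_le_card fun t ht => (Finset.mem_filter.1 ht).2
  linarith

open Classical in
-- The cooperative players leave one rank free, with index `c` below. In a good round without
-- collision the deviator has the target of `c`, or an arm outside the top list, or the M-th best
-- arm while its owner explores; none of these is worth more than the target of `c`. A collision
-- forfeits that target, which is worth at least μ_e.
theorem Initialized.sum_netMean_le {j : Fin M} (hI : Initialized s T (Finset.univ.erase j) L₀ a ω)
    (hM : 1 ≤ M) (hMK : M ≤ K) (hμ0 : ∀ k, 0 < μ k)
    {B : ℝ} (hB : ∀ k, μ k ≤ B) {e : Fin K}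
    (he : place μ e + 1 = M) (hke : ∀ k ∉ topArms M μ, μ k < μ e) :
    ∑ t ∈ Finset.range T, netMean μ (actions s ω t) j ≤
      T / M * ∑ k ∈ topArms M μ, μ k + M * B +
        2 * B * ((Finset.range T).filter fun t =>
          ¬ GoodRound s (Finset.univ.erase j) μ δ L₀ t ω).card -
        μ e * ((Finset.range T).filter fun t =>
          Collision (actions s ω t) (actions s ω t j)).card := by
  set A := Finset.univ.erase j with hA
  have hmemA : ∀ {i}, i ∈ A ↔ i ≠ j := fun {i} => by simp [hA]
  have hB0 : 0 ≤ B := (hμ0 e).le.trans (hB e)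
  -- The M - 1 cooperative ranks are distinct and below M, so exactly one value is missing.
  obtain ⟨c, hcM, hc⟩ : ∃ c < M, ∀ r < M, r ≠ c → ∃ i ∈ A, (a i).val = r := by
    have hinj : Set.InjOn (fun i => (a i).val) (A : Set (Fin M)) := fun i hi i' hi' h =>
      hI.inj i hi i' hi' (Fin.ext h)
    have hcard : (A.image fun i => (a i).val).card = M - 1 := by
      rw [Finset.card_image_of_injOn hinj, hA, Finset.card_erase_of_mem (Finset.mem_univ j)]; simp
    have hsub : (A.image fun i => (a i).val) ⊆ Finset.range M := fun r hr => by
      obtain ⟨i, hi, rfl⟩ := Finset.mem_image.1 hr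
      exact Finset.mem_range.2 (hI.lt i hi)
    have hsd : (Finset.range M \ A.image fun i => (a i).val).card = 1 := by
      rw [Finset.card_sdiff_of_subset hsub, hcard, Finset.card_range]; omega
    obtain ⟨c, hc⟩ := Finset.card_eq_one.1 hsd
    have hcm : c ∈ Finset.range M \ A.image fun i => (a i).val := by simp [hc]
    refine ⟨c, Finset.mem_range.1 (Finset.mem_sdiff.1 hcm).1, fun r hr hrc => ?_⟩
    by_contra hno
    have : r ∈ Finset.range M \ A.image fun i => (a i).val := by
      refine Finset.mem_sdiff.2 ⟨Finset.mem_range.2 hr, fun h => hno ?_⟩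
      obtain ⟨i, hi, h⟩ := Finset.mem_image.1 h
      exact ⟨i, hi, h⟩
    rw [hc, Finset.mem_singleton] at this
    exact hrc this
  have htarget := (abs_le.1 (abs_sum_target_sub_le hM hMK (fun k => (hμ0 k).le) hB c T)).2
  have hetop : ∀ k ∈ topArms M μ, μ e ≤ μ k := fun k hk =>
    place_le_imp (by have := mem_topArms.1 hk; omega)
  have hround : ∀ t ∈ Finset.range T, netMean μ (actions s ω t) j ≤
      μ (target M μ c (t + 1)) + 2 * B * (if ¬ GoodRound s A μ δ L₀ t ω then 1 else 0) -
      μ e * (if Collision (actions s ω t) (actions s ω t j) then 1 else 0) := by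
    intro t _
    have hte := hetop _ (target_mem hM hMK c (t + 1))
    by_cases hcol : Collision (actions s ω t) (actions s ω t j)
    · rw [netMean, if_pos hcol, if_pos hcol]
      have : 0 ≤ 2 * B * (if ¬ GoodRound s A μ δ L₀ t ω then (1 : ℝ) else 0) :=
        mul_nonneg (by linarith) (by split_ifs <;> norm_num)
      linarith
    · rw [netMean, if_neg hcol, if_neg hcol]
      by_cases hg : GoodRound s A μ δ L₀ t ω
      · rw [if_neg (not_not.2 hg)]
        suffices μ (actions s ω t j) ≤ μ (target M μ c (t + 1)) by linarith
        by_cases hj : actions s ω t j ∈ topArms M μ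
        · obtain ⟨r, hr, hrt⟩ := exists_target_eq hMK hj (t + 1)
          rcases eq_or_ne r c with rfl | hrc
          · rw [hrt]
          · obtain ⟨i, hi, hir⟩ := hc r hr hrc
            rw [← hir] at hrt
            rcases hI.action_cases hi hg.1 (hg.2 i hi) with h | ⟨h1, -, -⟩
            · exact absurd (collision_of_eq (hmemA.1 hi) (h.trans hrt)) hcol
            · rw [hrt] at h1
              have : actions s ω t j = e := place_injective μ (by omega)
              rw [this]; exact hte
        · exact (hke _ hj).le.trans hte
      · rw [if_pos hg]
        have h1 := hB (actions s ω t j)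
        have h2 := (hμ0 (target M μ c (t + 1))).le
        linarith
  have hsum := Finset.sum_le_sum hround
  rw [Finset.sum_sub_distrib, Finset.sum_add_distrib, ← Finset.mul_sum, ← Finset.mul_sum,
    Finset.sum_boole, Finset.sum_boole] at hsum
  linarith

end Pathwise

end MPBandit

namespace MPBandit
open Set

/-! ## The initialization along a trajectory -/

section Init

variable {K : ℕ}

/-- The number of sensed pulls of `k` among the first `m` rounds of a signal process. -/
def senses (g : ℕ → Signal K) (k : Fin K) (m : ℕ) : ℕ :=
  ((Finset.range m).filter fun r => (g r).1 = k ∧ (g r).2.1 = true).card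

/-- The number of those with a collision. -/
def sensedCollisions (g : ℕ → Signal K) (k : Fin K) (m : ℕ) : ℕ :=
  ((Finset.range m).filter fun r => (g r).1 = k ∧ (g r).2.1 = true ∧ (g r).2.2 = false).card

theorem senses_mono (g : ℕ → Signal K) (k : Fin K) : Monotone (senses g k) := fun _ _ h =>
  Finset.card_le_card (Finset.filter_subset_filter _ (Finset.range_mono h))

theorem card_fin_filter_min {t m : ℕ} (p : ℕ → Prop) [DecidablePred p] :
    (Finset.univ.filter fun r : Fin t => r.val < m ∧ p r.val).card =
      ((Finset.range (min m t)).filter p).card := by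
  rw [← card_fin_filter (t := t) (min_le_right m t)]
  congr 1
  ext r
  simp

theorem sensedCount_eq (g : ℕ → Signal K) (k : Fin K) (t m : ℕ) :
    sensedCount (fun r : Fin t => g r.val) k m = senses g k (min m t) :=
  card_fin_filter_min fun r => (g r).1 = k ∧ (g r).2.1 = true

theorem collisionCount_eq (g : ℕ → Signal K) (k : Fin K) (t m : ℕ) :
    collisionCount (fun r : Fin t => g r.val) k m = sensedCollisions g k (min m t) :=
  card_fin_filter_min fun r => (g r).1 = k ∧ (g r).2.1 = true ∧ (g r).2.2 = false

/-- The estimation of the number of players stops after round `m`. -/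
def StopsAt (T : ℕ) (g : ℕ → Signal K) (m : ℕ) : Prop :=
  IsLeast {m | ∀ k, obsTarget K T ≤ senses g k m} m

variable {T : ℕ} {g : ℕ → Signal K} {tm : ℕ}

theorem StopsAt.estimDone_iff (h : StopsAt T g tm) (t : ℕ) :
    EstimDone T (fun r : Fin t => g r.val) t ↔ tm ≤ t := by
  simp only [EstimDone, sensedCount_eq, min_self]
  constructor
  · exact fun hd => h.2 hd
  · intro ht k
    exact (h.1 k).trans (by exact_mod_cast senses_mono g k ht)

/-- A history of length `t` has constant counts beyond `t`. Because the criterion is met by time `tm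
≤ t`, this does not change the least time, and all longer histories agree on it. -/
theorem StopsAt.estimTime_eq (h : StopsAt T g tm) {t : ℕ} (ht : tm ≤ t) :
    estimTime T (fun r : Fin t => g r.val) = tm := by
  refine IsLeast.csInf_eq ⟨fun k => ?_, fun m hm => ?_⟩
  · rw [sensedCount_eq, min_eq_left ht]; exact h.1 k
  · by_contra hlt
    rw [not_le] at hlt
    refine absurd (h.2 (fun k => ?_ : m ∈ {m | ∀ k, obsTarget K T ≤ senses g k m})) (not_le.2 hlt)
    have := hm k
    rwa [sensedCount_eq, min_eq_left (by omega)] at this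

/-- The averaged empirical collision probability after `m` rounds. -/
def meanCollision (g : ℕ → Signal K) (m : ℕ) : ℝ :=
  (1 / (K : ℝ)) * ∑ k : Fin K, (sensedCollisions g k m : ℝ) / (senses g k m : ℝ)

/-- The estimate of the number of players when the averaged collision probability is `p`. -/
def playersEstimate (K : ℕ) (p : ℝ) : ℕ :=
  if p = 1 then K
  else min K (1 + (round (Real.log (1 - p) / Real.log (1 - 1 / (K : ℝ)))).toNat)

theorem StopsAt.estimM_eq (h : StopsAt T g tm) {t : ℕ} (ht : tm ≤ t) :
    estimM T (fun r : Fin t => g r.val) = playersEstimate K (meanCollision g tm) := by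
  have hav : avgCollision T (fun r : Fin t => g r.val) = meanCollision g tm := by
    simp only [avgCollision, meanCollision, h.estimTime_eq ht, collisionCount_eq, sensedCount_eq,
      min_eq_left ht]
  rw [estimM, hav, playersEstimate]

/-- There is a positive reward in round `r + 1`, during the attribution of ranks. -/
def IsWin (T : ℕ) (g : ℕ → Signal K) (tm r : ℕ) : Prop :=
  waitEnd tm < (r : ℝ) + 1 ∧ (r : ℝ) + 1 ≤ rankEnd K T tm ∧ (g r).2.2 = true

theorem StopsAt.rank_eq_none (h : StopsAt T g tm) {t : ℕ} (ht : tm ≤ t)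
    (hw : ∀ r < t, ¬ IsWin T g tm r) : rank T (fun r : Fin t => g r.val) = none := by
  rw [rank, dif_neg]
  rintro ⟨r, hr⟩
  simp only [rankWins, Finset.mem_filter, Finset.mem_univ, true_and, h.estimTime_eq ht] at hr
  exact hw r.val r.isLt hr

theorem StopsAt.rank_eq_some (h : StopsAt T g tm) {t r : ℕ} (ht : tm ≤ t) (hrt : r < t)
    (hr : IsLeast {r | IsWin T g tm r} r) :
    rank T (fun r : Fin t => g r.val) = some (g r).1 := by
  have hmem : ∀ q : Fin t, q ∈ rankWins T (fun r : Fin t => g r.val) ↔ IsWin T g tm q.val :=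
    fun q => by
      simp only [rankWins, Finset.mem_filter, Finset.mem_univ, true_and, h.estimTime_eq ht]
      rfl
  have hne : (rankWins T (fun r : Fin t => g r.val)).Nonempty := ⟨⟨r, hrt⟩, (hmem ⟨r, hrt⟩).2 hr.1⟩
  rw [rank, dif_pos hne]
  have hmin : (rankWins T (fun r : Fin t => g r.val)).min' hne = ⟨r, hrt⟩ := by
    refine le_antisymm (Finset.min'_le _ _ ((hmem ⟨r, hrt⟩).2 hr.1)) ?_
    exact hr.2 ((hmem _).1 (Finset.min'_mem _ hne))
  rw [hmin]

variable [NeZero K]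

/-- Uniform pulling covers the estimation and the first waiting room. If the estimation took at
least γ₁ τ rounds, this lasts until γ₂ τ, when every cooperative player has finished her own. -/
theorem StopsAt.initStep_uniform (hex : StopsAt T g tm) {t : ℕ}
    (ht : (t : ℝ) + 1 ≤ waitEnd tm) :
    initStep T (fun r : Fin t => g r.val) = .inl (.uniform Finset.univ) := by
  unfold initStep
  split_ifs with h1 h2 h3 h4
  · rfl
  · rw [hex.estimTime_eq ((hex.estimDone_iff t).1 h1)] at h2; exact absurd ht h2
  · rw [hex.estimTime_eq ((hex.estimDone_iff t).1 h1)] at h2; exact absurd ht h2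
  · rw [hex.estimTime_eq ((hex.estimDone_iff t).1 h1)] at h2; exact absurd ht h2
  · rfl

theorem initStep_eq_uniform_of_lt {t : ℕ} (ht : ∃ k, (senses g k t : ℝ) < obsTarget K T) :
    initStep T (fun r : Fin t => g r.val) = .inl (.uniform Finset.univ) := by
  obtain ⟨k, hk⟩ := ht
  unfold initStep
  rw [if_neg]
  intro h
  have := h k
  rw [sensedCount_eq, min_self] at this
  linarith

theorem le_of_waitEnd_lt {t : ℕ} (h : waitEnd tm < (t : ℝ) + 1) : tm ≤ t := by
  have h1 : (tm : ℝ) ≤ waitEnd tm := by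
    unfold waitEnd γ₁ γ₂
    have : (0 : ℝ) ≤ tm := Nat.cast_nonneg tm
    linarith
  have h2 : ((tm : ℕ) : ℝ) < ((t + 1 : ℕ) : ℝ) := by push_cast; linarith
  exact Nat.lt_succ_iff.1 (by exact_mod_cast h2)

theorem StopsAt.initStep_rank (h : StopsAt T g tm) {t : ℕ} (h1 : waitEnd tm < (t : ℝ) + 1)
    (h2 : (t : ℝ) + 1 ≤ rankEnd K T tm) :
    initStep T (fun r : Fin t => g r.val) = match rank T (fun r : Fin t => g r.val) with
      | none => .inl (.uniform (Finset.univ.filter fun k =>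
          k.val < playersEstimate K (meanCollision g tm)))
      | some a => .inl (.pull a) := by
  have ht := le_of_waitEnd_lt h1
  unfold initStep
  rw [if_pos ((h.estimDone_iff t).2 ht), h.estimTime_eq ht, if_neg (not_le.2 h1), if_pos h2,
    h.estimM_eq ht]

theorem StopsAt.initStep_wait (h : StopsAt T g tm) {t : ℕ} (h1 : waitEnd tm < (t : ℝ) + 1)
    (h2 : rankEnd K T tm < (t : ℝ) + 1) (h3 : (t : ℝ) + 1 ≤ initEnd K tm) :
    initStep T (fun r : Fin t => g r.val) =
      .inl (.pull ((rank T (fun r : Fin t => g r.val)).getD 0)) := by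
  have ht := le_of_waitEnd_lt h1
  unfold initStep
  rw [if_pos ((h.estimDone_iff t).2 ht), h.estimTime_eq ht, if_neg (not_le.2 h1),
    if_neg (not_le.2 h2), if_pos h3]

theorem StopsAt.initStep_end (h : StopsAt T g tm) {t : ℕ} (h1 : waitEnd tm < (t : ℝ) + 1)
    (h2 : rankEnd K T tm < (t : ℝ) + 1) (h3 : initEnd K tm < (t : ℝ) + 1) :
    initStep T (fun r : Fin t => g r.val) =
      .inr (playersEstimate K (meanCollision g tm), (rank T (fun r : Fin t => g r.val)).getD 0) := by
  have ht := le_of_waitEnd_lt h1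
  unfold initStep
  rw [if_pos ((h.estimDone_iff t).2 ht), h.estimTime_eq ht, if_neg (not_le.2 h1),
    if_neg (not_le.2 h2), if_neg (not_le.2 h3), h.estimM_eq ht]

end Init

/-! ### Outcome of a successful initialization: distinct ranks -/

section InitGame

variable {K M : ℕ}

/-- The signals of player `i`. -/
def signals (s : Fin M → Strategy K) (ω : ℕ → Draw K M) (i : Fin M) (r : ℕ) : Signal K :=
  signal (observe (ω r).1 (actions s ω r) i)

theorem signals_history (s : Fin M → Strategy K) (ω : ℕ → Draw K M) (i : Fin M) (t : ℕ) :
    (fun r => signal (history s ω i t r)) = fun r : Fin t => signals s ω i r.val := rfl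

theorem signals_win {s : Fin M → Strategy K} {ω : ℕ → Draw K M} {i : Fin M} {r : ℕ} :
    (signals s ω i r).2.2 = true ↔ ¬ Collision (actions s ω r) (actions s ω r i) ∧
      0 < (ω r).1 (actions s ω r i) := by
  simp only [signals, signal, observe, reward]
  split_ifs with h <;> simp [h]

theorem waitEnd_le_rankEnd {T : ℕ} (hT : 0 < Real.log T) (tm : ℕ) :
    waitEnd tm ≤ rankEnd K T tm := by
  unfold rankEnd obsTarget γ₁ β
  have : 0 ≤ tm * Real.log T / (13 / 14 * (39 ^ 2 * (K : ℝ) ^ 2 * Real.log T)) := by positivity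
  linarith

/-- A bound on the duration of the initialization when the estimation of the number of players
takes at most `γ₂ τ` rounds. -/
def initBound (K : ℕ) (τ : ℝ) : ℝ :=
  (γ₂ / (γ₁ ^ 2 * β ^ 2 * (K : ℝ) ^ 2) + γ₂ ^ 2 / γ₁ ^ 2) * (γ₂ * τ)

theorem initEnd_le_initBound {tm : ℕ} {τ : ℝ} (h : (tm : ℝ) ≤ γ₂ * τ) :
    initEnd K tm ≤ initBound K τ := by
  unfold initEnd initBound
  refine mul_le_mul_of_nonneg_left h ?_
  unfold γ₁ γ₂ β; positivity

variable [NeZero K]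

theorem rankEnd_eq {T : ℕ} (hT : 0 < Real.log T) (tm : ℕ) :
    rankEnd K T tm = (γ₂ / γ₁ + 1 / (γ₁ * β ^ 2 * (K : ℝ) ^ 2)) * tm := by
  have hK : (K : ℝ) ≠ 0 := by exact_mod_cast NeZero.ne K
  unfold rankEnd waitEnd obsTarget γ₁ γ₂ β
  field_simp

/-- The purpose of the second waiting room: stopping times between γ₁ τ and γ₂ τ differ by at most
the factor γ₂/γ₁, so nobody leaves her rank before all cooperative players have finished the
attribution. -/
theorem initEnd_eq {T : ℕ} (hT : 0 < Real.log T) (tm : ℕ) :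
    initEnd K tm = γ₂ / γ₁ * rankEnd K T tm := by
  have hK : (K : ℝ) ≠ 0 := by exact_mod_cast NeZero.ne K
  rw [rankEnd_eq hT]
  unfold initEnd γ₁ γ₂ β
  field_simp
  ring

theorem rankEnd_le_initEnd {T : ℕ} (hT : 0 < Real.log T) (tm : ℕ) :
    rankEnd K T tm ≤ initEnd K tm := by
  have h0 : 0 ≤ rankEnd K T tm := by
    rw [rankEnd_eq hT]; unfold γ₁ γ₂ β; positivity
  rw [initEnd_eq hT]
  unfold γ₁ γ₂
  linarith

/-- Along this trajectory, the players of `A` succeed in the estimation of the number of players,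
which takes them comparable times, and in the attribution of ranks. -/
structure InitSuccess (s : Fin M → Strategy K) (T : ℕ) (A : Finset (Fin M)) (τ : ℝ)
    (ω : ℕ → Draw K M) : Prop where
  seed : ∀ t i, ((ω t).2 i : ℝ) < 1
  success : ∀ i ∈ A, ∃ tm, StopsAt T (signals s ω i) tm ∧ γ₁ * τ ≤ tm ∧ tm ≤ γ₂ * τ ∧
    playersEstimate K (meanCollision (signals s ω i) tm) = M ∧ ∃ r, IsWin T (signals s ω i) tm r

/-- Suppose that two cooperative players win with the same arm, one not later than the other. The
first stays on it until her `initEnd`, which is not before the `rankEnd` of the second, so the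
second would have won in a collision, which is absurd. -/
theorem InitSuccess.exists_initialized {s : Fin M → Strategy K} {T : ℕ} {A : Finset (Fin M)}
    {τ : ℝ} {ω : ℕ → Draw K M} (h : InitSuccess s T A τ ω) (hM : 1 ≤ M)
    (hT : 0 < Real.log T) (hA : ∀ i ∈ A, s i = selfishRobust K T) :
    ∃ a, Initialized s T A (initBound K τ) a ω := by
  classical
  choose! tm htm using h.success
  have hwin : ∀ i ∈ A, ∃ r, IsLeast {r | IsWin T (signals s ω i) (tm i) r} r := fun i hi => by
    obtain ⟨r, hr⟩ := (htm i hi).2.2.2.2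
    exact ⟨Nat.find ⟨r, hr⟩, Nat.find_spec ⟨r, hr⟩, fun q hq => Nat.find_min' _ hq⟩
  choose! w hw using hwin
  have hact : ∀ i ∈ A, ∀ t S, S.Nonempty →
      initStep T (fun r : Fin t => signals s ω i r.val) = .inl (.uniform S) →
      actions s ω t i ∈ S := fun i hi t S hS hc => by
    rw [actions_coop (hA i hi), choice, signals_history, hc]
    exact pick_mem hS (h.seed t i)
  have hlt : ∀ i ∈ A, (actions s ω (w i) i).val < M := fun i hi => by
    obtain ⟨h1, h2, h3⟩ := (hw i hi).1
    have hs := (htm i hi).1.initStep_rank h1 h2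
    rw [(htm i hi).1.rank_eq_none (le_of_waitEnd_lt h1) fun r hr hr' =>
      absurd ((hw i hi).2 hr') (not_le.2 hr), (htm i hi).2.2.2.1] at hs
    have := hact i hi (w i) _ ⟨0, by simp; omega⟩ hs
    simpa using this
  have hpull : ∀ i ∈ A, ∀ t, w i < t → (t : ℝ) + 1 ≤ initEnd K (tm i) →
      actions s ω t i = actions s ω (w i) i := fun i hi t h1 h2 => by
    have hwt : waitEnd (tm i) < (t : ℝ) + 1 := by
      have := (hw i hi).1.1
      have h3 : ((w i : ℕ) : ℝ) < t := by exact_mod_cast h1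
      linarith
    have hr := (htm i hi).1.rank_eq_some (le_of_waitEnd_lt hwt) h1 (hw i hi)
    have hs : initStep T (fun r : Fin t => signals s ω i r.val) =
        .inl (.uniform {(signals s ω i (w i)).1}) := by
      rcases le_or_gt ((t : ℝ) + 1) (rankEnd K T (tm i)) with h3 | h3
      · rw [(htm i hi).1.initStep_rank hwt h3, hr]; rfl
      · rw [(htm i hi).1.initStep_wait hwt h3 h2, hr]; rfl
    exact Finset.mem_singleton.1 (hact i hi t _ (Finset.singleton_nonempty _) hs)
  have hle : ∀ i ∈ A, ∀ i' ∈ A, rankEnd K T (tm i') ≤ initEnd K (tm i) := fun i hi i' hi' => by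
    rw [initEnd_eq hT, rankEnd_eq hT, rankEnd_eq hT]
    have h1 := (htm i hi).2.1
    have h2 := (htm i' hi').2.2.1
    have hc : 0 ≤ (γ₂ / γ₁ + 1 / (γ₁ * β ^ 2 * (K : ℝ) ^ 2)) := by
      unfold γ₁ γ₂ β; positivity
    have h3 : (tm i' : ℝ) ≤ γ₂ / γ₁ * tm i := by
      unfold γ₁ γ₂ at *; linarith
    calc _ ≤ (γ₂ / γ₁ + 1 / (γ₁ * β ^ 2 * (K : ℝ) ^ 2)) * (γ₂ / γ₁ * tm i) :=
          mul_le_mul_of_nonneg_left h3 hc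
      _ = _ := by ring
  have hdist : ∀ i ∈ A, ∀ i' ∈ A, w i ≤ w i' →
      actions s ω (w i) i = actions s ω (w i') i' → i = i' := fun i hi i' hi' hww he => by
    by_contra hne
    have h1 : actions s ω (w i') i = actions s ω (w i') i' := by
      rcases hww.eq_or_lt with h1 | h1
      · rw [← he, h1]
      · rw [hpull i hi (w i') h1 ((hw i' hi').1.2.1.trans (hle i hi i' hi')), he]
    exact (signals_win.1 (hw i' hi').1.2.2).1 (collision_of_eq hne h1)
  refine ⟨fun i => actions s ω (w i) i, hA, h.seed, fun i hi i' hi' he => ?_, hlt,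
    fun i hi t ht => ?_⟩
  · rcases le_total (w i) (w i') with hc | hc
    · exact hdist i hi i' hi' hc he
    · exact (hdist i' hi' i hi hc he.symm).symm
  · have h3 : initEnd K (tm i) < (t : ℝ) + 1 :=
      (initEnd_le_initBound (htm i hi).2.2.1).trans_lt ht
    have h2 := (rankEnd_le_initEnd (K := K) hT (tm i)).trans_lt h3
    have h1 := (waitEnd_le_rankEnd (K := K) hT (tm i)).trans_lt h2
    have hwt : w i < t := by
      have := (hw i hi).1.2.1.trans_lt h2
      have h4 : ((w i : ℕ) : ℝ) < t := by linarith
      exact_mod_cast h4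
    rw [signals_history, (htm i hi).1.initStep_end h1 h2 h3, (htm i hi).2.2.2.1,
      (htm i hi).1.rank_eq_some (le_of_waitEnd_lt h1) hwt (hw i hi)]
    rfl

end InitGame

end MPBandit

namespace MPBandit
open Set

/-! ## Concentration of the numbers of sensed and of solitary pulls -/

section Concentration

variable {K M : ℕ}

theorem pullProb_nonneg (s : Fin M → Strategy K) (t : ℕ) (i : Fin M) (k : Fin K)
    (ω : ℕ → Draw K M) : 0 ≤ pullProb s t i k ω := measureReal_nonneg

/-- The conditional probability that player `i` is the only one to pull `k` in round `t + 1`. -/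
def soloProb (s : Fin M → Strategy K) (t : ℕ) (i : Fin M) (k : Fin K) (ω : ℕ → Draw K M) : ℝ :=
  pullProb s t i k ω * ∏ i' ∈ Finset.univ.erase i, (1 - pullProb s t i' k ω)

theorem measurable_soloProb (s : Fin M → Strategy K) (t : ℕ) (i : Fin M) (k : Fin K) :
    Measurable (soloProb s t i k) :=
  (measurable_pullProb s t i k).mul (Finset.measurable_prod _ fun i' _ =>
    (measurable_pullProb s t i' k).const_sub 1)

theorem dependsBefore_soloProb (s : Fin M → Strategy K) (t : ℕ) (i : Fin M) (k : Fin K) :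
    DependsBefore t (soloProb s t i k) := fun r hr ω x => by
  simp only [soloProb, fun i' => dependsBefore_pullProb s t i' k r hr ω x]

/-- Player `i` pulls `k` in round `t + 1` and sees a positive quality. -/
def sensedEvent (s : Fin M → Strategy K) (i : Fin M) (k : Fin K) (t : ℕ) :
    Set (ℕ → Draw K M) :=
  {ω | 0 < (ω t).1 k ∧ actions s ω t i = k}

/-- Moreover, no other player pulls `k`. -/
def soloEvent (s : Fin M → Strategy K) (i : Fin M) (k : Fin K) (t : ℕ) : Set (ℕ → Draw K M) :=
  {ω | 0 < (ω t).1 k ∧ actions s ω t i = k ∧ ∀ i', i' ≠ i → actions s ω t i' ≠ k}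

theorem measurableSet_pos_quality (k : Fin K) (t : ℕ) :
    MeasurableSet {ω : ℕ → Draw K M | 0 < (ω t).1 k} :=
  (show Measurable fun ω : ℕ → Draw K M => (ω t).1 k by fun_prop) measurableSet_pos

theorem measurableSet_sensedEvent (s : Fin M → Strategy K) (i : Fin M) (k : Fin K) (t : ℕ) :
    MeasurableSet (sensedEvent s i k t) :=
  (measurableSet_pos_quality k t).inter (measurableSet_actions_eq s t i k)

theorem measurableSet_soloEvent (s : Fin M → Strategy K) (i : Fin M) (k : Fin K) (t : ℕ) :
    MeasurableSet (soloEvent s i k t) := by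
  have h : {ω | ∀ i', i' ≠ i → actions s ω t i' ≠ k} =
      ⋂ i', ⋂ _ : i' ≠ i, {ω | actions s ω t i' = k}ᶜ := by
    ext ω; simp
  have h' : MeasurableSet {ω | ∀ i', i' ≠ i → actions s ω t i' ≠ k} := by
    rw [h]
    exact MeasurableSet.iInter fun i' => MeasurableSet.iInter fun _ =>
      (measurableSet_actions_eq s t i' k).compl
  exact (measurableSet_pos_quality k t).inter ((measurableSet_actions_eq s t i k).inter h')

theorem dependsBefore_sensedEvent (s : Fin M → Strategy K) (i : Fin M) (k : Fin K) (t : ℕ) :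
    DependsBefore (t + 1) fun ω => ω ∈ sensedEvent s i k t := fun r hr ω x => by
  simp only [sensedEvent, mem_ofPred_eq, dependsBefore_actions s t r hr ω x,
    Function.update_of_ne (show t ≠ r by omega)]

theorem dependsBefore_soloEvent (s : Fin M → Strategy K) (i : Fin M) (k : Fin K) (t : ℕ) :
    DependsBefore (t + 1) fun ω => ω ∈ soloEvent s i k t := fun r hr ω x => by
  simp only [soloEvent, mem_ofPred_eq, dependsBefore_actions s t r hr ω x,
    Function.update_of_ne (show t ≠ r by omega)]

theorem roundLaw_real_sensedEvent (ν : Fin K → ProbabilityMeasure unitInterval)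
    (s : Fin M → Strategy K) (i : Fin M) (k : Fin K) (t : ℕ) (ω : ℕ → Draw K M) :
    (roundLaw ν M).real {x | Function.update ω t x ∈ sensedEvent s i k t} =
      posProb ν k * pullProb s t i k ω := by
  simp only [sensedEvent, mem_ofPred_eq, actions_update, Function.update_self]
  exact roundLaw_real_sensed ν k i {u | stepArm s ω t i u = k}

theorem roundLaw_real_soloEvent (ν : Fin K → ProbabilityMeasure unitInterval)
    (s : Fin M → Strategy K) (i : Fin M) (k : Fin K) (t : ℕ) (ω : ℕ → Draw K M) :
    (roundLaw ν M).real {x | Function.update ω t x ∈ soloEvent s i k t} =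
      posProb ν k * soloProb s t i k ω := by
  simp only [soloEvent, mem_ofPred_eq, actions_update, Function.update_self]
  refine (roundLaw_real_alone ν k i fun i' => {u | stepArm s ω t i' u = k}).trans ?_
  congr 2
  refine Finset.prod_congr rfl fun i' _ => ?_
  exact probReal_compl_eq_one_sub (measurable_stepArm s ω i' t (measurableSet_singleton k))

/-- The number of solitary sensed pulls of `k` by player `i` in the first `m` rounds. -/
def soloCount (s : Fin M → Strategy K) (i : Fin M) (k : Fin K) (m : ℕ) (ω : ℕ → Draw K M) : ℝ :=
  ∑ t ∈ Finset.range m, (soloEvent s i k t).indicator 1 ω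

theorem signals_sensed {s : Fin M → Strategy K} {ω : ℕ → Draw K M} {i : Fin M} {r : ℕ} :
    (signals s ω i r).2.1 = true ↔ 0 < (ω r).1 (actions s ω r i) :=
  decide_eq_true_iff

theorem signals_arm (s : Fin M → Strategy K) (ω : ℕ → Draw K M) (i : Fin M) (r : ℕ) :
    (signals s ω i r).1 = actions s ω r i := rfl

theorem senses_eq_sum (s : Fin M → Strategy K) (i : Fin M) (k : Fin K) (m : ℕ)
    (ω : ℕ → Draw K M) :
    (senses (signals s ω i) k m : ℝ) =
      ∑ t ∈ Finset.range m, (sensedEvent s i k t).indicator 1 ω := by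
  classical
  simp only [Set.indicator_apply, Pi.one_apply, Finset.sum_boole, senses]
  congr 2
  refine Finset.filter_congr fun r _ => ?_
  simp only [signals_sensed, signals_arm, sensedEvent, mem_ofPred_eq]
  constructor
  · rintro ⟨rfl, h⟩; exact ⟨h, rfl⟩
  · rintro ⟨h, rfl⟩; exact ⟨rfl, h⟩

theorem measure_senses_deviation_le (ν : Fin K → ProbabilityMeasure unitInterval)
    (s : Fin M → Strategy K) (i : Fin M) (k : Fin K) (m : ℕ) {a v : ℝ} (ha : 0 ≤ a)
    (hv : 0 < v) (hav : a ≤ 2 * v) {σ : ℝ} (hσ : σ = 1 ∨ σ = -1) :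
    gameLaw ν M {ω | a ≤ σ * (senses (signals s ω i) k m -
        posProb ν k * ∑ t ∈ Finset.range m, pullProb s t i k ω) ∧
      posProb ν k * ∑ t ∈ Finset.range m, pullProb s t i k ω ≤ v} ≤
      ENNReal.ofReal (Real.exp (-(a ^ 2 / (4 * v)))) := by
  have h := measure_occurrences_le (D := roundLaw ν M) (Y := sensedEvent s i k)
    (c := fun t ω => posProb ν k * pullProb s t i k ω)
    (measurableSet_sensedEvent s i k) (dependsBefore_sensedEvent s i k)
    (fun t => (measurable_pullProb s t i k).const_mul _)
    (fun t r hr ω x => by simp only [dependsBefore_pullProb s t i k r hr ω x])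
    (roundLaw_real_sensedEvent ν s i k) m ha hv hav σ hσ
  rw [gameLaw_eq]
  refine (measure_mono fun ω hω => ?_).trans h
  simp only [mem_ofPred_eq, senses_eq_sum, Finset.sum_sub_distrib, ← Finset.mul_sum] at hω ⊢
  exact hω

theorem measure_soloCount_deviation_le (ν : Fin K → ProbabilityMeasure unitInterval)
    (s : Fin M → Strategy K) (i : Fin M) (k : Fin K) (m : ℕ) {a v : ℝ} (ha : 0 ≤ a)
    (hv : 0 < v) (hav : a ≤ 2 * v) {σ : ℝ} (hσ : σ = 1 ∨ σ = -1) :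
    gameLaw ν M {ω | a ≤ σ * (soloCount s i k m ω -
        posProb ν k * ∑ t ∈ Finset.range m, soloProb s t i k ω) ∧
      posProb ν k * ∑ t ∈ Finset.range m, soloProb s t i k ω ≤ v} ≤
      ENNReal.ofReal (Real.exp (-(a ^ 2 / (4 * v)))) := by
  have h := measure_occurrences_le (D := roundLaw ν M) (Y := soloEvent s i k)
    (c := fun t ω => posProb ν k * soloProb s t i k ω)
    (measurableSet_soloEvent s i k) (dependsBefore_soloEvent s i k)
    (fun t => (measurable_soloProb s t i k).const_mul _)
    (fun t r hr ω x => by simp only [dependsBefore_soloProb s t i k r hr ω x])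
    (roundLaw_real_soloEvent ν s i k) m ha hv hav σ hσ
  rw [gameLaw_eq]
  refine (measure_mono fun ω hω => ?_).trans h
  simp only [mem_ofPred_eq, soloCount, Finset.sum_sub_distrib, ← Finset.mul_sum] at hω ⊢
  exact hω

/-- A sensed pull without collision is solitary. -/
theorem sensedCollisions_eq (s : Fin M → Strategy K) (i : Fin M) (k : Fin K) (m : ℕ)
    (ω : ℕ → Draw K M) :
    (sensedCollisions (signals s ω i) k m : ℝ) =
      senses (signals s ω i) k m - soloCount s i k m ω := by
  classical
  rw [eq_sub_iff_add_eq]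
  simp only [soloCount, Set.indicator_apply, Pi.one_apply, Finset.sum_boole, senses,
    sensedCollisions]
  norm_cast
  rw [← Finset.card_filter_add_card_filter_not (s := (Finset.range m).filter fun r =>
    (signals s ω i r).1 = k ∧ (signals s ω i r).2.1 = true) fun r =>
      (signals s ω i r).2.2 = false]
  congr 2
  · rw [Finset.filter_filter]
    exact Finset.filter_congr fun r _ => by tauto
  · rw [Finset.filter_filter]
    refine Finset.filter_congr fun r _ => ?_
    rw [Bool.not_eq_false, signals_win, signals_sensed, signals_arm]
    simp only [soloEvent, mem_ofPred_eq]
    constructor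
    · rintro ⟨h1, h2, h3⟩
      refine ⟨⟨h2, by rwa [h2]⟩, fun hc => ?_, by rwa [h2]⟩
      obtain ⟨i', hi', he⟩ := exists_of_collision hc
      exact h3 i' hi' (he.trans h2)
    · rintro ⟨⟨rfl, h2⟩, h3, h4⟩
      exact ⟨h2, rfl, fun i' hi' he => h3 (collision_of_eq hi' he)⟩

end Concentration

end MPBandit

namespace MPBandit
open Set

/-! ## The duration of the estimation of the number of players -/

section Duration

variable {K M : ℕ} [NeZero K] {s : Fin M → Strategy K} {i : Fin M} {T : ℕ}

theorem pullProb_uniform (hs : s i = selfishRobust K T) {ω : ℕ → Draw K M} {t : ℕ}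
    {S : Finset (Fin K)}
    (h : initStep T (fun r : Fin t => signals s ω i r.val) = .inl (.uniform S)) {k : Fin K}
    (hk : k ∈ S) : pullProb s t i k ω = 1 / S.card := by
  simp only [pullProb, stepArm_coop hs, choice, signals_history, h]
  exact volume_pick hk

theorem pullProb_uniform_univ (hs : s i = selfishRobust K T) {ω : ℕ → Draw K M} {t : ℕ}
    (h : initStep T (fun r : Fin t => signals s ω i r.val) = .inl (.uniform Finset.univ))
    (k : Fin K) : pullProb s t i k ω = 1 / K := by
  rw [pullProb_uniform hs h (Finset.mem_univ k), Finset.card_univ, Fintype.card_fin]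

/-- The estimation of the number of players takes between `γ₁ τ` and `γ₂ τ` rounds. -/
def StopsNear (T : ℕ) (g : ℕ → Signal K) (τ : ℝ) : Prop :=
  ∃ tm, StopsAt T g tm ∧ γ₁ * τ ≤ tm ∧ tm ≤ γ₂ * τ

theorem StopsNear.initStep_uniform {g : ℕ → Signal K} {τ : ℝ} (h : StopsNear T g τ) {t : ℕ}
    (ht : (t : ℝ) + 1 ≤ γ₂ * τ) :
    initStep T (fun r : Fin t => g r.val) = .inl (.uniform Finset.univ) := by
  obtain ⟨tm, h1, h2, -⟩ := h
  refine h1.initStep_uniform (ht.trans ?_)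
  unfold waitEnd γ₁ γ₂ at *
  linarith

theorem obsTarget_ge (hT : 1 ≤ Real.log T) : 1521 * Real.log T ≤ obsTarget K T := by
  have hK : (1 : ℝ) ≤ K := by exact_mod_cast Nat.one_le_iff_ne_zero.2 (NeZero.ne K)
  unfold obsTarget β
  nlinarith [mul_nonneg (sub_nonneg.2 (one_le_pow₀ hK : (1 : ℝ) ≤ (K : ℝ) ^ 2)) (zero_le_one.trans hT)]

theorem exp_neg_le_inv_pow {T : ℕ} (hT : 0 < T) {x : ℝ} (c : ℕ) (hx : c * Real.log T ≤ x) :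
    Real.exp (-x) ≤ 1 / (T : ℝ) ^ c := by
  have hT' : (0 : ℝ) < T := by exact_mod_cast hT
  rw [one_div, ← Real.exp_log (pow_pos hT' c), ← Real.exp_neg, Real.exp_le_exp, Real.log_pow]
  linarith

theorem pos_of_one_le_log (hT : 1 ≤ Real.log T) : 0 < T := by
  rcases Nat.eq_zero_or_pos T with rfl | h
  · norm_num at hT
  · exact h

/-- While the criterion is not met, pulls are uniform, so arm k needs about n K / `posProb ν k`
rounds, and the slowest arm `k₀` fixes τ. Stopping late means that some arm still has fewer than n
sensed pulls at time γ₂ τ. Stopping early means that `k₀` reached n before γ₁ τ; here a union over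
all possible times is taken. -/
theorem measure_not_stopsNear_le (ν : Fin K → ProbabilityMeasure unitInterval)
    (hs : s i = selfishRobust K T) (hT : 1 ≤ Real.log T) {p : ℝ} (hp0 : 0 < p)
    (hp : ∀ k, p ≤ posProb ν k) {k₀ : Fin K} (hk₀ : posProb ν k₀ = p) :
    gameLaw ν M {ω | ¬ StopsNear T (signals s ω i) (obsTarget K T * K / p)} ≤
      ENNReal.ofReal (K / T + (γ₂ * (obsTarget K T * K / p) + 1) / (T : ℝ) ^ 2) := by
  set n := obsTarget K T with hn
  set τ := n * K / p with hτ
  have hTpos : 0 < T := pos_of_one_le_log hT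
  have hn1 : 1521 * Real.log T ≤ n := obsTarget_ge hT
  have hn0 : 0 < n := by linarith
  have hK : (0 : ℝ) < K := by exact_mod_cast Nat.pos_of_ne_zero (NeZero.ne K)
  have hK1 : (1 : ℝ) ≤ K := by exact_mod_cast Nat.one_le_iff_ne_zero.2 (NeZero.ne K)
  have hτ0 : 0 < τ := by positivity
  have hg2 : 0 ≤ γ₂ * τ := mul_nonneg (by unfold γ₂; norm_num) hτ0.le
  set N := ⌊γ₂ * τ⌋₊ with hN
  have hN1 : (N : ℝ) ≤ γ₂ * τ := Nat.floor_le hg2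
  have hN2 : γ₂ * τ - 1 ≤ N := (sub_lt_iff_lt_add.2 (Nat.lt_floor_add_one _)).le
  set V : Fin K → ℝ := fun k => N * posProb ν k / K with hV
  -- The step from γ₂ = 16/15 down to 17/16 pays for rounding γ₂ τ to an integer, since n is large.
  -- It makes a count below n fall short of its expectation V by at least V/17.
  have hV1 : ∀ k, 17 / 16 * n ≤ V k := fun k => by
    have hx1 : posProb ν k / K ≤ 1 := by
      rw [div_le_one hK]
      exact (measureReal_le_one).trans hK1
    have hx2 : n ≤ τ * (posProb ν k / K) := by
      have h1 : n = τ * (p / K) := by rw [hτ]; field_simp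
      rw [h1]
      exact mul_le_mul_of_nonneg_left (by gcongr; exact hp k) hτ0.le
    have hx0 : 0 ≤ posProb ν k / K := div_nonneg measureReal_nonneg hK.le
    have h2 : V k = N * (posProb ν k / K) := by rw [hV]; ring
    have h3 := mul_le_mul_of_nonneg_right hN2 hx0
    have h4 : (γ₂ * τ - 1) * (posProb ν k / K) =
        γ₂ * (τ * (posProb ν k / K)) - posProb ν k / K := by ring
    rw [h2]
    unfold γ₂ at *
    linarith
  set B₁ : Fin K → Set (ℕ → Draw K M) := fun k =>
    {ω | V k / 17 ≤ (-1) * (senses (signals s ω i) k N -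
        posProb ν k * ∑ t ∈ Finset.range N, pullProb s t i k ω) ∧
      posProb ν k * ∑ t ∈ Finset.range N, pullProb s t i k ω ≤ V k} with hB₁
  set B₂ : ℕ → Set (ℕ → Draw K M) := fun m =>
    {ω | n / 14 ≤ 1 * (senses (signals s ω i) k₀ m -
        posProb ν k₀ * ∑ t ∈ Finset.range m, pullProb s t i k₀ ω) ∧
      posProb ν k₀ * ∑ t ∈ Finset.range m, pullProb s t i k₀ ω ≤ 13 / 14 * n} with hB₂
  have hsub : {ω | ¬ StopsNear T (signals s ω i) τ} ⊆
      (⋃ k ∈ (Finset.univ : Finset (Fin K)), B₁ k) ∪ ⋃ m ∈ Finset.range (N + 1), B₂ m := by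
    intro ω hω
    by_contra hcon
    simp only [mem_union, mem_iUnion, not_or, not_exists, Finset.mem_univ, Finset.mem_range] at hcon
    refine hω ?_
    have hdone : ∀ k, n ≤ senses (signals s ω i) k N := fun k => by
      by_contra hlt
      rw [not_le] at hlt
      refine hcon.1 k trivial ?_
      have hsum : posProb ν k * ∑ t ∈ Finset.range N, pullProb s t i k ω = V k := by
        rw [Finset.sum_congr rfl fun t ht => pullProb_uniform_univ hs (initStep_eq_uniform_of_lt
          ⟨k, lt_of_le_of_lt (by exact_mod_cast senses_mono _ k (Finset.mem_range.1 ht).le) hlt⟩) k]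
        simp only [Finset.sum_const, Finset.card_range, nsmul_eq_mul, hV]
        ring
      have := hV1 k
      refine ⟨?_, hsum.le⟩
      rw [hsum]
      linarith
    have hne : {m | ∀ k, n ≤ senses (signals s ω i) k m}.Nonempty := ⟨N, hdone⟩
    refine ⟨sInf {m | ∀ k, n ≤ senses (signals s ω i) k m}, ⟨Nat.sInf_mem hne,
      fun m hm => Nat.sInf_le hm⟩, ?_, (Nat.cast_le.2 (Nat.sInf_le (show N ∈ {m | ∀ k, n ≤ senses (signals s ω i) k m} from
        hdone))).trans hN1⟩
    set tm := sInf {m | ∀ k, n ≤ senses (signals s ω i) k m} with htm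
    by_contra hlt
    rw [not_le] at hlt
    have htN : tm ≤ N :=
      Nat.sInf_le (show N ∈ {m | ∀ k, n ≤ senses (signals s ω i) k m} from hdone)
    refine hcon.2 tm (by omega) ?_
    have hun : ∀ t < tm, ∃ k, (senses (signals s ω i) k t : ℝ) < n := fun t ht => by
      by_contra hc
      simp only [not_exists, not_lt] at hc
      exact absurd (Nat.sInf_le (show t ∈ {m | ∀ k, n ≤ senses (signals s ω i) k m} from hc))
        (not_le.2 ht)
    have hsum : posProb ν k₀ * ∑ t ∈ Finset.range tm, pullProb s t i k₀ ω = tm * (p / K) := by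
      rw [Finset.sum_congr rfl fun t ht => pullProb_uniform_univ hs (initStep_eq_uniform_of_lt
        (hun t (Finset.mem_range.1 ht))) k₀, hk₀]
      simp only [Finset.sum_const, Finset.card_range, nsmul_eq_mul]
      ring
    have hle : (tm : ℝ) * (p / K) ≤ 13 / 14 * n := by
      calc (tm : ℝ) * (p / K) ≤ γ₁ * τ * (p / K) := by gcongr
        _ = 13 / 14 * n := by rw [hτ, γ₁]; field_simp
    have hge := (Nat.sInf_mem hne) k₀
    rw [← htm] at hge
    refine ⟨?_, ?_⟩
    · rw [hsum]; linarith
    · rw [hsum]; exact hle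
  have h₁ : ∀ k, gameLaw ν M (B₁ k) ≤ ENNReal.ofReal (1 / T) := fun k => by
    have hVk := hV1 k
    have hV0 : 0 < V k := by linarith
    refine (measure_senses_deviation_le ν s i k N (by positivity) hV0 (by linarith)
      (Or.inr rfl)).trans (ENNReal.ofReal_le_ofReal ?_)
    refine (exp_neg_le_inv_pow hTpos 1 ?_).trans (by rw [pow_one])
    have h1 : (V k / 17) ^ 2 / (4 * V k) = V k / 1156 := by field_simp; norm_num
    rw [h1]
    push_cast
    linarith
  have h₂ : ∀ m, gameLaw ν M (B₂ m) ≤ ENNReal.ofReal (1 / (T : ℝ) ^ 2) := fun m => by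
    refine (measure_senses_deviation_le ν s i k₀ m (by positivity) (by positivity) (by linarith)
      (Or.inl rfl)).trans (ENNReal.ofReal_le_ofReal ?_)
    refine exp_neg_le_inv_pow hTpos 2 ?_
    -- This event is summed over order τ times, so its probability must be at most T⁻². That is
    -- where β = 39 is needed: β² = 1521 exceeds 2 · 728 = 1456.
    have h1 : (n / 14) ^ 2 / (4 * (13 / 14 * n)) = n / 728 := by field_simp; norm_num
    rw [h1]
    push_cast
    linarith
  calc gameLaw ν M {ω | ¬ StopsNear T (signals s ω i) τ}
      ≤ ∑ k : Fin K, gameLaw ν M (B₁ k) + ∑ m ∈ Finset.range (N + 1), gameLaw ν M (B₂ m) :=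
        (measure_mono hsub).trans ((measure_union_le _ _).trans
          (add_le_add (measure_biUnion_finset_le _ _) (measure_biUnion_finset_le _ _)))
    _ ≤ ∑ k : Fin K, ENNReal.ofReal (1 / T) +
          ∑ m ∈ Finset.range (N + 1), ENNReal.ofReal (1 / (T : ℝ) ^ 2) :=
        add_le_add (Finset.sum_le_sum fun k _ => h₁ k) (Finset.sum_le_sum fun m _ => h₂ m)
    _ = ENNReal.ofReal (K / T + (N + 1) / (T : ℝ) ^ 2) := by
        rw [← ENNReal.ofReal_sum_of_nonneg fun _ _ => by positivity,
          ← ENNReal.ofReal_sum_of_nonneg fun _ _ => by positivity,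
          ← ENNReal.ofReal_add (by positivity) (by positivity)]
        congr 1
        simp only [Finset.sum_const, Finset.card_univ, Fintype.card_fin, Finset.card_range,
          nsmul_eq_mul]
        push_cast
        ring
    _ ≤ _ := by
        refine ENNReal.ofReal_le_ofReal ?_
        gcongr

end Duration

end MPBandit

namespace MPBandit
open Set

/-! ## The estimate of the number of players -/

section Estimate

/-- Rounding is correct if log(1 - p) is within half of |log(1 - 1/K)| of its ideal value, and y/2
with y = 1/K suffices, as |log(1-y)| ≥ y. The ideal value Q = (1-1/K)^(M-1) stays above 1/e, so an
error of order 1/(9K) is small relative to Q. -/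
theorem playersEstimate_eq {K M : ℕ} (hM : 2 ≤ M) (hMK : M ≤ K) {p ε : ℝ}
    (hε : ε = 1 / (9 * K))
    (h1 : ((1 - 1 / (K : ℝ)) ^ (M - 1) - ε) / (1 + ε) ≤ 1 - p)
    (h2 : 1 - p ≤ ((1 - 1 / (K : ℝ)) ^ (M - 1) + ε) / (1 - ε)) :
    playersEstimate K p = M := by
  have hK2 : (2 : ℝ) ≤ K := by exact_mod_cast hM.trans hMK
  have hK : (0 : ℝ) < K := by linarith
  set y : ℝ := 1 / (K : ℝ) with hy
  have hy0 : 0 < y := by positivity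
  have hy2 : y ≤ 1 / 2 := one_div_le_one_div_of_le two_pos hK2
  have hε' : ε = y / 9 := by rw [hε, hy]; field_simp
  set L : ℝ := -Real.log (1 - y) with hL
  have hLy : y ≤ L := by
    have := Real.log_le_sub_one_of_pos (show 0 < 1 - y by linarith)
    rw [hL]; linarith
  have hL0 : 0 < L := hy0.trans_le hLy
  set Q : ℝ := (1 - y) ^ (M - 1) with hQ
  have hlogQ : Real.log Q = -((M : ℝ) - 1) * L := by
    rw [hQ, Real.log_pow, hL, Nat.cast_sub (by omega)]
    push_cast
    ring
  have hQ0 : 0 < Q := pow_pos (by linarith) _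
  -- Since M - 1 ≤ K - 1 and |log(1 - 1/K)| ≤ 1/(K-1), one gets Q ≥ 1/e > 0.367.
  have hQe : 367 / 1000 ≤ Q := by
    have h3 : -1 ≤ Real.log Q := by
      have h4 : L ≤ 1 / ((K : ℝ) - 1) := by
        have h5 := Real.one_sub_inv_le_log_of_pos (show 0 < 1 - y by linarith)
        have h6 : 1 - (1 - y)⁻¹ = -(1 / ((K : ℝ) - 1)) := by
          have : (K : ℝ) - 1 ≠ 0 := by linarith
          rw [hy]; field_simp; ring
        rw [hL]; linarith
      have h7 : ((M : ℝ) - 1) * L ≤ ((K : ℝ) - 1) * (1 / ((K : ℝ) - 1)) := by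
        have : (M : ℝ) ≤ K := by exact_mod_cast hMK
        exact mul_le_mul (by linarith) h4 hL0.le (by linarith)
      rw [mul_one_div_cancel (by linarith)] at h7
      rw [hlogQ]; linarith
    have h4 : Real.exp (-1) ≤ Q := by
      rw [← Real.exp_log hQ0]; exact Real.exp_le_exp.2 h3
    have h5 := Real.exp_one_lt_d9
    have h6 : Real.exp (-1) * Real.exp 1 = 1 := by rw [← Real.exp_add]; simp
    nlinarith [Real.exp_pos (-1)]
  -- The constant 0.303 is 1/(9 · 0.367), rounded up.
  have hx : ε / Q ≤ 303 / 1000 * y := by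
    rw [div_le_iff₀ hQ0, hε']
    nlinarith
  set x : ℝ := ε / Q with hxdef
  have hx0 : 0 ≤ x := div_nonneg (by rw [hε']; positivity) hQ0.le
  have hεx : ε = x * Q := by rw [hxdef]; field_simp
  have hx1 : x < 1 := by linarith
  have hε1 : ε < 1 := by rw [hε']; linarith
  have hε0 : 0 < ε := by rw [hε']; positivity
  have hp0 : 0 < 1 - p := by
    refine lt_of_lt_of_le (div_pos ?_ (by linarith)) h1
    rw [hεx]; nlinarith
  have hlow : Real.log Q - y / 2 < Real.log (1 - p) := by
    have h3 : Real.log ((Q - ε) / (1 + ε)) ≤ Real.log (1 - p) := by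
      refine Real.log_le_log (div_pos ?_ (by linarith)) h1
      rw [hεx]; nlinarith
    have h4 : Q - ε = Q * (1 - x) := by rw [hεx]; ring
    rw [Real.log_div (by rw [h4]; exact (mul_pos hQ0 (by linarith)).ne') (by linarith), h4,
      Real.log_mul hQ0.ne' (by linarith)] at h3
    have h5 := Real.one_sub_inv_le_log_of_pos (show 0 < 1 - x by linarith)
    have h6 := Real.log_le_sub_one_of_pos (show 0 < 1 + ε by linarith)
    have h7 : (1 - x)⁻¹ - 1 ≤ 36 / 100 * y := by
      have h9 : 0 < 1 - x := by linarith
      rw [sub_le_iff_le_add, inv_le_comm₀ h9 (by positivity), inv_le_iff_one_le_mul₀ (by positivity)]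
      nlinarith
    linarith
  have hup : Real.log (1 - p) < Real.log Q + y / 2 := by
    have h3 := Real.log_le_log hp0 h2
    have h4 : Q + ε = Q * (1 + x) := by rw [hεx]; ring
    rw [Real.log_div (by rw [h4]; positivity) (by linarith), h4,
      Real.log_mul hQ0.ne' (by linarith)] at h3
    have h5 := Real.one_sub_inv_le_log_of_pos (show 0 < 1 - ε by linarith)
    have h6 := Real.log_le_sub_one_of_pos (show 0 < 1 + x by linarith)
    have h7 : (1 - ε)⁻¹ - 1 ≤ 12 / 100 * y := by
      have h9 : 0 < 1 - ε := by linarith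
      rw [sub_le_iff_le_add, inv_le_comm₀ h9 (by positivity), inv_le_iff_one_le_mul₀ (by positivity),
        hε']
      nlinarith
    linarith
  have hr : round (Real.log (1 - p) / Real.log (1 - y)) = ((M - 1 : ℕ) : ℤ) := by
    have h3 : Real.log (1 - y) = -L := by rw [hL]; ring
    rw [h3, round_eq, Int.floor_eq_iff, Int.cast_natCast, Nat.cast_sub (by omega), Nat.cast_one,
      div_neg]
    have h4 : Real.log (1 - p) / L < -((M : ℝ) - 1) + 1 / 2 := by
      rw [div_lt_iff₀ hL0]
      nlinarith
    have h5 : -((M : ℝ) - 1) - 1 / 2 < Real.log (1 - p) / L := by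
      rw [lt_div_iff₀ hL0]
      nlinarith
    constructor <;> linarith
  rw [playersEstimate, if_neg (by linarith), hr, Int.toNat_natCast]
  omega

/-- This is where the estimate becomes immune to a deviator: ρ is her average distribution over the
arms, `F` counts solitary pulls, and in the mean over arms of q (1 - ρ_k), with q = (1-1/K)^(M-2),
only the sum of the ρ_k remains, which is 1. -/
theorem playersEstimate_meanCollision {K M : ℕ} [NeZero K] (hM : 2 ≤ M) (hMK : M ≤ K)
    {g : ℕ → Signal K} {m : ℕ} {ε : ℝ} (hε : ε = 1 / (9 * K)) {F V ρ : Fin K → ℝ}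
    (hF : ∀ k, (sensedCollisions g k m : ℝ) = senses g k m - F k) (hV : ∀ k, 0 < V k)
    (hF0 : ∀ k, 0 ≤ F k) (hρ : ∑ k, ρ k = 1) (hρ0 : ∀ k, 0 ≤ ρ k)
    (hN : ∀ k, |senses g k m - V k| ≤ ε * V k)
    (hFV : ∀ k, |F k - V k * ((1 - 1 / (K : ℝ)) ^ (M - 2) * (1 - ρ k))| ≤ ε * V k) :
    playersEstimate K (meanCollision g m) = M := by
  have hK2 : (2 : ℝ) ≤ K := by exact_mod_cast hM.trans hMK
  have hK : (0 : ℝ) < K := by linarith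
  have hε0 : 0 < ε := by rw [hε]; positivity
  have hε1 : ε < 1 := by rw [hε, div_lt_one (by positivity)]; linarith
  have hρ1 : ∀ k, ρ k ≤ 1 := fun k => by
    rw [← hρ]; exact Finset.single_le_sum (fun k _ => hρ0 k) (Finset.mem_univ k)
  set q : ℝ := (1 - 1 / (K : ℝ)) ^ (M - 2) with hq
  have hq0 : 0 ≤ q := pow_nonneg (by rw [sub_nonneg, div_le_one hK]; linarith) _
  have hNpos : ∀ k, 0 < (senses g k m : ℝ) := fun k => by
    have h1 := (abs_le.1 (hN k)).1
    nlinarith [hV k]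
  have hmean : 1 - meanCollision g m = (1 / K) * ∑ k, F k / senses g k m := by
    have h1 : ∀ k, (sensedCollisions g k m : ℝ) / senses g k m = 1 - F k / senses g k m :=
      fun k => by rw [hF, sub_div, div_self (hNpos k).ne']
    rw [meanCollision, Finset.sum_congr rfl fun k _ => h1 k, Finset.sum_sub_distrib]
    simp only [Finset.sum_const, Finset.card_univ, Fintype.card_fin, nsmul_eq_mul, mul_one]
    field_simp
    ring
  have hQ : (1 - 1 / (K : ℝ)) ^ (M - 1) = (1 / K) * ∑ k, q * (1 - ρ k) := by
    rw [← Finset.mul_sum, Finset.sum_sub_distrib, hρ]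
    simp only [Finset.sum_const, Finset.card_univ, Fintype.card_fin, nsmul_eq_mul, mul_one]
    rw [show M - 1 = (M - 2) + 1 by omega, pow_succ, ← hq]
    field_simp
  have hconst : ∀ c : ℝ, (1 / (K : ℝ)) * ∑ _k : Fin K, c = c := fun c => by
    simp only [Finset.sum_const, Finset.card_univ, Fintype.card_fin, nsmul_eq_mul]
    field_simp
  refine playersEstimate_eq hM hMK hε ?_ ?_
  · rw [hmean, hQ]
    have h1 : ∀ k, (q * (1 - ρ k) - ε) / (1 + ε) ≤ F k / senses g k m := fun k => by
      rw [div_le_div_iff₀ (by linarith) (hNpos k)]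
      rcases le_or_gt (q * (1 - ρ k) - ε) 0 with h | h
      · exact (mul_nonpos_of_nonpos_of_nonneg h (hNpos k).le).trans
          (mul_nonneg (hF0 k) (by linarith))
      · have h2 := (abs_le.1 (hN k)).2
        have h3 := (abs_le.1 (hFV k)).1
        calc (q * (1 - ρ k) - ε) * senses g k m ≤ (q * (1 - ρ k) - ε) * ((1 + ε) * V k) :=
              mul_le_mul_of_nonneg_left (by linarith) h.le
          _ = (V k * (q * (1 - ρ k)) - ε * V k) * (1 + ε) := by ring
          _ ≤ F k * (1 + ε) := mul_le_mul_of_nonneg_right (by linarith) (by linarith)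
    calc _ = (1 / (K : ℝ)) * ∑ k, (q * (1 - ρ k) - ε) / (1 + ε) := by
          rw [← Finset.sum_div, Finset.sum_sub_distrib, ← mul_div_assoc, mul_sub, hconst ε]
      _ ≤ _ := mul_le_mul_of_nonneg_left (Finset.sum_le_sum fun k _ => h1 k) (by positivity)
  · rw [hmean, hQ]
    have h1 : ∀ k, F k / senses g k m ≤ (q * (1 - ρ k) + ε) / (1 - ε) := fun k => by
      rw [div_le_div_iff₀ (hNpos k) (by linarith)]
      have h2 := (abs_le.1 (hN k)).1
      have h3 := (abs_le.1 (hFV k)).2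
      have h4 : 0 ≤ q * (1 - ρ k) + ε :=
        add_nonneg (mul_nonneg hq0 (sub_nonneg.2 (hρ1 k))) hε0.le
      calc F k * (1 - ε) ≤ (V k * (q * (1 - ρ k)) + ε * V k) * (1 - ε) :=
            mul_le_mul_of_nonneg_right (by linarith) (by linarith)
        _ = (q * (1 - ρ k) + ε) * ((1 - ε) * V k) := by ring
        _ ≤ (q * (1 - ρ k) + ε) * senses g k m := mul_le_mul_of_nonneg_left (by linarith) h4
    calc _ ≤ (1 / (K : ℝ)) * ∑ k, (q * (1 - ρ k) + ε) / (1 - ε) :=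
          mul_le_mul_of_nonneg_left (Finset.sum_le_sum fun k _ => h1 k) (by positivity)
      _ = _ := by
          rw [← Finset.sum_div, Finset.sum_add_distrib, ← mul_div_assoc, mul_add, hconst ε]

end Estimate

/-! ### Probability of a wrong estimate of the number of players -/

section EstimateGame

variable {K M : ℕ} [NeZero K] {s : Fin M → Strategy K} {i j : Fin M} {T : ℕ}

/-- The deviator may adapt her pulls to the past; the Bernstein bounds compare counts with the sums
of conditional probabilities, so only her time-averaged probabilities enter. The stopping time is
random, whence the union over all times m between γ₁ τ and γ₂ τ. -/
theorem measure_playersEstimate_ne_le (ν : Fin K → ProbabilityMeasure unitInterval)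
    (hs : ∀ i', i' ≠ j → s i' = selfishRobust K T) (hij : i ≠ j) (hMK : M ≤ K)
    (hT : 1 ≤ Real.log T) {p : ℝ} (hp0 : 0 < p) (hp : ∀ k, p ≤ posProb ν k) {τ : ℝ}
    (hτ : τ = obsTarget K T * K / p) :
    gameLaw ν M {ω | (∀ i', i' ≠ j → StopsNear T (signals s ω i') τ) ∧
      ∃ m : ℕ, γ₁ * τ ≤ m ∧ m ≤ γ₂ * τ ∧
        playersEstimate K (meanCollision (signals s ω i) m) ≠ M} ≤
      ENNReal.ofReal (4 * K * (γ₂ * τ + 1) / (T : ℝ) ^ 2) := by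
  classical
  have hM : 2 ≤ M := by
    have h1 := i.isLt
    have h2 := j.isLt
    by_contra hc
    exact hij (Fin.ext (by omega))
  set n := obsTarget K T with hn
  have hTpos : 0 < T := pos_of_one_le_log hT
  have hn1 : 1521 * (K : ℝ) ^ 2 * Real.log T = n := by rw [hn, obsTarget, β]; norm_num
  have hK : (0 : ℝ) < K := by exact_mod_cast Nat.pos_of_ne_zero (NeZero.ne K)
  have hn0 : 0 < n := by rw [← hn1]; positivity
  have hτ0 : 0 < τ := by rw [hτ]; positivity
  have hg2 : 0 ≤ γ₂ * τ := mul_nonneg (by unfold γ₂; norm_num) hτ0.le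
  set N := ⌊γ₂ * τ⌋₊ with hN
  have hN1 : (N : ℝ) ≤ γ₂ * τ := Nat.floor_le hg2
  set ε : ℝ := 1 / (9 * K) with hε
  have hε0 : 0 < ε := by positivity
  have hε1 : ε ≤ 1 := by
    have hK1 : (1 : ℝ) ≤ K := by exact_mod_cast Nat.one_le_iff_ne_zero.2 (NeZero.ne K)
    rw [hε, div_le_one (by positivity)]; linarith
  set V : ℕ → Fin K → ℝ := fun m k => m * posProb ν k / K with hV
  have hV1 : ∀ m : ℕ, γ₁ * τ ≤ m → ∀ k, 13 / 14 * n ≤ V m k := fun m hm k => by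
    calc 13 / 14 * n = γ₁ * τ * p / K := by rw [hτ, γ₁]; field_simp
      _ ≤ V m k := by
        simp only [hV]
        gcongr
        exact hp k
  set S : ℝ → ℕ → Fin K → Set (ℕ → Draw K M) := fun σ m k =>
    {ω | ε * V m k ≤ σ * (senses (signals s ω i) k m -
        posProb ν k * ∑ t ∈ Finset.range m, pullProb s t i k ω) ∧
      posProb ν k * ∑ t ∈ Finset.range m, pullProb s t i k ω ≤ V m k} with hS
  set F : ℝ → ℕ → Fin K → Set (ℕ → Draw K M) := fun σ m k =>
    {ω | ε * V m k ≤ σ * (soloCount s i k m ω -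
        posProb ν k * ∑ t ∈ Finset.range m, soloProb s t i k ω) ∧
      posProb ν k * ∑ t ∈ Finset.range m, soloProb s t i k ω ≤ V m k} with hFs
  set I : Finset ℕ := (Finset.range (N + 1)).filter fun m : ℕ => γ₁ * τ ≤ m with hI
  have hexp : ∀ m : ℕ, γ₁ * τ ≤ m → ∀ k,
      Real.exp (-((ε * V m k) ^ 2 / (4 * V m k))) ≤ 1 / (T : ℝ) ^ 2 := fun m hm k => by
    have hVm := hV1 m hm k
    have hV0 : 0 < V m k := by linarith
    refine exp_neg_le_inv_pow hTpos 2 ?_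
    -- This fixes the factor K² in n: V is at least 13/14 · 1521 K² log T, so the exponent exceeds 2
    -- log T, enough for a union over times.
    have h1 : (ε * V m k) ^ 2 / (4 * V m k) = V m k / (324 * (K : ℝ) ^ 2) := by
      rw [hε]; field_simp; norm_num
    rw [h1, le_div_iff₀ (by positivity)]
    push_cast
    have h2 : 0 ≤ (K : ℝ) ^ 2 * Real.log T := by positivity
    nlinarith
  have hSle : ∀ σ : ℝ, (σ = 1 ∨ σ = -1) → ∀ m : ℕ, γ₁ * τ ≤ m → ∀ k,
      gameLaw ν M (S σ m k) ≤ ENNReal.ofReal (1 / (T : ℝ) ^ 2) := fun σ hσ m hm k => by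
    have hV0 : 0 < V m k := by linarith [hV1 m hm k]
    exact (measure_senses_deviation_le ν s i k m (by positivity) hV0 (by nlinarith) hσ).trans
      (ENNReal.ofReal_le_ofReal (hexp m hm k))
  have hFle : ∀ σ : ℝ, (σ = 1 ∨ σ = -1) → ∀ m : ℕ, γ₁ * τ ≤ m → ∀ k,
      gameLaw ν M (F σ m k) ≤ ENNReal.ofReal (1 / (T : ℝ) ^ 2) := fun σ hσ m hm k => by
    have hV0 : 0 < V m k := by linarith [hV1 m hm k]
    exact (measure_soloCount_deviation_le ν s i k m (by positivity) hV0 (by nlinarith) hσ).trans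
      (ENNReal.ofReal_le_ofReal (hexp m hm k))
  have hsub : {ω | (∀ i', i' ≠ j → StopsNear T (signals s ω i') τ) ∧
      ∃ m : ℕ, γ₁ * τ ≤ m ∧ m ≤ γ₂ * τ ∧
        playersEstimate K (meanCollision (signals s ω i) m) ≠ M} ⊆
      ⋃ m ∈ I, ⋃ k ∈ (Finset.univ : Finset (Fin K)),
        ((S 1 m k ∪ S (-1) m k) ∪ (F 1 m k ∪ F (-1) m k)) := by
    rintro ω ⟨hnear, m, hm1, hm2, hne⟩
    by_contra hcon
    have hmI : m ∈ I := by
      rw [hI, Finset.mem_filter, Finset.mem_range]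
      exact ⟨Nat.lt_succ_of_le (Nat.le_floor hm2), hm1⟩
    simp only [mem_iUnion, mem_union, not_exists, not_or, Finset.mem_univ] at hcon
    have hcon := fun k => hcon m hmI k trivial
    have hm0 : (0 : ℝ) < m := lt_of_lt_of_le (mul_pos (by unfold γ₁; norm_num) hτ0) hm1
    have hV0 : ∀ k, 0 < V m k := fun k => by linarith [hV1 m hm1 k]
    -- The first waiting room is used here: players who stopped early keep pulling uniformly until
    -- γ₂ τ, so the collision statistics of the slower ones are not distorted.
    have hun : ∀ i', i' ≠ j → ∀ t ∈ Finset.range m, ∀ k, pullProb s t i' k ω = 1 / K :=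
      fun i' hi' t ht k => by
        refine pullProb_uniform_univ (hs i' hi') ((hnear i' hi').initStep_uniform ?_) k
        refine le_trans ?_ hm2
        exact_mod_cast Finset.mem_range.1 ht
    have hsum : ∀ k, posProb ν k * ∑ t ∈ Finset.range m, pullProb s t i k ω = V m k := fun k => by
      rw [Finset.sum_congr rfl fun t ht => hun i hij t ht k]
      simp only [Finset.sum_const, Finset.card_range, nsmul_eq_mul, hV]
      ring
    set ρ : Fin K → ℝ := fun k => (∑ t ∈ Finset.range m, pullProb s t j k ω) / m with hρ
    have hsolo : ∀ k, ∀ t ∈ Finset.range m, soloProb s t i k ω =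
        (1 / K) * ((1 - 1 / (K : ℝ)) ^ (M - 2) * (1 - pullProb s t j k ω)) := fun k t ht => by
      rw [soloProb, hun i hij t ht k, ← Finset.mul_prod_erase _ _
        (Finset.mem_erase.2 ⟨hij.symm, Finset.mem_univ j⟩),
        Finset.prod_congr rfl fun i' hi' => by rw [hun i' (Finset.ne_of_mem_erase hi') t ht k],
        Finset.prod_const, Finset.card_erase_of_mem
          (Finset.mem_erase.2 ⟨hij.symm, Finset.mem_univ j⟩),
        Finset.card_erase_of_mem (Finset.mem_univ i), Finset.card_univ, Fintype.card_fin,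
        Nat.sub_sub]
      ring
    have hsum' : ∀ k, posProb ν k * ∑ t ∈ Finset.range m, soloProb s t i k ω =
        V m k * ((1 - 1 / (K : ℝ)) ^ (M - 2) * (1 - ρ k)) := fun k => by
      rw [Finset.sum_congr rfl (hsolo k), ← Finset.mul_sum, ← Finset.mul_sum,
        Finset.sum_sub_distrib]
      simp only [Finset.sum_const, Finset.card_range, nsmul_eq_mul, mul_one, hρ, hV]
      field_simp
    have hρ0 : ∀ k, 0 ≤ ρ k := fun k =>
      div_nonneg (Finset.sum_nonneg fun t _ => pullProb_nonneg s t j k ω) hm0.le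
    have hq0 : 0 ≤ 1 - 1 / (K : ℝ) := by
      have hK1 : (1 : ℝ) ≤ K := by exact_mod_cast Nat.one_le_iff_ne_zero.2 (NeZero.ne K)
      rw [sub_nonneg, div_le_one hK]; exact hK1
    have hq1 : (1 - 1 / (K : ℝ)) ^ (M - 2) ≤ 1 :=
      pow_le_one₀ hq0 (by rw [sub_le_self_iff]; positivity)
    have hρs : ∑ k, ρ k = 1 := by
      simp only [hρ]
      rw [← Finset.sum_div, Finset.sum_comm, Finset.sum_congr rfl fun t _ => sum_pullProb s t j ω]
      simp only [Finset.sum_const, Finset.card_range, nsmul_eq_mul, mul_one]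
      exact div_self hm0.ne'
    have hρ1 : ∀ k, ρ k ≤ 1 := fun k => by
      rw [← hρs]; exact Finset.single_le_sum (fun k _ => hρ0 k) (Finset.mem_univ k)
    refine hne (playersEstimate_meanCollision hM hMK hε
      (F := fun k => soloCount s i k m ω) (V := V m) (ρ := ρ)
      (fun k => sensedCollisions_eq s i k m ω) hV0 (fun k => Finset.sum_nonneg fun t _ =>
        Set.indicator_nonneg (fun _ _ => zero_le_one) ω) hρs hρ0 (fun k => ?_) fun k => ?_)
    · obtain ⟨⟨h1, h2⟩, -⟩ := hcon k
      simp only [hS, mem_ofPred_eq, hsum k, le_refl, and_true, not_le] at h1 h2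
      rw [abs_le]
      constructor <;> linarith
    · obtain ⟨-, h1, h2⟩ := hcon k
      have hle : V m k * ((1 - 1 / (K : ℝ)) ^ (M - 2) * (1 - ρ k)) ≤ V m k := by
        refine mul_le_of_le_one_right (hV0 k).le (mul_le_one₀ hq1 (by linarith [hρ1 k]) ?_)
        linarith [hρ0 k]
      simp only [hFs, mem_ofPred_eq, hsum' k, hle, and_true, not_le] at h1 h2
      rw [abs_le]
      constructor <;> linarith
  have h4 : ∀ m ∈ I, ∀ k, gameLaw ν M ((S 1 m k ∪ S (-1) m k) ∪ (F 1 m k ∪ F (-1) m k)) ≤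
      ENNReal.ofReal (4 / (T : ℝ) ^ 2) := fun m hm k => by
    have hm1 : γ₁ * τ ≤ m := (Finset.mem_filter.1 hm).2
    refine (measure_union_le _ _).trans ((add_le_add (measure_union_le _ _)
      (measure_union_le _ _)).trans ((add_le_add
        (add_le_add (hSle 1 (Or.inl rfl) m hm1 k) (hSle (-1) (Or.inr rfl) m hm1 k))
        (add_le_add (hFle 1 (Or.inl rfl) m hm1 k) (hFle (-1) (Or.inr rfl) m hm1 k))).trans_eq ?_))
    rw [← ENNReal.ofReal_add (by positivity) (by positivity),
      ← ENNReal.ofReal_add (by positivity) (by positivity)]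
    congr 1
    ring
  calc _ ≤ ∑ m ∈ I, ∑ k : Fin K, gameLaw ν M ((S 1 m k ∪ S (-1) m k) ∪ (F 1 m k ∪ F (-1) m k)) :=
        (measure_mono hsub).trans ((measure_biUnion_finset_le _ _).trans
          (Finset.sum_le_sum fun m _ => measure_biUnion_finset_le _ _))
    _ ≤ ∑ m ∈ I, ∑ k : Fin K, ENNReal.ofReal (4 / (T : ℝ) ^ 2) :=
        Finset.sum_le_sum fun m hm => Finset.sum_le_sum fun k _ => h4 m hm k
    _ ≤ ∑ m ∈ Finset.range (N + 1), ∑ k : Fin K, ENNReal.ofReal (4 / (T : ℝ) ^ 2) :=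
        Finset.sum_le_sum_of_subset (Finset.filter_subset _ _)
    _ = ENNReal.ofReal (4 * K * (N + 1) / (T : ℝ) ^ 2) := by
        simp only [Finset.sum_const, Finset.card_univ, Fintype.card_fin, Finset.card_range,
          nsmul_eq_mul]
        rw [← ENNReal.ofReal_natCast, ← ENNReal.ofReal_natCast,
          ← ENNReal.ofReal_mul (by positivity), ← ENNReal.ofReal_mul (by positivity)]
        congr 1
        push_cast
        ring
    _ ≤ _ := by
        refine ENNReal.ofReal_le_ofReal ?_
        gcongr

end EstimateGame

end MPBandit

namespace MPBandit
open Set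

/-! ## The attribution of ranks -/

section Waiting

variable {E : Type*} [MeasurableSpace E] {D : Measure E} [IsProbabilityMeasure D]

/-- Adapted events `S t` that have conditional probability at least `x` on the predictable events
`V t` can only be avoided for a long time with a small probability. -/
theorem measure_avoid_le {V S : ℕ → Set (ℕ → E)} (hV : ∀ t, MeasurableSet (V t))
    (hVd : ∀ t, DependsBefore t (fun ω => ω ∈ V t)) (hS : ∀ t, MeasurableSet (S t))
    (hSd : ∀ t, DependsBefore (t + 1) (fun ω => ω ∈ S t)) {x : ℝ}
    (hx : ∀ t, ∀ ω ∈ V t, x ≤ D.real {y | Function.update ω t y ∈ S t}) (hx0 : 0 ≤ x) (m : ℕ)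
    (W : ℝ) :
    (Measure.infinitePi fun _ : ℕ => D)
      {ω | (∀ t, ω ∈ V t → ω ∉ S t) ∧ W ≤ ∑ t ∈ Finset.range m, (V t).indicator (1 : (ℕ → E) → ℝ) ω} ≤
      ENNReal.ofReal (Real.exp (-(x * W))) := by
  classical
  -- On `V t` the conditional mean of this factor is at most exp(x) (1 - x) ≤ 1. If all `S t` are
  -- avoided, the product is exp(x) to the number of visits to the `V t`.
  set G : ℕ → (ℕ → E) → ENNReal := fun t ω =>
    if ω ∈ V t then (if ω ∈ S t then 0 else ENNReal.ofReal (Real.exp x)) else 1 with hG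
  have hGm : ∀ t, Measurable (G t) := fun t =>
    Measurable.ite (hV t) (Measurable.ite (hS t) measurable_const measurable_const)
      measurable_const
  have hGd : ∀ t, DependsBefore (t + 1) (G t) := fun t r hr ω y => by
    have h1 : (Function.update ω r y ∈ V t) = (ω ∈ V t) := hVd t r (by omega) ω y
    have h2 : (Function.update ω r y ∈ S t) = (ω ∈ S t) := hSd t r hr ω y
    simp only [hG, h1, h2]
  have hG1 : ∀ t ω, ∫⁻ y, G t (Function.update ω t y) ∂D ≤ 1 := fun t ω => by
    have h1 : ∀ y, (Function.update ω t y ∈ V t) = (ω ∈ V t) := fun y => hVd t t le_rfl ω y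
    by_cases hω : ω ∈ V t
    · have hSm : MeasurableSet {y | Function.update ω t y ∈ S t} := measurable_update ω (hS t)
      have h2 : ∀ y, G t (Function.update ω t y) =
          ({y | Function.update ω t y ∈ S t}ᶜ).indicator
            (fun _ => ENNReal.ofReal (Real.exp x)) y := fun y => by
        simp only [hG, h1, hω, if_true, Set.indicator_apply, mem_compl_iff, mem_ofPred_eq]
        split_ifs <;> simp_all
      simp only [h2]
      rw [lintegral_indicator_const hSm.compl, ← ofReal_measureReal, probReal_compl_eq_one_sub hSm,
        ← ENNReal.ofReal_mul (Real.exp_pos _).le, ENNReal.ofReal_le_one]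
      have h3 := hx t ω hω
      have h4 := Real.add_one_le_exp (-x)
      calc Real.exp x * (1 - D.real {y | Function.update ω t y ∈ S t})
          ≤ Real.exp x * Real.exp (-x) := by gcongr; linarith
        _ = 1 := by rw [← Real.exp_add]; simp
    · simp [hG, h1, hω]
  have hprod := lintegral_prod_le_one hGm hGd hG1 m
  set B := {ω | (∀ t, ω ∈ V t → ω ∉ S t) ∧ W ≤ ∑ t ∈ Finset.range m, (V t).indicator (1 : (ℕ → E) → ℝ) ω}
    with hB
  have hle : ∀ ω ∈ B, ENNReal.ofReal (Real.exp (x * W)) ≤ ∏ t ∈ Finset.range m, G t ω := by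
    rintro ω ⟨h1, h2⟩
    have h3 : ∀ t, G t ω = ENNReal.ofReal (Real.exp (x * (V t).indicator 1 ω)) := fun t => by
      by_cases hω : ω ∈ V t
      · simp [hG, hω, h1 t hω]
      · simp [hG, hω]
    rw [Finset.prod_congr rfl fun t _ => h3 t,
      ← ENNReal.ofReal_prod_of_nonneg fun t _ => (Real.exp_pos _).le, ← Real.exp_sum,
      ← Finset.mul_sum]
    exact ENNReal.ofReal_le_ofReal (Real.exp_le_exp.2 (mul_le_mul_of_nonneg_left h2 hx0))
  have hmark := mul_meas_ge_le_lintegral (μ := Measure.infinitePi fun _ : ℕ => D)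
    (f := fun ω => ∏ t ∈ Finset.range m, G t ω)
    (Finset.measurable_prod _ fun t _ => hGm t) (ENNReal.ofReal (Real.exp (x * W)))
  have hfin : ENNReal.ofReal (Real.exp (x * W)) * (Measure.infinitePi fun _ : ℕ => D) B ≤ 1 :=
    (mul_le_mul_right (measure_mono hle) _).trans (hmark.trans hprod)
  have hone : ENNReal.ofReal (Real.exp (-(x * W))) * ENNReal.ofReal (Real.exp (x * W)) = 1 := by
    rw [← ENNReal.ofReal_mul (Real.exp_pos _).le, ← Real.exp_add]
    simp
  calc (Measure.infinitePi fun _ : ℕ => D) B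
      = ENNReal.ofReal (Real.exp (-(x * W))) * (ENNReal.ofReal (Real.exp (x * W)) *
        (Measure.infinitePi fun _ : ℕ => D) B) := by rw [← mul_assoc, hone, one_mul]
    _ ≤ ENNReal.ofReal (Real.exp (-(x * W))) * 1 := mul_le_mul_right hfin _
    _ = _ := mul_one _

end Waiting

/-! ### Probability of obtaining a rank -/

section Ranks

variable {K M : ℕ}

/-- Bonferroni's inequality for products. -/
theorem one_sub_sum_le_prod {ι : Type*} (S : Finset ι) {f : ι → ℝ} (h0 : ∀ i ∈ S, 0 ≤ f i)
    (h1 : ∀ i ∈ S, f i ≤ 1) : 1 - ∑ i ∈ S, f i ≤ ∏ i ∈ S, (1 - f i) := by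
  classical
  induction S using Finset.induction_on with
  | empty => simp
  | insert i S hi ih =>
    rw [Finset.sum_insert hi, Finset.prod_insert hi]
    have h2 := ih (fun i hi => h0 i (Finset.mem_insert_of_mem hi))
      fun i hi => h1 i (Finset.mem_insert_of_mem hi)
    have h3 : ∏ i ∈ S, (1 - f i) ≤ 1 := Finset.prod_le_one
      (fun i hi => sub_nonneg.2 (h1 i (Finset.mem_insert_of_mem hi)))
      fun i hi => by linarith [h0 i (Finset.mem_insert_of_mem hi)]
    have h4 := h0 i (Finset.mem_insert_self i S)
    nlinarith

theorem pullProb_le_one (s : Fin M → Strategy K) (t : ℕ) (i : Fin M) (k : Fin K)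
    (ω : ℕ → Draw K M) : pullProb s t i k ω ≤ 1 := measureReal_le_one

theorem soloProb_nonneg (s : Fin M → Strategy K) (t : ℕ) (i : Fin M) (k : Fin K)
    (ω : ℕ → Draw K M) : 0 ≤ soloProb s t i k ω :=
  mul_nonneg (pullProb_nonneg s t i k ω) (Finset.prod_nonneg fun i' _ =>
    sub_nonneg.2 (pullProb_le_one s t i' k ω))

theorem card_filter_val_lt (hMK : M ≤ K) :
    ((Finset.univ : Finset (Fin K)).filter fun k => k.val < M).card = M := by
  have h := card_fin_filter hMK fun _ => True
  simpa using h

/-- A player who pulls uniformly in a set of `M` arms is alone with a probability of at least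
`1/M`: the `M - 1` others cannot occupy all of these arms. -/
theorem le_sum_soloProb (s : Fin M → Strategy K) (t : ℕ) (i : Fin M) {ω : ℕ → Draw K M}
    {S : Finset (Fin K)} (hS : S.card = M) (h : ∀ k ∈ S, pullProb s t i k ω = 1 / M) :
    1 / (M : ℝ) ≤ ∑ k ∈ S, soloProb s t i k ω := by
  have hM : 1 ≤ M := by have := i.isLt; omega
  have h1 : ∀ k ∈ S, (1 / (M : ℝ)) * (1 - ∑ i' ∈ Finset.univ.erase i, pullProb s t i' k ω) ≤
      soloProb s t i k ω := fun k hk => by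
    rw [soloProb, h k hk]
    exact mul_le_mul_of_nonneg_left (one_sub_sum_le_prod _
      (fun i' _ => pullProb_nonneg s t i' k ω) fun i' _ => pullProb_le_one s t i' k ω)
      (by positivity)
  refine le_trans ?_ (Finset.sum_le_sum h1)
  rw [← Finset.mul_sum, Finset.sum_sub_distrib, Finset.sum_const, hS, Finset.sum_comm]
  refine le_mul_of_one_le_right (by positivity) ?_
  have h2 : ∑ i' ∈ Finset.univ.erase i, ∑ k ∈ S, pullProb s t i' k ω ≤
      ∑ i' ∈ (Finset.univ : Finset (Fin M)).erase i, 1 := Finset.sum_le_sum fun i' _ => by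
    rw [← sum_pullProb s t i' ω]
    exact Finset.sum_le_sum_of_subset_of_nonneg (Finset.subset_univ S)
      fun k _ _ => pullProb_nonneg s t i' k ω
  rw [Finset.sum_const, Finset.card_erase_of_mem (Finset.mem_univ i), Finset.card_univ,
    Fintype.card_fin, nsmul_eq_mul, mul_one, Nat.cast_sub hM, Nat.cast_one] at h2
  rw [nsmul_eq_mul, mul_one]
  linarith

/-- In round `t + 1`, the player with signals `g` looks for a rank among the first `M` arms. -/
def SeeksRank (T M : ℕ) {t : ℕ} (g : Fin t → Signal K) : Prop :=
  EstimDone T g t ∧ waitEnd (estimTime T g) < (t : ℝ) + 1 ∧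
    (t : ℝ) + 1 ≤ rankEnd K T (estimTime T g) ∧ rank T g = none ∧ estimM T g = M

theorem measurableSet_seeksRank (s : Fin M → Strategy K) (i : Fin M) (T t : ℕ) :
    MeasurableSet {ω | SeeksRank T M fun r : Fin t => signals s ω i r.val} := by
  have h1 : Measurable fun ω => fun r : Fin t => signals s ω i r.val :=
    measurable_pi_lambda _ fun r => measurable_signal.comp
      ((measurable_pi_apply r).comp (measurable_history s i t))
  exact h1 (Set.toFinite {g : Fin t → Signal K | SeeksRank T M g}).measurableSet

theorem dependsBefore_seeksRank (s : Fin M → Strategy K) (i : Fin M) (T t : ℕ) :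
    DependsBefore t fun ω => ω ∈ {ω | SeeksRank T M fun r : Fin t => signals s ω i r.val} :=
  fun r hr ω x => by
    have h := dependsBefore_history s i t r hr ω x
    simp only [mem_ofPred_eq, ← signals_history]
    simp only [] at h
    rw [h]

/-- Player `i` gets a positive reward in round `t + 1`. -/
def winEvent (s : Fin M → Strategy K) (i : Fin M) (t : ℕ) : Set (ℕ → Draw K M) :=
  ⋃ k, soloEvent s i k t

theorem signals_win_of_mem {s : Fin M → Strategy K} {i : Fin M} {t : ℕ} {ω : ℕ → Draw K M}
    (h : ω ∈ winEvent s i t) : (signals s ω i t).2.2 = true := by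
  obtain ⟨k, h1, rfl, h2⟩ := mem_iUnion.1 h
  refine signals_win.2 ⟨fun hc => ?_, h1⟩
  obtain ⟨i', hi', he⟩ := exists_of_collision hc
  exact h2 i' hi' he

theorem dependsBefore_winEvent (s : Fin M → Strategy K) (i : Fin M) (t : ℕ) :
    DependsBefore (t + 1) fun ω => ω ∈ winEvent s i t := fun r hr ω x => by
  simp only [winEvent, mem_iUnion, eq_iff_iff]
  exact exists_congr fun k => iff_of_eq (dependsBefore_soloEvent s i k t r hr ω x)

variable [NeZero K]

theorem SeeksRank.initStep {T M t : ℕ} {g : Fin t → Signal K} (h : SeeksRank T M g) :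
    initStep T g = .inl (.uniform (Finset.univ.filter fun k => k.val < M)) := by
  obtain ⟨h1, h2, h3, h4, h5⟩ := h
  unfold MPBandit.initStep
  rw [if_pos h1, if_neg (not_le.2 h2), if_pos h3, h4, h5]

theorem roundLaw_real_winEvent_ge (ν : Fin K → ProbabilityMeasure unitInterval)
    {s : Fin M → Strategy K} {i : Fin M} {T : ℕ} (hs : s i = selfishRobust K T) (hMK : M ≤ K)
    {p : ℝ} (hp0 : 0 < p) (hp : ∀ k, p ≤ posProb ν k) {t : ℕ} {ω : ℕ → Draw K M}
    (h : SeeksRank T M fun r : Fin t => signals s ω i r.val) :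
    p / M ≤ (roundLaw ν M).real {x | Function.update ω t x ∈ winEvent s i t} := by
  have h1 : {x | Function.update ω t x ∈ winEvent s i t} =
      ⋃ k ∈ (Finset.univ : Finset (Fin K)), {x | Function.update ω t x ∈ soloEvent s i k t} := by
    ext x; simp [winEvent]
  have hdisj : ∀ k ∈ (Finset.univ : Finset (Fin K)), ∀ l ∈ (Finset.univ : Finset (Fin K)), k ≠ l →
      Disjoint {x | Function.update ω t x ∈ soloEvent s i k t}
        {x | Function.update ω t x ∈ soloEvent s i l t} := fun k _ l _ hkl =>
    Set.disjoint_left.2 fun x hx hx' => hkl (hx.2.1.symm.trans hx'.2.1)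
  rw [h1, measureReal_biUnion_finset hdisj fun k _ =>
    measurable_update ω (measurableSet_soloEvent s i k t),
    Finset.sum_congr rfl fun k _ => roundLaw_real_soloEvent ν s i k t ω]
  set S := (Finset.univ : Finset (Fin K)).filter fun k => k.val < M with hS
  have hcard : S.card = M := card_filter_val_lt hMK
  calc p / M = p * (1 / M) := by ring
    _ ≤ p * ∑ k ∈ S, soloProb s t i k ω := by
        refine mul_le_mul_of_nonneg_left (le_sum_soloProb s t i hcard fun k hk => ?_) hp0.le
        rw [pullProb_uniform hs h.initStep hk, hcard]
    _ = ∑ k ∈ S, p * soloProb s t i k ω := Finset.mul_sum _ _ _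
    _ ≤ ∑ k ∈ S, posProb ν k * soloProb s t i k ω := Finset.sum_le_sum fun k _ =>
        mul_le_mul_of_nonneg_right (hp k) (soloProb_nonneg s t i k ω)
    _ ≤ _ := Finset.sum_le_sum_of_subset_of_nonneg (Finset.subset_univ S) fun k _ _ =>
        mul_nonneg (hp0.le.trans (hp k)) (soloProb_nonneg s t i k ω)

/-- The attribution lasts at least K log T / p rounds, in each of which a player without a rank wins
with conditional probability at least p/M. As M ≤ K, never winning has probability at most exp(1 -
log T). -/
theorem measure_no_win_le (ν : Fin K → ProbabilityMeasure unitInterval)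
    {s : Fin M → Strategy K} {i : Fin M} {T : ℕ} (hs : s i = selfishRobust K T) (hMK : M ≤ K)
    (hT : 1 ≤ Real.log T) {p : ℝ} (hp0 : 0 < p) (hp : ∀ k, p ≤ posProb ν k) {τ : ℝ}
    (hτ : τ = obsTarget K T * K / p) :
    gameLaw ν M {ω | ∃ tm, StopsAt T (signals s ω i) tm ∧ γ₁ * τ ≤ tm ∧ tm ≤ γ₂ * τ ∧
      playersEstimate K (meanCollision (signals s ω i) tm) = M ∧
      ∀ r, ¬ IsWin T (signals s ω i) tm r} ≤ ENNReal.ofReal (3 / T) := by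
  classical
  have hM : 1 ≤ M := by have := i.isLt; omega
  have hM0 : (0 : ℝ) < M := by exact_mod_cast hM
  have hM1 : (1 : ℝ) ≤ M := by exact_mod_cast hM
  have hMK' : (M : ℝ) ≤ K := by exact_mod_cast hMK
  have hK : (0 : ℝ) < K := by linarith
  have hTpos : 0 < T := pos_of_one_le_log hT
  have hlog : 0 < Real.log T := by linarith
  have hp1 : p ≤ 1 := (hp 0).trans measureReal_le_one
  have hn0 : 0 < obsTarget K T := by unfold obsTarget β; positivity
  set m : ℕ := ⌈(γ₂ / γ₁ + 1 / (γ₁ * β ^ 2 * (K : ℝ) ^ 2)) * (γ₂ * τ)⌉₊ with hm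
  set W : ℝ := K * Real.log T / p - 1 with hW
  have key := measure_avoid_le (D := roundLaw ν M)
    (V := fun t => {ω | SeeksRank T M fun r : Fin t => signals s ω i r.val}) (S := winEvent s i)
    (measurableSet_seeksRank s i T) (dependsBefore_seeksRank s i T)
    (fun t => MeasurableSet.iUnion fun k => measurableSet_soloEvent s i k t)
    (dependsBefore_winEvent s i)
    (fun t ω hω => roundLaw_real_winEvent_ge ν hs hMK hp0 hp hω) (by positivity) m W
  rw [gameLaw_eq]
  refine (measure_mono ?_).trans (key.trans (ENNReal.ofReal_le_ofReal ?_))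
  · rintro ω ⟨tm, h1, h2, h3, h4, h5⟩
    refine ⟨fun t ht hw => ?_, ?_⟩
    · obtain ⟨h6, h7, h8, -⟩ := ht
      have htm := (h1.estimDone_iff t).1 h6
      rw [h1.estimTime_eq htm] at h7 h8
      exact h5 t ⟨h7, h8, signals_win_of_mem hw⟩
    · have hseek : ∀ t ∈ Finset.Ico ⌊waitEnd tm⌋₊ ⌊rankEnd K T tm⌋₊,
          SeeksRank T M fun r : Fin t => signals s ω i r.val := fun t ht => by
        rw [Finset.mem_Ico] at ht
        have ha : waitEnd tm < (t : ℝ) + 1 := by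
          have := Nat.lt_floor_add_one (waitEnd tm)
          have h6 : ((⌊waitEnd tm⌋₊ : ℕ) : ℝ) ≤ t := by exact_mod_cast ht.1
          linarith
        have hb : (t : ℝ) + 1 ≤ rankEnd K T tm := by
          have h6 : ((t + 1 : ℕ) : ℝ) ≤ rankEnd K T tm :=
            (Nat.le_floor_iff' (Nat.succ_ne_zero t)).1 ht.2
          push_cast at h6
          exact h6
        have htm := le_of_waitEnd_lt ha
        refine ⟨(h1.estimDone_iff t).2 htm, ?_, ?_, h1.rank_eq_none htm fun r _ => h5 r, ?_⟩
        · rwa [h1.estimTime_eq htm]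
        · rwa [h1.estimTime_eq htm]
        · rw [h1.estimM_eq htm, h4]
      have hrank : rankEnd K T tm ≤ m := by
        rw [rankEnd_eq hlog]
        refine le_trans ?_ (Nat.le_ceil _)
        refine mul_le_mul_of_nonneg_left h3 ?_
        unfold γ₁ γ₂ β; positivity
      have hsubset : Finset.Ico ⌊waitEnd tm⌋₊ ⌊rankEnd K T tm⌋₊ ⊆
          (Finset.range m).filter fun t => SeeksRank T M fun r : Fin t => signals s ω i r.val := by
        intro t ht
        rw [Finset.mem_filter, Finset.mem_range]
        refine ⟨(Finset.mem_Ico.1 ht).2.trans_le ?_, hseek t ht⟩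
        exact Nat.floor_le_of_le hrank
      have hcard := Finset.card_le_card hsubset
      rw [Nat.card_Ico] at hcard
      simp only [Set.indicator_apply, mem_ofPred_eq, Pi.one_apply, Finset.sum_boole]
      have h6 : (⌊rankEnd K T tm⌋₊ : ℝ) - ⌊waitEnd tm⌋₊ ≤
          ((⌊rankEnd K T tm⌋₊ - ⌊waitEnd tm⌋₊ : ℕ) : ℝ) := by
        rw [sub_le_iff_le_add]
        exact_mod_cast (by omega : ⌊rankEnd K T tm⌋₊ ≤ ⌊rankEnd K T tm⌋₊ - ⌊waitEnd tm⌋₊ + ⌊waitEnd tm⌋₊)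
      have h7 : rankEnd K T tm < ⌊rankEnd K T tm⌋₊ + 1 := Nat.lt_floor_add_one _
      have h8 : (⌊waitEnd tm⌋₊ : ℝ) ≤ waitEnd tm := Nat.floor_le (by
        unfold waitEnd γ₁ γ₂; positivity)
      have h9 : K * Real.log T / p ≤ rankEnd K T tm - waitEnd tm := by
        rw [rankEnd, add_sub_cancel_left, le_div_iff₀ (by unfold γ₁; positivity)]
        calc K * Real.log T / p * (γ₁ * obsTarget K T) = γ₁ * τ * Real.log T := by
              rw [hτ]; field_simp
          _ ≤ tm * Real.log T := mul_le_mul_of_nonneg_right h2 hlog.le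
      have h10 : ((⌊rankEnd K T tm⌋₊ - ⌊waitEnd tm⌋₊ : ℕ) : ℝ) ≤
          (((Finset.range m).filter fun t =>
            SeeksRank T M fun r : Fin t => signals s ω i r.val).card : ℝ) := by
        exact_mod_cast hcard
      rw [hW]
      linarith
  · have hT' : (0 : ℝ) < T := by exact_mod_cast hTpos
    have h1 : Real.log T - 1 ≤ p / M * W := by
      have h2 : p / M * W = K / M * Real.log T - p / M := by rw [hW]; field_simp
      have h3 : p / M ≤ 1 := by rw [div_le_one hM0]; linarith
      have h4 : Real.log T ≤ K / M * Real.log T :=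
        le_mul_of_one_le_left hlog.le ((one_le_div hM0).2 hMK')
      linarith
    calc Real.exp (-(p / M * W)) ≤ Real.exp (1 - Real.log T) := Real.exp_le_exp.2 (by linarith)
      _ = Real.exp 1 / T := by rw [Real.exp_sub, Real.exp_log hT']
      _ ≤ 3 / T := by
        have := Real.exp_one_lt_d9
        gcongr
        linarith

end Ranks

end MPBandit

namespace MPBandit
open Set

/-! ## The probability of a successful initialization -/

section Success

variable {K M : ℕ}

theorem ae_seed_lt_one (ν : Fin K → ProbabilityMeasure unitInterval) :
    ∀ᵐ ω ∂(gameLaw ν M), ∀ t i, ((ω t).2 i : ℝ) < 1 := by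
  refine ae_all_iff.2 fun t => ae_all_iff.2 fun i => ?_
  have h1 : MeasurePreserving (fun ω : ℕ → Draw K M => ω t) (gameLaw ν M) (roundLaw ν M) := by
    rw [gameLaw_eq]; exact measurePreserving_eval_infinitePi (fun _ : ℕ => roundLaw ν M) t
  have hm : MeasurableSet ({1} : Set unitInterval) := measurableSet_singleton 1
  have hm2 : MeasurableSet {x : Draw K M | x.2 i ∈ ({1} : Set unitInterval)} :=
    (show Measurable fun x : Draw K M => x.2 i by fun_prop) hm
  have h2 := h1.measure_preimage hm2.nullMeasurableSet
  rw [roundLaw_seed ν i hm, measure_singleton] at h2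
  rw [ae_iff]
  refine measure_mono_null (fun ω hω => ?_) h2
  simp only [mem_ofPred_eq, not_lt] at hω
  exact Subtype.ext (le_antisymm ((ω t).2 i).2.2 hω)

/-- A lone player never collides, so her estimate is exact. The case is separate because the
argument with a deviator needs a second player. -/
theorem playersEstimate_of_single [NeZero K] (s : Fin 1 → Strategy K) (ω : ℕ → Draw K 1)
    (i : Fin 1) (m : ℕ) : playersEstimate K (meanCollision (signals s ω i) m) = 1 := by
  have h1 : ∀ k, sensedCollisions (signals s ω i) k m = 0 := fun k => by
    rw [sensedCollisions, Finset.card_eq_zero, Finset.filter_eq_empty_iff]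
    rintro r - ⟨-, h2, h3⟩
    refine absurd (signals_win.2 ⟨fun hc => ?_, signals_sensed.1 h2⟩) (by rw [h3]; simp)
    obtain ⟨i', hi', -⟩ := exists_of_collision hc
    exact hi' (Subsingleton.elim _ _)
  have h2 : meanCollision (signals s ω i) m = 0 := by simp [meanCollision, h1]
  have hK := Nat.one_le_iff_ne_zero.2 (NeZero.ne K)
  rw [playersEstimate, h2, if_neg zero_ne_one]
  simp [hK]

/-- A bound, up to the factor `1 / T`, for the probability that the initialization fails when all
arms have a positive quality with probability at least `p`. -/
def initFailure (K M : ℕ) (p : ℝ) : ℝ := M * (K + 3 + 5 * K * (1623 * K ^ 3 / p + 1))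

variable [NeZero K]

theorem measure_not_initSuccess_le (ν : Fin K → ProbabilityMeasure unitInterval)
    -- The causes of failure are seeds equal to 1 (a null set), atypical estimation times, wrong
    -- estimates and missing ranks. If nobody deviates, any other player can be cast as the
    -- deviator, since the estimate of M holds for arbitrary behaviour of hers. The log T in τ is
    -- bounded by T to turn X/T² into a multiple of 1/T.
    {s : Fin M → Strategy K} {A : Finset (Fin M)} {T : ℕ} (hMK : M ≤ K)
    (hA : ∀ i ∈ A, s i = selfishRobust K T)
    (hother : ∀ i ∈ A, M = 1 ∨ ∃ j, i ≠ j ∧ ∀ i', i' ≠ j → s i' = selfishRobust K T)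
    (hT : 1 ≤ Real.log T) {p : ℝ} (hp0 : 0 < p) (hp : ∀ k, p ≤ posProb ν k) {k₀ : Fin K}
    (hk₀ : posProb ν k₀ = p) {τ : ℝ} (hτ : τ = obsTarget K T * K / p) :
    gameLaw ν M {ω | ¬ InitSuccess s T A τ ω} ≤ ENNReal.ofReal (initFailure K M p / T) := by
  classical
  have hTpos : 0 < T := pos_of_one_le_log hT
  have hT0 : (0 : ℝ) < T := by exact_mod_cast hTpos
  have hT1 : (1 : ℝ) ≤ T := by exact_mod_cast hTpos
  have hlog : 0 < Real.log T := by linarith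
  have hlogT : Real.log T ≤ T := (Real.log_le_sub_one_of_pos hT0).trans (by linarith)
  have hK : (0 : ℝ) < K := by exact_mod_cast Nat.pos_of_ne_zero (NeZero.ne K)
  have hn0 : 0 < obsTarget K T := by unfold obsTarget β; positivity
  have hτ0 : 0 < τ := by rw [hτ]; positivity
  have hK1 : (1 : ℝ) ≤ K := by exact_mod_cast Nat.one_le_iff_ne_zero.2 (NeZero.ne K)
  set X : ℝ := γ₂ * τ + 1 with hX
  have hX0 : 0 ≤ X := by rw [hX]; unfold γ₂; positivity
  have hXT : X ≤ (1623 * K ^ 3 / p + 1) * T := by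
    have h1 : γ₂ * τ ≤ 1623 * K ^ 3 / p * Real.log T := by
      have h2 : γ₂ * τ = 16 / 15 * 1521 * K ^ 3 / p * Real.log T := by
        rw [hτ, obsTarget, β, γ₂]; field_simp; ring
      rw [h2]
      gcongr
      norm_num
    have h2 : 1623 * K ^ 3 / p * Real.log T ≤ 1623 * K ^ 3 / p * T := by gcongr
    rw [hX, add_mul, one_mul]
    linarith
  set C : Finset (Fin M) := Finset.univ.filter fun i => s i = selfishRobust K T with hC
  set N₁ : Set (ℕ → Draw K M) := {ω | ¬ ∀ t i, ((ω t).2 i : ℝ) < 1} with hN₁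
  set N₂ : Fin M → Set (ℕ → Draw K M) := fun i => {ω | ¬ StopsNear T (signals s ω i) τ} with hN₂
  set N₃ : Fin M → Set (ℕ → Draw K M) := fun i =>
    {ω | (∀ i', s i' = selfishRobust K T → StopsNear T (signals s ω i') τ) ∧
      ∃ m : ℕ, γ₁ * τ ≤ m ∧ m ≤ γ₂ * τ ∧
        playersEstimate K (meanCollision (signals s ω i) m) ≠ M} with hN₃
  set N₄ : Fin M → Set (ℕ → Draw K M) := fun i =>
    {ω | ∃ tm, StopsAt T (signals s ω i) tm ∧ γ₁ * τ ≤ tm ∧ tm ≤ γ₂ * τ ∧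
      playersEstimate K (meanCollision (signals s ω i) tm) = M ∧
      ∀ r, ¬ IsWin T (signals s ω i) tm r} with hN₄
  have hsub : {ω | ¬ InitSuccess s T A τ ω} ⊆
      (N₁ ∪ ⋃ i ∈ C, N₂ i) ∪ ((⋃ i ∈ A, N₃ i) ∪ ⋃ i ∈ A, N₄ i) := by
    intro ω hω
    by_contra hcon
    simp only [mem_union, mem_iUnion, not_or, not_exists] at hcon
    obtain ⟨⟨h1, h2⟩, h3, h4⟩ := hcon
    have hnear : ∀ i', s i' = selfishRobust K T → StopsNear T (signals s ω i') τ := fun i' hi' =>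
      not_not.1 (h2 i' (Finset.mem_filter.2 ⟨Finset.mem_univ i', hi'⟩))
    refine hω ⟨not_not.1 h1, fun i hi => ?_⟩
    obtain ⟨tm, h5, h6, h7⟩ := hnear i (hA i hi)
    have h8 : playersEstimate K (meanCollision (signals s ω i) tm) = M := by
      by_contra hne
      exact h3 i hi ⟨hnear, tm, h6, h7, hne⟩
    refine ⟨tm, h5, h6, h7, h8, ?_⟩
    by_contra hno
    exact h4 i hi ⟨tm, h5, h6, h7, h8, not_exists.1 hno⟩
  have h₁ : gameLaw ν M N₁ = 0 := ae_iff.1 (ae_seed_lt_one ν)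
  have h₂ : ∀ i ∈ C, gameLaw ν M (N₂ i) ≤ ENNReal.ofReal (K / T + X / (T : ℝ) ^ 2) :=
    fun i hi => by
      have := measure_not_stopsNear_le (M := M) ν (Finset.mem_filter.1 hi).2 hT hp0 hp hk₀
      rwa [← hτ] at this
  have h₃ : ∀ i ∈ A, gameLaw ν M (N₃ i) ≤ ENNReal.ofReal (4 * K * X / (T : ℝ) ^ 2) :=
    fun i hi => by
      rcases hother i hi with hM1 | ⟨j, hij, hj⟩
      · have : N₃ i = ∅ := by
          subst hM1
          refine Set.eq_empty_iff_forall_notMem.2 fun ω hω => ?_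
          obtain ⟨-, m, -, -, hne⟩ := hω
          exact hne (playersEstimate_of_single s ω i m)
        rw [this, measure_empty]
        exact zero_le
      · refine (measure_mono fun ω hω => ?_).trans
          (measure_playersEstimate_ne_le ν hj hij hMK hT hp0 hp hτ)
        exact ⟨fun i' hi' => hω.1 i' (hj i' hi'), hω.2⟩
  have h₄ : ∀ i ∈ A, gameLaw ν M (N₄ i) ≤ ENNReal.ofReal (3 / T) := fun i hi =>
    measure_no_win_le ν (hA i hi) hMK hT hp0 hp hτ
  have hcard : ∀ (B : Finset (Fin M)) (f : Fin M → Set (ℕ → Draw K M)) (b : ℝ), 0 ≤ b →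
      (∀ i ∈ B, gameLaw ν M (f i) ≤ ENNReal.ofReal b) →
      gameLaw ν M (⋃ i ∈ B, f i) ≤ ENNReal.ofReal (M * b) := fun B f b hb hf => by
    calc gameLaw ν M (⋃ i ∈ B, f i) ≤ ∑ i ∈ B, gameLaw ν M (f i) := measure_biUnion_finset_le _ _
      _ ≤ ∑ i ∈ B, ENNReal.ofReal b := Finset.sum_le_sum hf
      _ ≤ ∑ i : Fin M, ENNReal.ofReal b := Finset.sum_le_sum_of_subset (Finset.subset_univ B)
      _ = ENNReal.ofReal (M * b) := by
        rw [Finset.sum_const, Finset.card_univ, Fintype.card_fin, nsmul_eq_mul,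
          ENNReal.ofReal_mul (Nat.cast_nonneg M), ENNReal.ofReal_natCast]
  calc gameLaw ν M {ω | ¬ InitSuccess s T A τ ω}
      ≤ (gameLaw ν M N₁ + gameLaw ν M (⋃ i ∈ C, N₂ i)) +
        (gameLaw ν M (⋃ i ∈ A, N₃ i) + gameLaw ν M (⋃ i ∈ A, N₄ i)) :=
        (measure_mono hsub).trans ((measure_union_le _ _).trans
          (add_le_add (measure_union_le _ _) (measure_union_le _ _)))
    _ ≤ (0 + ENNReal.ofReal (M * (K / T + X / (T : ℝ) ^ 2))) +
        (ENNReal.ofReal (M * (4 * K * X / (T : ℝ) ^ 2)) + ENNReal.ofReal (M * (3 / T))) := by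
        gcongr
        · exact h₁.le
        · exact hcard C N₂ _ (by positivity) h₂
        · exact hcard A N₃ _ (by positivity) h₃
        · exact hcard A N₄ _ (by positivity) h₄
    _ = ENNReal.ofReal (M * (K / T + X / (T : ℝ) ^ 2) + (M * (4 * K * X / (T : ℝ) ^ 2) +
          M * (3 / T))) := by
        rw [zero_add, ← ENNReal.ofReal_add (by positivity) (by positivity),
          ← ENNReal.ofReal_add (by positivity) (by positivity)]
    _ ≤ _ := by
        refine ENNReal.ofReal_le_ofReal ?_
        have h5 : M * (K / T + X / (T : ℝ) ^ 2) + (M * (4 * K * X / (T : ℝ) ^ 2) + M * (3 / T)) =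
            M * (K + 3 + (1 + 4 * K) * (X / T)) / T := by field_simp; ring
        rw [h5, initFailure]
        have h6 : X / T ≤ 1623 * K ^ 3 / p + 1 := (div_le_iff₀ hT0).2 hXT
        gcongr
        linarith

end Success

end MPBandit

namespace MPBandit
open Set

/-! ## The probability of too small indices -/

section IndexFailure

variable {K M : ℕ} {s : Fin M → Strategy K} {i : Fin M} {k : Fin K}

theorem exp_neg_explorationLevel_le {U : ℕ} (hU : 3 ≤ U) :
    Real.exp (-explorationLevel U) ≤ 1 / U := by
  have h1 : (0 : ℝ) < U := by positivity
  have h2 : 1 ≤ Real.log U := by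
    rw [Real.le_log_iff_exp_le h1]
    have h3 : (3 : ℝ) ≤ U := by exact_mod_cast hU
    linarith [Real.exp_one_lt_d9]
  have h3 := Real.log_nonneg h2
  calc Real.exp (-explorationLevel U) ≤ Real.exp (-Real.log U) := by
        rw [Real.exp_le_exp, explorationLevel]; linarith
    _ = 1 / U := by rw [Real.exp_neg, Real.exp_log h1, one_div]

theorem explorationLevel_mono {U V : ℕ} (hU : 3 ≤ U) (hUV : U ≤ V) :
    explorationLevel U ≤ explorationLevel V := by
  have h0 : (0 : ℝ) < U := by positivity
  have h1 : (U : ℝ) ≤ V := by exact_mod_cast hUV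
  have h2 : 0 < Real.log U := by
    have h3 : (3 : ℝ) ≤ U := by exact_mod_cast hU
    exact Real.log_pos (by linarith)
  have h3 := Real.log_le_log h0 h1
  have h4 := Real.log_le_log h2 h3
  unfold explorationLevel
  linarith

theorem explorationLevel_pos {U : ℕ} (hU : 3 ≤ U) : 0 < explorationLevel U := by
  have h1 := exp_neg_explorationLevel_le hU
  have h2 : (1 : ℝ) / U < 1 := by
    have h3 : (3 : ℝ) ≤ U := by exact_mod_cast hU
    rw [div_lt_one (by linarith)]; linarith
  have h3 := Real.exp_lt_one_iff.1 (h1.trans_lt h2)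
  linarith

/-- A bound for the expected number of failures of the index of an arm with mean `m`. -/
def indexFailureBound (m δ : ℝ) : ℝ :=
  2 * (1 + 1 / klReal (m - 2 * δ) (m - δ)) * (1 - Real.exp (-klReal (m - 2 * δ) (m - δ)))⁻¹

/-- A union over the count c ≥ n. Each count costs at most (1/U) exp(-κc), where 1/U comes from the
exploration level and κ from the slack between m - 2δ and m - δ. Comparing with m - δ instead of m
keeps the argument below 1 when m = 1. -/
theorem measure_indexFailure_le {ν : Fin K → ProbabilityMeasure unitInterval} {m δ : ℝ}
    (hm : ∫ x : unitInterval, (x : ℝ) ∂(ν k : Measure unitInterval) = m) (hδ : 0 < δ)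
    (hδm : 4 * δ ≤ m) (hm1 : m ≤ 1) {T U : ℕ} (hU : 3 ≤ U) (hn : 0 < obsTarget K T) :
    (gameLaw ν M).real (indexFailure s i T k m δ U) ≤
      1 / U * (Real.exp (-(klReal (m - 2 * δ) (m - δ) * obsTarget K T)) *
        (1 - Real.exp (-klReal (m - 2 * δ) (m - δ)))⁻¹) := by
  set κ := klReal (m - 2 * δ) (m - δ) with hκ
  set n := obsTarget K T with hn'
  have hκ0 : 0 < κ := klReal_pos (by linarith) (by linarith) (by linarith)
  have hx1 : Real.exp (-κ) < 1 := Real.exp_lt_one_iff.2 (by linarith)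
  have hx0 := (Real.exp_pos (-κ)).le
  have hf := explorationLevel_pos hU
  set Q : ℕ → Set (ℕ → Draw K M) := fun c => {ω | pulls s i k (U - 1) ω = c ∧
    pullMean s i k (U - 1) ω ≤ m - 2 * δ ∧
    explorationLevel U < c * klReal (pullMean s i k (U - 1) ω) (m - 2 * δ)} with hQ
  have hsub : indexFailure s i T k m δ U ⊆ ⋃ c ∈ Finset.Ico ⌈n⌉₊ (U + ⌈n⌉₊), Q c := by
    rintro ω ⟨h1, h2, h3⟩
    have hle : pulls s i k (U - 1) ω ≤ U - 1 := (Finset.card_filter_le _ _).trans (by simp)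
    simp only [mem_iUnion, Finset.mem_Ico]
    exact ⟨pulls s i k (U - 1) ω, ⟨Nat.ceil_le.2 h1, by omega⟩, rfl, by linarith,
      lt_of_klIndex_lt (by linarith) (by linarith) hf.le h3⟩
  have hc : ∀ c ∈ Finset.Ico ⌈n⌉₊ (U + ⌈n⌉₊), (gameLaw ν M).real (Q c) ≤
      1 / U * (Real.exp (-κ)) ^ c := fun c hc => by
    have hc0 : c ≠ 0 := by
      have h1 := (Finset.mem_Ico.1 hc).1
      have h2 := Nat.ceil_pos.2 hn
      omega
    have h1 := measure_klIndex_deviation_le (s := s) (i := i) (M := M) (q := m - 2 * δ)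
      (q' := m - δ) hm (by linarith) (by linarith) (by linarith) (by linarith) hf (U - 1) c hc0
    refine ENNReal.toReal_le_of_le_ofReal (by positivity) (h1.trans (ENNReal.ofReal_le_ofReal ?_))
    rw [neg_add, Real.exp_add, ← Real.exp_nat_mul, mul_neg]
    exact mul_le_mul_of_nonneg_right (exp_neg_explorationLevel_le hU) (Real.exp_pos _).le
  calc (gameLaw ν M).real (indexFailure s i T k m δ U)
      ≤ (gameLaw ν M).real (⋃ c ∈ Finset.Ico ⌈n⌉₊ (U + ⌈n⌉₊), Q c) :=
        measureReal_mono hsub (measure_ne_top _ _)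
    _ ≤ ∑ c ∈ Finset.Ico ⌈n⌉₊ (U + ⌈n⌉₊), (gameLaw ν M).real (Q c) :=
        measureReal_biUnion_finset_le _ _
    _ ≤ ∑ c ∈ Finset.Ico ⌈n⌉₊ (U + ⌈n⌉₊), 1 / U * (Real.exp (-κ)) ^ c := Finset.sum_le_sum hc
    _ = 1 / U * (Real.exp (-κ) ^ ⌈n⌉₊ * ∑ c ∈ Finset.range U, (Real.exp (-κ)) ^ c) := by
        rw [← Finset.mul_sum, Finset.sum_Ico_eq_sum_range, Nat.add_sub_cancel]
        simp only [pow_add, Finset.mul_sum]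
    _ ≤ 1 / U * (Real.exp (-(κ * n)) * (1 - Real.exp (-κ))⁻¹) := by
        refine mul_le_mul_of_nonneg_left (mul_le_mul ?_ ?_ ?_ (Real.exp_pos _).le) (by positivity)
        · rw [← Real.exp_nat_mul, Real.exp_le_exp]
          have := mul_le_mul_of_nonneg_left (Nat.le_ceil n) hκ0.le
          linarith
        · rw [← tsum_geometric_of_lt_one hx0 hx1]
          exact (summable_geometric_of_lt_one hx0 hx1).sum_le_tsum _ fun c _ => pow_nonneg hx0 c
        · exact Finset.sum_nonneg fun c _ => pow_nonneg hx0 c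

/-- The factors 1/U sum to order log T, which exp(-κn) absorbs because n ≥ log T. The total is
bounded uniformly in `T`. -/
theorem sum_measure_indexFailure_le [NeZero K] {ν : Fin K → ProbabilityMeasure unitInterval}
    {m δ : ℝ} (hm : ∫ x : unitInterval, (x : ℝ) ∂(ν k : Measure unitInterval) = m) (hδ : 0 < δ)
    (hδm : 4 * δ ≤ m) (hm1 : m ≤ 1) {T : ℕ} (hT : 1 ≤ Real.log T) (hM : 1 ≤ M) {L₀ : ℝ}
    (hL : 3 ≤ L₀) :
    ∑ t ∈ (Finset.range T).filter (fun t : ℕ => L₀ + M < (t : ℝ) + 1),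
      (gameLaw ν M).real (indexFailure s i T k m δ (lastUpdate M (t + 1))) ≤
      indexFailureBound m δ := by
  set κ := klReal (m - 2 * δ) (m - δ) with hκ
  have hn := obsTarget_ge (K := K) hT
  set n := obsTarget K T with hn'
  have hκ0 : 0 < κ := klReal_pos (by linarith) (by linarith) (by linarith)
  have hx1 : Real.exp (-κ) < 1 := Real.exp_lt_one_iff.2 (by linarith)
  have hg0 : 0 < (1 - Real.exp (-κ))⁻¹ := inv_pos.2 (by linarith)
  have hn0 : 0 < n := by linarith
  set X : ℝ := Real.exp (-(κ * n)) * (1 - Real.exp (-κ))⁻¹ with hX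
  have hX0 : 0 ≤ X := mul_nonneg (Real.exp_pos _).le hg0.le
  have h1 : ∀ t ∈ (Finset.range T).filter (fun t : ℕ => L₀ + M < (t : ℝ) + 1),
      (gameLaw ν M).real (indexFailure s i T k m δ (lastUpdate M (t + 1))) ≤
        2 * X * ((t : ℝ) + 1)⁻¹ := fun t ht => by
    have h2 := lt_lastUpdate_of_lt hM (Finset.mem_filter.1 ht).2
    have hU : 3 ≤ lastUpdate M (t + 1) := by
      have : ((3 : ℕ) : ℝ) < lastUpdate M (t + 1) := by push_cast; linarith
      exact_mod_cast this.le
    refine (measure_indexFailure_le hm hδ hδm hm1 hU hn0).trans ?_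
    rw [← hκ, ← hX, show 2 * X * ((t : ℝ) + 1)⁻¹ = 2 / ((t : ℝ) + 1) * X by ring]
    refine mul_le_mul_of_nonneg_right ?_ hX0
    rw [div_le_div_iff₀ (by positivity) (by positivity)]
    -- The last update is a positive multiple of M and precedes t + 1 by less than M, so it is at
    -- least half of t + 1.
    have h3 : t + 1 ≤ 2 * lastUpdate M (t + 1) := by
      have h4 : t + 1 < M * ((t + 1) / M + 1) := Nat.lt_mul_div_succ _ hM
      have h5 : M ≤ lastUpdate M (t + 1) := by
        unfold lastUpdate at hU ⊢
        exact Nat.le_mul_of_pos_right M (Nat.pos_of_ne_zero fun h => by simp [h] at hU)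
      unfold lastUpdate at h5 ⊢
      rw [mul_add, mul_one] at h4
      omega
    have h4 : ((t + 1 : ℕ) : ℝ) ≤ ((2 * lastUpdate M (t + 1) : ℕ) : ℝ) := by exact_mod_cast h3
    push_cast at h4
    linarith
  have h2 : ∑ t ∈ Finset.range T, ((t : ℝ) + 1)⁻¹ ≤ 1 + Real.log T := by
    have h3 := harmonic_le_one_add_log T
    simp only [harmonic, Rat.cast_sum, Rat.cast_inv, Rat.cast_natCast] at h3
    push_cast at h3
    exact h3
  calc _ ≤ ∑ t ∈ (Finset.range T).filter (fun t : ℕ => L₀ + M < (t : ℝ) + 1),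
        2 * X * ((t : ℝ) + 1)⁻¹ := Finset.sum_le_sum h1
    _ ≤ ∑ t ∈ Finset.range T, 2 * X * ((t : ℝ) + 1)⁻¹ :=
        Finset.sum_le_sum_of_subset_of_nonneg (Finset.filter_subset _ _) fun t _ _ => by positivity
    _ = 2 * X * ∑ t ∈ Finset.range T, ((t : ℝ) + 1)⁻¹ := (Finset.mul_sum _ _ _).symm
    _ ≤ 2 * X * (1 + Real.log T) := mul_le_mul_of_nonneg_left h2 (by positivity)
    _ = 2 * (Real.exp (-(κ * n)) * (1 + Real.log T)) * (1 - Real.exp (-κ))⁻¹ := by rw [hX]; ring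
    _ ≤ 2 * (1 + 1 / κ) * (1 - Real.exp (-κ))⁻¹ := by
        refine mul_le_mul_of_nonneg_right (mul_le_mul_of_nonneg_left ?_ zero_le_two) hg0.le
        have h3 : Real.exp (-(κ * n)) ≤ 1 := Real.exp_le_one_iff.2 (by
          have := mul_pos hκ0 hn0; linarith)
        have h4 : Real.exp (-(κ * n)) * Real.log T ≤ 1 / κ := by
          rw [le_div_iff₀ hκ0]
          have h5 := Real.add_one_le_exp (κ * n)
          have h6 : Real.exp (-(κ * n)) * Real.exp (κ * n) = 1 := by rw [← Real.exp_add]; simp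
          have h7 : Real.log T * κ ≤ Real.exp (κ * n) := by nlinarith
          calc Real.exp (-(κ * n)) * Real.log T * κ = Real.exp (-(κ * n)) * (Real.log T * κ) := by
                ring
            _ ≤ Real.exp (-(κ * n)) * Real.exp (κ * n) :=
                mul_le_mul_of_nonneg_left h7 (Real.exp_pos _).le
            _ = 1 := h6
        linarith
    _ = indexFailureBound m δ := rfl

end IndexFailure

end MPBandit

namespace MPBandit
open Set

/-! ## Bounds for the expected rewards -/

section Expected

variable {K M : ℕ} {s : Fin M → Strategy K} {A : Finset (Fin M)} {μ : Fin K → ℝ} {δ L₀ : ℝ}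
  {T : ℕ}

theorem measurableSet_indexFailure (s : Fin M → Strategy K) (i : Fin M) (T : ℕ) (k : Fin K)
    (m δ : ℝ) (U : ℕ) : MeasurableSet (indexFailure s i T k m δ U) := by
  have h1 : Measurable fun ω => pullIndex s i U ω k := by
    have h2 : Measurable fun z : ℝ × ℕ => klIndex z.2 z.1 U :=
      measurable_from_prod_countable_left fun n => measurable_klIndex n U
    have h3 := h2.comp ((measurable_pullMean s i k (U - 1)).prodMk (measurable_pulls s i k (U - 1)))
    simp only [Function.comp_def] at h3
    simp only [pullIndex]
    exact h3
  have h4 : Measurable fun ω => (pulls s i k (U - 1) ω : ℝ) :=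
    measurable_from_nat.comp (measurable_pulls s i k (U - 1))
  exact (measurableSet_le measurable_const h4).inter
    ((measurableSet_le (measurable_pullMean s i k (U - 1)) measurable_const).inter
      (measurableSet_lt h1 measurable_const))

/-- A bound for the number of rounds with bad statistics of a player of `A` after the
initialization. -/
def statsFailures (s : Fin M → Strategy K) (A : Finset (Fin M)) (μ : Fin K → ℝ) (δ L₀ : ℝ)
    (T : ℕ) (ω : ℕ → Draw K M) : ℝ :=
  ∑ i ∈ A, ∑ k, (M * ∑ t ∈ Finset.range (T + M),
      (deviantSet s i k M (μ k) δ (1 / (2 * K)) t).indicator 1 ω +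
    ∑ t ∈ (Finset.range T).filter (fun t : ℕ => L₀ + M < (t : ℝ) + 1),
      (indexFailure s i T k (μ k) δ (lastUpdate M (t + 1))).indicator 1 ω)

/-- A bound for the expectation of `statsFailures`. -/
def statsFailureBound (M : ℕ) (μ : Fin K → ℝ) (δ : ℝ) : ℝ :=
  M * ∑ k, (M * (M / (1 / (2 * K)) * (2 * (1 - Real.exp (-(δ ^ 2 / 4)))⁻¹)) +
    indexFailureBound (μ k) δ)

theorem statsFailures_nonneg (ω : ℕ → Draw K M) : 0 ≤ statsFailures s A μ δ L₀ T ω :=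
  Finset.sum_nonneg fun _ _ => Finset.sum_nonneg fun _ _ => add_nonneg
    (mul_nonneg (Nat.cast_nonneg M) (Finset.sum_nonneg fun _ _ =>
      Set.indicator_nonneg (fun _ _ => zero_le_one) ω))
    (Finset.sum_nonneg fun _ _ => Set.indicator_nonneg (fun _ _ => zero_le_one) ω)

theorem integrable_indicator_one (ν : Fin K → ProbabilityMeasure unitInterval)
    {S : Set (ℕ → Draw K M)} (hS : MeasurableSet S) :
    Integrable (S.indicator (1 : (ℕ → Draw K M) → ℝ)) (gameLaw ν M) :=
  (integrable_const (1 : ℝ)).indicator hS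

theorem integrable_statsFailures (ν : Fin K → ProbabilityMeasure unitInterval) :
    Integrable (statsFailures s A μ δ L₀ T) (gameLaw ν M) :=
  integrable_finsetSum _ fun i _ => integrable_finsetSum _ fun k _ =>
    ((integrable_finsetSum _ fun _ _ => integrable_indicator_one ν
      (measurableSet_deviantSet M (μ k) δ _ _)).const_mul _).add
      (integrable_finsetSum _ fun _ _ => integrable_indicator_one ν
        (measurableSet_indexFailure s i T k (μ k) δ _))

theorem indexFailureBound_nonneg {m δ : ℝ} (hδ : 0 < δ) (hδm : 4 * δ ≤ m) (hm1 : m ≤ 1) :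
    0 ≤ indexFailureBound m δ := by
  have h : 0 < klReal (m - 2 * δ) (m - δ) := klReal_pos (by linarith) (by linarith) (by linarith)
  have h1 : Real.exp (-klReal (m - 2 * δ) (m - δ)) < 1 := Real.exp_lt_one_iff.2 (by linarith)
  have h2 : 0 < (1 - Real.exp (-klReal (m - 2 * δ) (m - δ)))⁻¹ := inv_pos.2 (by linarith)
  unfold indexFailureBound
  positivity

theorem deviation_factor_pos {δ : ℝ} (hδ : 0 < δ) : 0 < (1 - Real.exp (-(δ ^ 2 / 4)))⁻¹ := by
  have h1 : Real.exp (-(δ ^ 2 / 4)) < 1 := Real.exp_lt_one_iff.2 (by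
    have := pow_pos hδ 2; linarith)
  exact inv_pos.2 (by linarith)

theorem integral_statsFailures_le [NeZero K] {ν : Fin K → ProbabilityMeasure unitInterval}
    (hμ : ∀ k, ∫ x : unitInterval, (x : ℝ) ∂(ν k : Measure unitInterval) = μ k) (hδ : 0 < δ)
    (hδm : ∀ k, 4 * δ ≤ μ k) (hμ1 : ∀ k, μ k ≤ 1) (hM : 1 ≤ M) (hT : 1 ≤ Real.log T)
    (hL : 3 ≤ L₀) :
    ∫ ω, statsFailures s A μ δ L₀ T ω ∂(gameLaw ν M) ≤ statsFailureBound M μ δ := by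
  have hK : (0 : ℝ) < K := by exact_mod_cast Nat.pos_of_ne_zero (NeZero.ne K)
  have hd : ∀ i k t, Integrable ((deviantSet s i k M (μ k) δ (1 / (2 * K)) t).indicator
      (1 : (ℕ → Draw K M) → ℝ)) (gameLaw ν M) := fun i k t =>
    integrable_indicator_one ν (measurableSet_deviantSet M (μ k) δ _ t)
  have hf : ∀ i k t, Integrable ((indexFailure s i T k (μ k) δ (lastUpdate M (t + 1))).indicator
      (1 : (ℕ → Draw K M) → ℝ)) (gameLaw ν M) := fun i k t =>
    integrable_indicator_one ν (measurableSet_indexFailure s i T k (μ k) δ _)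
  have hds : ∀ i k, Integrable (fun ω => (M : ℝ) * ∑ t ∈ Finset.range (T + M),
      (deviantSet s i k M (μ k) δ (1 / (2 * K)) t).indicator 1 ω) (gameLaw ν M) := fun i k =>
    (integrable_finsetSum _ fun t _ => hd i k t).const_mul _
  have hfs : ∀ i k, Integrable (fun ω => ∑ t ∈ (Finset.range T).filter
      (fun t : ℕ => L₀ + M < (t : ℝ) + 1),
      (indexFailure s i T k (μ k) δ (lastUpdate M (t + 1))).indicator
        (1 : (ℕ → Draw K M) → ℝ) ω) (gameLaw ν M) := fun i k =>
    integrable_finsetSum _ fun t _ => hf i k t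
  have hsum : ∀ i k, Integrable (fun ω => (M : ℝ) * ∑ t ∈ Finset.range (T + M),
      (deviantSet s i k M (μ k) δ (1 / (2 * K)) t).indicator 1 ω +
      ∑ t ∈ (Finset.range T).filter (fun t : ℕ => L₀ + M < (t : ℝ) + 1),
        (indexFailure s i T k (μ k) δ (lastUpdate M (t + 1))).indicator 1 ω) (gameLaw ν M) :=
    fun i k => (hds i k).add (hfs i k)
  have hone : ∀ i k, ∫ ω, ((M : ℝ) * ∑ t ∈ Finset.range (T + M),
      (deviantSet s i k M (μ k) δ (1 / (2 * K)) t).indicator 1 ω +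
      ∑ t ∈ (Finset.range T).filter (fun t : ℕ => L₀ + M < (t : ℝ) + 1),
        (indexFailure s i T k (μ k) δ (lastUpdate M (t + 1))).indicator 1 ω) ∂(gameLaw ν M) ≤
      M * (M / (1 / (2 * K)) * (2 * (1 - Real.exp (-(δ ^ 2 / 4)))⁻¹)) +
        indexFailureBound (μ k) δ := fun i k => by
    rw [integral_add (hds i k) (hfs i k), integral_const_mul, integral_finsetSum _ fun t _ => hd i k t,
      integral_finsetSum _ fun t _ => hf i k t]
    refine add_le_add (mul_le_mul_of_nonneg_left ?_ (Nat.cast_nonneg M)) ?_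
    · rw [Finset.sum_congr rfl fun t _ => integral_indicator_one
        (measurableSet_deviantSet M (μ k) δ (1 / (2 * K)) t)]
      exact sum_measure_deviantSet_le (hμ k) hδ (by linarith [hδm k, hμ1 k]) (by positivity) hM _
    · rw [Finset.sum_congr rfl fun t _ => integral_indicator_one
        (measurableSet_indexFailure s i T k (μ k) δ (lastUpdate M (t + 1)))]
      exact sum_measure_indexFailure_le (hμ k) hδ (hδm k) (hμ1 k) hT hM hL
  have hnn : ∀ k, 0 ≤ (M : ℝ) * (M / (1 / (2 * K)) * (2 * (1 - Real.exp (-(δ ^ 2 / 4)))⁻¹)) +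
      indexFailureBound (μ k) δ := fun k => by
    have := deviation_factor_pos hδ
    have := indexFailureBound_nonneg hδ (hδm k) (hμ1 k)
    positivity
  unfold statsFailures
  rw [integral_finsetSum _ fun i _ => integrable_finsetSum _ fun k _ => hsum i k]
  calc _ ≤ ∑ i ∈ A, ∑ k, ((M : ℝ) * (M / (1 / (2 * K)) * (2 * (1 - Real.exp (-(δ ^ 2 / 4)))⁻¹)) +
        indexFailureBound (μ k) δ) := Finset.sum_le_sum fun i _ => by
          rw [integral_finsetSum _ fun k _ => hsum i k]
          exact Finset.sum_le_sum fun k _ => hone i k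
    _ ≤ ∑ i : Fin M, ∑ k, ((M : ℝ) * (M / (1 / (2 * K)) *
        (2 * (1 - Real.exp (-(δ ^ 2 / 4)))⁻¹)) + indexFailureBound (μ k) δ) :=
        Finset.sum_le_sum_of_subset_of_nonneg (Finset.subset_univ A)
          fun i _ _ => Finset.sum_nonneg fun k _ => hnn k
    _ = statsFailureBound M μ δ := by
        rw [Finset.sum_const, Finset.card_univ, Fintype.card_fin, nsmul_eq_mul, statsFailureBound]

/-- The number of rounds in which a player outside of `A` collides. -/
def outerCollisions (s : Fin M → Strategy K) (A : Finset (Fin M)) (T : ℕ) (ω : ℕ → Draw K M) : ℝ :=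
  (((Finset.range T).filter fun t =>
    ∃ j ∉ A, Collision (actions s ω t) (actions s ω t j)).card : ℝ)

theorem outerCollisions_nonneg (ω : ℕ → Draw K M) : 0 ≤ outerCollisions s A T ω :=
  Nat.cast_nonneg _

theorem outerCollisions_le (ω : ℕ → Draw K M) : outerCollisions s A T ω ≤ T := by
  unfold outerCollisions
  exact_mod_cast (Finset.card_filter_le _ _).trans (Finset.card_range T).le

theorem integrable_outerCollisions (ν : Fin K → ProbabilityMeasure unitInterval) :
    Integrable (outerCollisions s A T) (gameLaw ν M) := by
  classical
  have hm : Measurable (outerCollisions s A T) := by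
    have h1 : outerCollisions s A T = fun ω => ∑ t ∈ Finset.range T,
        (fun π : Fin M → Fin K => if ∃ j ∉ A, Collision π (π j) then (1 : ℝ) else 0)
          (actions s ω t) := by
      funext ω
      simp only [outerCollisions, Finset.sum_boole]
    rw [h1]
    exact Finset.measurable_sum _ fun t _ =>
      (measurable_of_countable fun π : Fin M → Fin K =>
        if ∃ j ∉ A, Collision π (π j) then (1 : ℝ) else 0).comp (measurable_actions s t)
  refine Integrable.of_bound hm.aestronglyMeasurable T (Filter.Eventually.of_forall fun ω => ?_)
  rw [Real.norm_eq_abs, abs_of_nonneg (outerCollisions_nonneg ω)]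
  exact outerCollisions_le ω

theorem outerCollisions_univ (ω : ℕ → Draw K M) :
    outerCollisions s Finset.univ T ω = 0 := by
  simp [outerCollisions]

variable [NeZero K]

open Classical in
theorem Initialized.card_not_goodRound_le {a : Fin M → Fin K} {ω : ℕ → Draw K M}
    (hI : Initialized s T A L₀ a ω) (hM : 1 ≤ M) (hMK : M ≤ K) (hμ : Function.Injective μ)
    (hδ : 0 < δ) (hgap : ∀ k l, μ k < μ l → μ k + 4 * δ ≤ μ l) (hL : 0 ≤ L₀)
    (hn : 0 < obsTarget K T) :
    (((Finset.range T).filter fun t => ¬ GoodRound s A μ δ L₀ t ω).card : ℝ) ≤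
      L₀ + M + statsFailures s A μ δ L₀ T ω := by
  set S : Fin M → Finset ℕ := fun i => (Finset.range T).filter fun t : ℕ =>
    L₀ + M < (t : ℝ) + 1 ∧ ¬ StatsGood s i μ δ (lastUpdate M (t + 1)) ω with hS
  have hsub : ((Finset.range T).filter fun t => ¬ GoodRound s A μ δ L₀ t ω) ⊆
      Finset.range ⌊L₀ + M⌋₊ ∪ A.biUnion S := by
    intro t ht
    obtain ⟨htT, hb⟩ := Finset.mem_filter.1 ht
    rw [Finset.mem_union, Finset.mem_range, Finset.mem_biUnion]
    by_cases hlt : L₀ + M < (t : ℝ) + 1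
    · right
      by_contra hno
      push Not at hno
      refine hb ⟨hlt, fun i hi => ?_⟩
      by_contra hs
      exact hno i hi (Finset.mem_filter.2 ⟨htT, hlt, hs⟩)
    · left
      refine Nat.le_floor ?_
      push_cast
      exact not_lt.1 hlt
  have hcard : (((Finset.range T).filter fun t => ¬ GoodRound s A μ δ L₀ t ω).card : ℝ) ≤
      ⌊L₀ + M⌋₊ + ∑ i ∈ A, ((S i).card : ℝ) := by
    have := (Finset.card_le_card hsub).trans ((Finset.card_union_le _ _).trans
      (Nat.add_le_add_left Finset.card_biUnion_le _))
    rw [Finset.card_range] at this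
    exact_mod_cast this
  refine hcard.trans (add_le_add (Nat.floor_le (by positivity)) (Finset.sum_le_sum fun i hi => ?_))
  have h1 := hI.card_bad_le hi hM hMK hμ hδ hgap hL hn
  refine (Nat.cast_le (α := ℝ).2 h1).trans (le_of_eq ?_)
  push_cast
  refine Finset.sum_congr rfl fun k _ => ?_
  simp only [Set.indicator_apply, Pi.one_apply, Finset.sum_boole, Finset.filter_filter]

/-- Lower bound for the expected reward of a cooperative player. -/
theorem le_expReward {ν : Fin K → ProbabilityMeasure unitInterval}
    (hν : ∀ k, ∫ x : unitInterval, (x : ℝ) ∂(ν k : Measure unitInterval) = μ k) {i : Fin M}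
    (hi : i ∈ A) (hM : 1 ≤ M) (hMK : M ≤ K) (hμ : Function.Injective μ) (hδ : 0 < δ)
    (hδm : ∀ k, 4 * δ ≤ μ k) (hμ1 : ∀ k, μ k ≤ 1) {B : ℝ} (hB : ∀ k, μ k ≤ B)
    (hgap : ∀ k l, μ k < μ l → μ k + 4 * δ ≤ μ l) (hL : 3 ≤ L₀) (hT : 1 ≤ Real.log T)
    {e : Fin K} (he : place μ e + 1 = M) {q : ℝ} (hq0 : 0 ≤ q)
    (hq : gameLaw ν M {ω | ¬ ∃ a, Initialized s T A L₀ a ω} ≤ ENNReal.ofReal q) {F : ℝ}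
    (hF0 : 0 ≤ F) (hF : ∀ U : ℕ, L₀ < U → U ≤ T → explorationLevel U ≤ F) :
    T / M * ∑ k ∈ topArms M μ, μ k - M * B - B * (L₀ + M + statsFailureBound M μ δ) -
        (∑ k ∈ Finset.univ.filter (fun k => k ∉ topArms M μ),
          (μ e - μ k) * (F / klReal (μ k + δ) (μ e - 2 * δ) + 1)) -
        B * ∫ ω, outerCollisions s A T ω ∂(gameLaw ν M) - T * B * q ≤ expReward ν T s i := by
  classical
  have hμ0 : ∀ k, 0 < μ k := fun k => by linarith [hδm k]
  have hB0 : 0 < B := (hμ0 e).trans_le (hB e)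
  have hn : 0 < obsTarget K T := by linarith [obsTarget_ge (K := K) hT]
  have hM0 : (0 : ℝ) < M := by exact_mod_cast hM
  have hke : ∀ k ∉ topArms M μ, μ k < μ e := fun k hk =>
    lt_of_place_lt hμ (by rw [mem_topArms] at hk; omega)
  -- The measurable hull has the same measure, so the measurability of the failure event need not be
  -- established.
  set N := toMeasurable (gameLaw ν M) {ω | ¬ ∃ a, Initialized s T A L₀ a ω} with hN
  have hNm : MeasurableSet N := measurableSet_toMeasurable _ _
  have hNq : (gameLaw ν M).real N ≤ q :=
    ENNReal.toReal_le_of_le_ofReal hq0 (by rw [hN, measure_toMeasurable]; exact hq)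
  set E := ∑ k ∈ Finset.univ.filter (fun k => k ∉ topArms M μ),
    (μ e - μ k) * (F / klReal (μ k + δ) (μ e - 2 * δ) + 1) with hE
  have hE0 : 0 ≤ E := Finset.sum_nonneg fun k hk => by
    have h1 := hke k (Finset.mem_filter.1 hk).2
    have h2 := hgap k e h1
    have h3 : 0 < klReal (μ k + δ) (μ e - 2 * δ) := klReal_pos (by linarith [hμ0 k]) (by linarith)
      (by linarith [hμ1 e])
    exact mul_nonneg (by linarith) (by positivity)
  have htop : T / M * ∑ k ∈ topArms M μ, μ k ≤ T * B := by
    have h1 : ∑ k ∈ topArms M μ, μ k ≤ M * B := by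
      calc ∑ k ∈ topArms M μ, μ k ≤ ∑ k ∈ topArms M μ, B := Finset.sum_le_sum fun k _ => hB k
        _ = M * B := by rw [Finset.sum_const, card_topArms hMK, nsmul_eq_mul]
    calc T / M * ∑ k ∈ topArms M μ, μ k ≤ T / M * (M * B) :=
          mul_le_mul_of_nonneg_left h1 (by positivity)
      _ = T * B := by field_simp
  set c := T / M * ∑ k ∈ topArms M μ, μ k - M * B - B * (L₀ + M) - E with hc
  have hS0 := statsFailures_nonneg (s := s) (A := A) (μ := μ) (δ := δ) (L₀ := L₀) (T := T)
  have hpath : ∀ ω, c - B * statsFailures s A μ δ L₀ T ω - B * outerCollisions s A T ω -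
      T * B * N.indicator 1 ω ≤ ∑ t ∈ Finset.range T, netMean μ (actions s ω t) i := by
    intro ω
    have hZ0 := outerCollisions_nonneg (s := s) (A := A) (T := T) ω
    -- On the failure event the trivial bound 0 is enough, since the rotation value is at most `T *
    -- B`.
    by_cases hω : ω ∈ N
    · rw [Set.indicator_of_mem hω, Pi.one_apply]
      have h1 : 0 ≤ ∑ t ∈ Finset.range T, netMean μ (actions s ω t) i :=
        Finset.sum_nonneg fun t _ => netMean_nonneg hμ0 _ i
      have h2 := mul_nonneg hB0.le (hS0 ω)
      have h3 := mul_nonneg hB0.le hZ0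
      have h4 : 0 ≤ B * (L₀ + M) := by positivity
      have h5 : 0 ≤ M * B := by positivity
      linarith
    · rw [Set.indicator_of_notMem hω]
      obtain ⟨a, hI⟩ := not_not.1 fun h => hω (subset_toMeasurable _ _ h)
      have h1 := hI.sum_netMean_ge hi hM hMK hδ hμ0 hμ1 hB hgap (by linarith) hn hF he hke hF0
        ((Finset.range T).filter fun t => ∃ j ∉ A, Collision (actions s ω t) (actions s ω t j))
        fun t ht hg hcol => Finset.mem_filter.2 ⟨Finset.mem_range.2 ht,
          hI.exists_collision hi hM hMK hg hcol⟩
      have h2 := mul_le_mul_of_nonneg_left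
        (hI.card_not_goodRound_le hM hMK hμ hδ hgap (by linarith) hn) hB0.le
      have h3 : outerCollisions s A T ω = (((Finset.range T).filter fun t =>
          ∃ j ∉ A, Collision (actions s ω t) (actions s ω t j)).card : ℝ) := by
        rfl
      rw [h3]
      rw [← hE] at h1
      linarith
  have hiS := (integrable_statsFailures (s := s) (A := A) (μ := μ) (δ := δ) (L₀ := L₀) (T := T)
    ν).const_mul B
  have hiZ := (integrable_outerCollisions (s := s) (A := A) (T := T) ν).const_mul B
  have hiN := (integrable_indicator_one ν hNm).const_mul (T * B)
  have hi₁ : Integrable (fun ω => c - B * statsFailures s A μ δ L₀ T ω) (gameLaw ν M) :=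
    (integrable_const c).sub hiS
  have hi₂ : Integrable (fun ω => c - B * statsFailures s A μ δ L₀ T ω -
    B * outerCollisions s A T ω) (gameLaw ν M) := hi₁.sub hiZ
  have hi₃ : Integrable (fun ω => c - B * statsFailures s A μ δ L₀ T ω -
    B * outerCollisions s A T ω - T * B * N.indicator 1 ω) (gameLaw ν M) := hi₂.sub hiN
  have hmono := integral_mono hi₃
    (integrable_finsetSum _ fun t _ => integrable_netMean ν s μ t i) hpath
  have hint : ∫ ω, (c - B * statsFailures s A μ δ L₀ T ω - B * outerCollisions s A T ω -
      T * B * N.indicator 1 ω) ∂(gameLaw ν M) =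
      c - B * ∫ ω, statsFailures s A μ δ L₀ T ω ∂(gameLaw ν M) -
        B * ∫ ω, outerCollisions s A T ω ∂(gameLaw ν M) - T * B * (gameLaw ν M).real N := by
    rw [integral_sub hi₂ hiN, integral_sub hi₁ hiZ, integral_sub (integrable_const c) hiS,
      integral_const_mul, integral_const_mul, integral_const_mul, integral_indicator_one hNm]
    simp
  have h1 := mul_le_mul_of_nonneg_left (integral_statsFailures_le (s := s) (A := A) hν hδ hδm hμ1
    hM hT hL) hB0.le
  have h2 : T * B * (gameLaw ν M).real N ≤ T * B * q :=
    mul_le_mul_of_nonneg_left hNq (by positivity)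
  rw [expReward_eq ν hν]
  refine le_trans ?_ hmono
  rw [hint]
  linarith

/-- Upper bound for the expected reward of a selfish player. -/
theorem expReward_le {ν : Fin K → ProbabilityMeasure unitInterval}
    (hν : ∀ k, ∫ x : unitInterval, (x : ℝ) ∂(ν k : Measure unitInterval) = μ k) {j : Fin M}
    (hM : 1 ≤ M) (hMK : M ≤ K) (hμ : Function.Injective μ) (hδ : 0 < δ)
    (hδm : ∀ k, 4 * δ ≤ μ k) (hμ1 : ∀ k, μ k ≤ 1) {B : ℝ} (hB : ∀ k, μ k ≤ B)
    (hgap : ∀ k l, μ k < μ l → μ k + 4 * δ ≤ μ l) (hL : 3 ≤ L₀) (hT : 1 ≤ Real.log T)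
    {e : Fin K} (he : place μ e + 1 = M) {q : ℝ} (hq0 : 0 ≤ q)
    (hq : gameLaw ν M {ω | ¬ ∃ a, Initialized s T (Finset.univ.erase j) L₀ a ω} ≤
      ENNReal.ofReal q) :
    expReward ν T s j ≤ T / M * ∑ k ∈ topArms M μ, μ k + M * B +
        2 * B * (L₀ + M + statsFailureBound M μ δ) -
        μ e * ∫ ω, outerCollisions s (Finset.univ.erase j) T ω ∂(gameLaw ν M) +
        2 * (T * B * q) := by
  classical
  have hμ0 : ∀ k, 0 < μ k := fun k => by linarith [hδm k]
  have hB0 : 0 < B := (hμ0 e).trans_le (hB e)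
  have hn : 0 < obsTarget K T := by linarith [obsTarget_ge (K := K) hT]
  have hM0 : (0 : ℝ) < M := by exact_mod_cast hM
  have hke : ∀ k ∉ topArms M μ, μ k < μ e := fun k hk =>
    lt_of_place_lt hμ (by rw [mem_topArms] at hk; omega)
  set A := Finset.univ.erase j with hA
  set N := toMeasurable (gameLaw ν M) {ω | ¬ ∃ a, Initialized s T A L₀ a ω} with hN
  have hNm : MeasurableSet N := measurableSet_toMeasurable _ _
  have hNq : (gameLaw ν M).real N ≤ q :=
    ENNReal.toReal_le_of_le_ofReal hq0 (by rw [hN, measure_toMeasurable]; exact hq)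
  have htop : 0 ≤ T / M * ∑ k ∈ topArms M μ, μ k :=
    mul_nonneg (by positivity) (Finset.sum_nonneg fun k _ => (hμ0 k).le)
  set c := T / M * ∑ k ∈ topArms M μ, μ k + M * B + 2 * B * (L₀ + M) with hc
  have hS0 := statsFailures_nonneg (s := s) (A := A) (μ := μ) (δ := δ) (L₀ := L₀) (T := T)
  have hpath : ∀ ω, ∑ t ∈ Finset.range T, netMean μ (actions s ω t) j ≤
      c + 2 * B * statsFailures s A μ δ L₀ T ω - μ e * outerCollisions s A T ω +
      2 * (T * B) * N.indicator 1 ω := by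
    intro ω
    have hZ1 := outerCollisions_le (s := s) (A := A) (T := T) ω
    by_cases hω : ω ∈ N
    · rw [Set.indicator_of_mem hω, Pi.one_apply]
      have h1 : ∑ t ∈ Finset.range T, netMean μ (actions s ω t) j ≤ T * B := by
        calc _ ≤ ∑ t ∈ Finset.range T, B := Finset.sum_le_sum fun t _ => by
              rw [netMean]; split_ifs
              · exact hB0.le
              · exact hB _
          _ = T * B := by rw [Finset.sum_const, Finset.card_range, nsmul_eq_mul]
      have h2 : 0 ≤ 2 * B * statsFailures s A μ δ L₀ T ω := mul_nonneg (by linarith) (hS0 ω)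
      have h3 : μ e * outerCollisions s A T ω ≤ B * T :=
        -- On the failure event one `T * B` bounds the reward and a second one pays for the
        -- collision term that is subtracted; hence the factor 2.
        mul_le_mul (hB e) hZ1 (outerCollisions_nonneg ω) hB0.le
      have h4 : 0 ≤ 2 * B * (L₀ + M) := by positivity
      have h5 : 0 ≤ M * B := by positivity
      linarith
    · rw [Set.indicator_of_notMem hω]
      obtain ⟨a, hI⟩ := not_not.1 fun h => hω (subset_toMeasurable _ _ h)
      have h1 := hI.sum_netMean_le (δ := δ) hM hMK hμ0 hB he hke
      have h2 := mul_le_mul_of_nonneg_left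
        (hI.card_not_goodRound_le hM hMK hμ hδ hgap (by linarith) hn)
        (show 0 ≤ 2 * B by linarith)
      have h3 : outerCollisions s A T ω = (((Finset.range T).filter fun t =>
          Collision (actions s ω t) (actions s ω t j)).card : ℝ) := by
        unfold outerCollisions
        congr 2
        exact Finset.filter_congr fun t _ => by simp [hA]
      rw [h3]
      linarith
  have hiS := (integrable_statsFailures (s := s) (A := A) (μ := μ) (δ := δ) (L₀ := L₀) (T := T)
    ν).const_mul (2 * B)
  have hiZ := (integrable_outerCollisions (s := s) (A := A) (T := T) ν).const_mul (μ e)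
  have hiN := (integrable_indicator_one ν hNm).const_mul (2 * (T * B))
  have hi₁ : Integrable (fun ω => c + 2 * B * statsFailures s A μ δ L₀ T ω) (gameLaw ν M) :=
    (integrable_const c).add hiS
  have hi₂ : Integrable (fun ω => c + 2 * B * statsFailures s A μ δ L₀ T ω -
    μ e * outerCollisions s A T ω) (gameLaw ν M) := hi₁.sub hiZ
  have hi₃ : Integrable (fun ω => c + 2 * B * statsFailures s A μ δ L₀ T ω -
    μ e * outerCollisions s A T ω + 2 * (T * B) * N.indicator 1 ω) (gameLaw ν M) := hi₂.add hiN
  have hmono := integral_mono (integrable_finsetSum _ fun t _ => integrable_netMean ν s μ t j)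
    hi₃ hpath
  have hint : ∫ ω, (c + 2 * B * statsFailures s A μ δ L₀ T ω - μ e * outerCollisions s A T ω +
      2 * (T * B) * N.indicator 1 ω) ∂(gameLaw ν M) =
      c + 2 * B * ∫ ω, statsFailures s A μ δ L₀ T ω ∂(gameLaw ν M) -
        μ e * ∫ ω, outerCollisions s A T ω ∂(gameLaw ν M) +
        2 * (T * B) * (gameLaw ν M).real N := by
    rw [integral_add hi₂ hiN, integral_sub hi₁ hiZ, integral_add (integrable_const c) hiS,
      integral_const_mul, integral_const_mul, integral_const_mul, integral_indicator_one hNm]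
    simp
  have h1 := mul_le_mul_of_nonneg_left (integral_statsFailures_le (s := s) (A := A) hν hδ hδm hμ1
    hM hT hL) (show 0 ≤ 2 * B by linarith)
  have h2 : 2 * (T * B) * (gameLaw ν M).real N ≤ 2 * (T * B) * q :=
    mul_le_mul_of_nonneg_left hNq (by positivity)
  rw [expReward_eq ν hν]
  refine hmono.trans ?_
  rw [hint]
  linarith

end Expected

end MPBandit

namespace MPBandit
open Set Filter Topology

/-! ## The equilibrium property -/

section Equilibrium

variable {K M : ℕ}

/-- Rewards of the cooperative players that are close to an average, together with a bound for what
a deviating player gains in terms of the damage `z` that she does, make a symmetric profile a stable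
Nash equilibrium. -/
theorem isNash_isStable_of_bounds {ν : Fin K → ProbabilityMeasure unitInterval} {T : ℕ}
    {σ : Strategy K} {v E₁ E₂ B m ε : ℝ} (hm0 : 0 ≤ m) (hmB : m ≤ B) (hB : 0 < B)
    (hlow : ∀ i : Fin M, v - E₁ ≤ expReward ν T (fun _ => σ) i)
    (hdev : ∀ (s' : Strategy K) (j : Fin M), ∃ z : ℝ, 0 ≤ z ∧
      expReward ν T (Function.update (fun _ => σ) j s') j ≤ v + E₂ - m * z ∧
      ∀ i, i ≠ j → v - E₁ - B * z ≤ expReward ν T (Function.update (fun _ => σ) j s') i)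
    (hε0 : 0 ≤ ε) (hε : E₁ + E₂ ≤ ε) :
    IsNash ν T ε (fun _ : Fin M => σ) ∧ IsStable ν T (m / B) ε (fun _ : Fin M => σ) := by
  have hα1 : m / B ≤ 1 := (div_le_one hB).2 hmB
  have hα0 : 0 ≤ m / B := div_nonneg hm0 hB.le
  constructor
  · intro s' j
    obtain ⟨z, hz, h1, -⟩ := hdev s' j
    have h2 := hlow j
    have h3 := mul_nonneg hm0 hz
    linarith
  · intro s' l hl i j h
    rcases eq_or_ne i j with rfl | hij
    · have h1 := mul_le_of_le_one_left hl hα1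
      linarith
    · obtain ⟨z, hz, h1, h2⟩ := hdev s' j
      have h3 := h2 i hij
      have h4 := hlow j
      -- With a common baseline, the victim's loss gives l ≤ (baseline - v + E₁) + B z.
      -- Multiplication by m/B ≤ 1 leaves the first part at most unchanged, as it is nonnegative,
      -- and turns the second into m z.
      rw [expReward_symm ν T σ i j] at h
      have h5 : m / B * l ≤ m / B * (expReward ν T (fun _ => σ) j - v + E₁ + B * z) :=
        mul_le_mul_of_nonneg_left (by linarith) hα0
      have h6 : m / B * (expReward ν T (fun _ => σ) j - v + E₁ + B * z) =
          m / B * (expReward ν T (fun _ => σ) j - v + E₁) + m * z := by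
        field_simp
      have h7 : m / B * (expReward ν T (fun _ => σ) j - v + E₁) ≤
          expReward ν T (fun _ => σ) j - v + E₁ :=
        mul_le_of_le_one_left (by linarith) hα1
      linarith

/-- A quality is at most the indicator that it is positive. Hence the duration of the
initialization, governed by the probabilities of positive qualities, is bounded through the means,
and T₀ can be chosen independently of the laws. -/
theorem mean_le_posProb {ν : Fin K → ProbabilityMeasure unitInterval} {k : Fin K} {m : ℝ}
    (hm : ∫ x : unitInterval, (x : ℝ) ∂(ν k : Measure unitInterval) = m) : m ≤ posProb ν k := by
  rw [← hm, posProb, ← integral_indicator_one measurableSet_pos]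
  refine integral_mono ?_ ((integrable_const (1 : ℝ)).indicator measurableSet_pos) fun x => ?_
  · exact Integrable.of_bound measurable_subtype_coe.aestronglyMeasurable 1
      (Eventually.of_forall fun x => by
        rw [Real.norm_eq_abs, abs_of_nonneg x.2.1]; exact x.2.2)
  · by_cases hx : 0 < x
    · rw [Set.indicator_of_mem (by exact hx)]
      exact x.2.2
    · rw [Set.indicator_of_notMem (by exact hx)]
      exact_mod_cast not_lt.1 hx

theorem mean_le_one {ν : Fin K → ProbabilityMeasure unitInterval} {k : Fin K} {m : ℝ}
    (hm : ∫ x : unitInterval, (x : ℝ) ∂(ν k : Measure unitInterval) = m) : m ≤ 1 :=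
  (mean_le_posProb hm).trans measureReal_le_one

/-- All requirements hold for every small enough δ > 0, and they involve only the finitely many
means. -/
theorem exists_gap {μ : Fin K → ℝ} (hμ0 : ∀ k, 0 < μ k) (hμ1 : ∀ k, μ k ≤ 1) {e : Fin K} {b : ℝ}
    (hb : 0 < b) : ∃ δ, 0 < δ ∧ (∀ k, 4 * δ ≤ μ k) ∧ (∀ k l, μ k < μ l → μ k + 4 * δ ≤ μ l) ∧
      ∀ k, μ k < μ e → (μ e - μ k) / klReal (μ k + δ) (μ e - 2 * δ) ≤
        (ENNReal.ofReal (μ e - μ k) / kl (μ k) (μ e)).toReal + b := by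
  have hsmall : ∀ x : ℝ, 0 < x → ∀ᶠ δ in 𝓝[>] (0 : ℝ), 4 * δ ≤ x := fun x hx => by
    have h1 : ∀ᶠ δ in 𝓝 (0 : ℝ), δ < x / 4 := eventually_lt_nhds (by linarith)
    filter_upwards [h1.filter_mono nhdsWithin_le_nhds] with δ hδ
    linarith
  have hall : ∀ᶠ δ in 𝓝[>] (0 : ℝ), 0 < δ ∧ (∀ k, 4 * δ ≤ μ k) ∧
      (∀ k l, μ k < μ l → μ k + 4 * δ ≤ μ l) ∧
      ∀ k, μ k < μ e → (μ e - μ k) / klReal (μ k + δ) (μ e - 2 * δ) ≤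
        (ENNReal.ofReal (μ e - μ k) / kl (μ k) (μ e)).toReal + b := by
    refine eventually_mem_nhdsWithin.and ((eventually_all.2 fun k => hsmall _ (hμ0 k)).and
      ((eventually_all.2 fun k => eventually_all.2 fun l => ?_).and
        (eventually_all.2 fun k => ?_)))
    · by_cases h : μ k < μ l
      · filter_upwards [hsmall _ (sub_pos.2 h)] with δ hδ _
        linarith
      · exact Eventually.of_forall fun δ h' => absurd h' h
    · by_cases h : μ k < μ e
      · have ht := tendsto_gap_div_klReal (hμ0 k) h (hμ1 e)
        filter_upwards [ht.eventually (eventually_le_nhds (lt_add_of_pos_right _ hb))] with δ hδ _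
        exact hδ
      · exact Eventually.of_forall fun δ h' => absurd h' h
  exact hall.exists

theorem initFailure_anti {m p : ℝ} (hm : 0 < m) (hmp : m ≤ p) :
    initFailure K M p ≤ initFailure K M m := by
  unfold initFailure
  gcongr

theorem initFailure_nonneg {m : ℝ} (hm : 0 < m) : 0 ≤ initFailure K M m := by
  unfold initFailure; positivity

variable [NeZero K]

theorem initBound_bounds {T : ℕ} (hT : 1 ≤ Real.log T) {p m : ℝ} (hm : 0 < m) (hmp : m ≤ p)
    (hp1 : p ≤ 1) :
    3 ≤ initBound K (obsTarget K T * K / p) ∧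
      initBound K (obsTarget K T * K / p) ≤ 2200 * (1 / m * (K : ℝ) ^ 3 * Real.log T) := by
  have hK1 : (1 : ℝ) ≤ K := by exact_mod_cast Nat.one_le_iff_ne_zero.2 (NeZero.ne K)
  have hp0 : 0 < p := hm.trans_le hmp
  have hn := obsTarget_ge (K := K) hT
  set n := obsTarget K T with hn'
  have hτn : n ≤ n * K / p := by
    rw [le_div_iff₀ hp0]
    exact mul_le_mul_of_nonneg_left (hp1.trans hK1) (by linarith)
  have hτ : n * K / p ≤ 1521 * (1 / m * (K : ℝ) ^ 3 * Real.log T) := by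
    have h1 : n * K / p = 1521 * (1 / p * (K : ℝ) ^ 3 * Real.log T) := by
      rw [hn', obsTarget, β]; field_simp; norm_num
    rw [h1]
    gcongr
  have hfrac0 : 0 ≤ γ₂ / (γ₁ ^ 2 * β ^ 2 * (K : ℝ) ^ 2) := by unfold γ₁ γ₂ β; positivity
  have hfrac1 : γ₂ / (γ₁ ^ 2 * β ^ 2 * (K : ℝ) ^ 2) ≤ 1 / 1000 := by
    have h2 : (1 : ℝ) ≤ (K : ℝ) ^ 2 := one_le_pow₀ hK1
    rw [div_le_iff₀ (by unfold γ₁ β; positivity)]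
    unfold γ₁ γ₂ β
    linarith
  set τ := n * K / p with hτdef
  have hτ0 : 0 ≤ τ := by linarith
  have hlin : initBound K τ = (γ₂ / (γ₁ ^ 2 * β ^ 2 * (K : ℝ) ^ 2) * γ₂ + γ₂ ^ 3 / γ₁ ^ 2) * τ := by
    unfold initBound; ring
  -- This ratio is about 1.4075; with the factor 1521 from β² and the small term with `x`, the total
  -- stays below 2200.
  have hc : γ₂ ^ 3 / γ₁ ^ 2 = 802816 / 570375 := by unfold γ₁ γ₂; norm_num
  have hg : γ₂ = 16 / 15 := rfl
  rw [hlin, hc]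
  set x := γ₂ / (γ₁ ^ 2 * β ^ 2 * (K : ℝ) ^ 2) with hx
  rw [hg]
  constructor
  · nlinarith
  · nlinarith

theorem eventually_loglog_le (a c : ℝ) {d : ℝ} (hd : 0 < d) :
    ∀ᶠ T : ℕ in atTop, 1 ≤ Real.log T ∧
      4 * Real.log (Real.log T) * a + c ≤ d * Real.log T := by
  have hlog : Tendsto (fun T : ℕ => Real.log T) atTop atTop :=
    Real.tendsto_log_atTop.comp tendsto_natCast_atTop_atTop
  have h1 : ∀ᶠ x : ℝ in atTop, 4 * Real.log x * a + c ≤ d * x := by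
    have h2 := (Real.isLittleO_log_id_atTop.const_mul_left (4 * a)).def (half_pos hd)
    filter_upwards [h2, eventually_ge_atTop (2 * |c| / d), eventually_ge_atTop 0] with x hx hx1 hx0
    rw [Real.norm_eq_abs, Real.norm_eq_abs, id_eq, abs_of_nonneg hx0] at hx
    have h3 := le_abs_self (4 * a * Real.log x)
    rw [div_le_iff₀ hd] at hx1
    have h4 := le_abs_self c
    linarith
  exact (hlog.eventually (eventually_ge_atTop 1)).and (hlog.eventually h1)

end Equilibrium

/-! ### Assembly of the bounds -/

section Main

variable {K M : ℕ} [NeZero K]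

/-- A bound for the loss of a cooperative player up to the damage done by others. -/
def lowerLoss (M : ℕ) (μ : Fin K → ℝ) (e : Fin K) (δ B L₀ m F : ℝ) : ℝ :=
  M * B + B * (L₀ + M + statsFailureBound M μ δ) +
    (∑ k ∈ Finset.univ.filter (fun k => k ∉ topArms M μ),
      (μ e - μ k) * (F / klReal (μ k + δ) (μ e - 2 * δ) + 1)) + B * initFailure K M m

/-- A bound for the gain of a deviating player. -/
def upperGain (M : ℕ) (μ : Fin K → ℝ) (δ B L₀ m : ℝ) : ℝ :=
  M * B + 2 * B * (L₀ + M + statsFailureBound M μ δ) + 2 * (B * initFailure K M m)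

theorem measure_not_initialized_le (ν : Fin K → ProbabilityMeasure unitInterval)
    {s : Fin M → Strategy K} {A : Finset (Fin M)} {T : ℕ} (hM : 1 ≤ M) (hMK : M ≤ K)
    (hA : ∀ i ∈ A, s i = selfishRobust K T)
    (hother : ∀ i ∈ A, M = 1 ∨ ∃ j, i ≠ j ∧ ∀ i', i' ≠ j → s i' = selfishRobust K T)
    (hT : 1 ≤ Real.log T) {p m : ℝ} (hm : 0 < m) (hmp : m ≤ p) (hp : ∀ k, p ≤ posProb ν k)
    {k₀ : Fin K} (hk₀ : posProb ν k₀ = p) :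
    gameLaw ν M {ω | ¬ ∃ a, Initialized s T A (initBound K (obsTarget K T * K / p)) a ω} ≤
      ENNReal.ofReal (initFailure K M m / T) := by
  have hsub : {ω | ¬ ∃ a, Initialized s T A (initBound K (obsTarget K T * K / p)) a ω} ⊆
      {ω | ¬ InitSuccess s T A (obsTarget K T * K / p) ω} := fun _ hω hI =>
    hω (InitSuccess.exists_initialized hI hM (by linarith) hA)
  exact (measure_mono hsub).trans
    ((measure_not_initSuccess_le ν hMK hA hother hT (hm.trans_le hmp) hp hk₀ rfl).trans
      (ENNReal.ofReal_le_ofReal (by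
        have := initFailure_anti (K := K) (M := M) hm hmp
        gcongr)))

/-- The bound `L₀` on the initialization depends on the laws through p, but p ≥ m bounds it by means
only; so the condition on ε is required for all `L₀` in that range. -/
theorem isNash_isStable_selfishRobust {ν : Fin K → ProbabilityMeasure unitInterval}
    {μ : Fin K → ℝ} (hν : ∀ k, ∫ x : unitInterval, (x : ℝ) ∂(ν k : Measure unitInterval) = μ k)
    (hM : 1 ≤ M) (hMK : M ≤ K) (hμ : Function.Injective μ) {δ : ℝ} (hδ : 0 < δ)
    (hδm : ∀ k, 4 * δ ≤ μ k) {B m : ℝ} (hB : ∀ k, μ k ≤ B) (hm0 : 0 < m) (hm : ∀ k, m ≤ μ k)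
    (hgap : ∀ k l, μ k < μ l → μ k + 4 * δ ≤ μ l) {e : Fin K} (he : place μ e + 1 = M)
    {T : ℕ} (hT : 1 ≤ Real.log T) {ε : ℝ} (hε0 : 0 ≤ ε)
    (hε : ∀ L₀ ≤ 2200 * (1 / m * (K : ℝ) ^ 3 * Real.log T),
      lowerLoss M μ e δ B L₀ m (explorationLevel T) + upperGain M μ δ B L₀ m ≤ ε) :
    IsNash ν T ε (fun _ : Fin M => selfishRobust K T) ∧
      IsStable ν T (μ e / B) ε (fun _ : Fin M => selfishRobust K T) := by
  obtain ⟨k₀, hk₀⟩ := Finite.exists_min (posProb ν)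
  set p := posProb ν k₀ with hp
  have hmp : m ≤ p := (hm k₀).trans (mean_le_posProb (hν k₀))
  obtain ⟨hL3, hLle⟩ := initBound_bounds (K := K) hT hm0 hmp measureReal_le_one
  set L₀ := initBound K (obsTarget K T * K / p) with hL₀
  have hμ0 : ∀ k, 0 < μ k := fun k => hm0.trans_le (hm k)
  have hμ1 : ∀ k, μ k ≤ 1 := fun k => mean_le_one (hν k)
  have hB0 : 0 < B := (hμ0 e).trans_le (hB e)
  have hT0 : (0 : ℝ) < T := by exact_mod_cast pos_of_one_le_log hT
  have hT3 : 3 ≤ T := by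
    by_contra hlt
    have h1 : (T : ℝ) ≤ 2 := by exact_mod_cast (by omega : T ≤ 2)
    have h2 := Real.log_le_log hT0 h1
    have h3 := Real.log_two_lt_d9
    linarith
  have hF0 := (explorationLevel_pos hT3).le
  have hF : ∀ U : ℕ, L₀ < U → U ≤ T → explorationLevel U ≤ explorationLevel T := fun U h1 h2 => by
    refine explorationLevel_mono ?_ h2
    have : ((3 : ℕ) : ℝ) < U := by push_cast; linarith
    exact_mod_cast this.le
  have hq0 : 0 ≤ initFailure K M m / T := div_nonneg (initFailure_nonneg hm0) hT0.le
  -- A failed initialization costs at most order `T * B` and has probability of order 1/T, so it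
  -- contributes a constant.
  have hTq : T * B * (initFailure K M m / T) = B * initFailure K M m := by field_simp
  refine isNash_isStable_of_bounds (v := T / M * ∑ k ∈ topArms M μ, μ k)
    (hμ0 e).le (hB e) hB0 (fun i => ?_) (fun s' j => ?_) hε0 (hε L₀ hLle)
  · have hother : ∀ i ∈ (Finset.univ : Finset (Fin M)), M = 1 ∨ ∃ j, i ≠ j ∧ ∀ i', i' ≠ j →
        (fun _ : Fin M => selfishRobust K T) i' = selfishRobust K T := fun i _ => by
      by_cases h : ∃ j, i ≠ j
      · obtain ⟨j, hj⟩ := h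
        exact Or.inr ⟨j, hj, fun _ _ => rfl⟩
      · left
        push Not at h
        have hlt := i.isLt
        by_contra hne
        have h0 := h ⟨0, by omega⟩
        have h1 := h ⟨1, by omega⟩
        rw [h0] at h1
        exact absurd (Fin.mk.inj h1) (by omega)
    have h1 := le_expReward (A := Finset.univ) hν (Finset.mem_univ i) hM hMK hμ hδ hδm hμ1 hB hgap
      hL3 hT he hq0 (measure_not_initialized_le ν hM hMK (fun _ _ => rfl) hother hT hm0 hmp hk₀ rfl)
      hF0 hF
    simp only [outerCollisions_univ, integral_zero, mul_zero, sub_zero, hTq] at h1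
    rw [lowerLoss]
    linarith
  · have hs : ∀ i, i ≠ j → Function.update (fun _ : Fin M => selfishRobust K T) j s' i =
        selfishRobust K T := fun i hi => by rw [Function.update_of_ne hi]
    have hq := measure_not_initialized_le ν hM hMK (A := Finset.univ.erase j)
      (fun i hi => hs i (Finset.ne_of_mem_erase hi))
      (fun i hi => Or.inr ⟨j, Finset.ne_of_mem_erase hi, hs⟩) hT hm0 hmp hk₀ rfl
    refine ⟨∫ ω, outerCollisions (Function.update (fun _ : Fin M => selfishRobust K T) j s')
        (Finset.univ.erase j) T ω ∂(gameLaw ν M), integral_nonneg fun ω => outerCollisions_nonneg ω,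
      (expReward_le hν hM hMK hμ hδ hδm hμ1 hB hgap hL3 hT he hq0 hq).trans ?_, fun i hi => ?_⟩
    · rw [hTq, upperGain]
      linarith
    · refine le_trans ?_ (le_expReward hν (Finset.mem_erase.2 ⟨hi, Finset.mem_univ i⟩) hM hMK hμ hδ
        hδm hμ1 hB hgap hL3 hT he hq0 hq hF0 hF)
      rw [hTq, lowerLoss]
      linarith

end Main

end MPBandit

end

/-! ### Choice of the constants -/

theorem theorem2 :
    ∃ C : ℝ, 0 < C ∧
      ∀ (K M : ℕ) [NeZero K] (hM : 1 ≤ M) (hMK : M ≤ K) (μ : Fin K → ℝ),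
        Function.Injective μ → (∀ k, 0 < μ k) →
        ∃ T₀ : ℕ, ∀ ν : Fin K → ProbabilityMeasure unitInterval,
          (∀ k, ∫ x : unitInterval, (x : ℝ) ∂(ν k : Measure unitInterval) = μ k) →
          ∀ T : ℕ, T₀ ≤ T → ∀ μ_1 μ_M μ_K α ε : ℝ,
            μ_1 = MPBandit.sortedMean μ ⟨0, by omega⟩ →
            μ_M = MPBandit.sortedMean μ ⟨M - 1, by omega⟩ →
            μ_K = MPBandit.sortedMean μ ⟨K - 1, by omega⟩ →
            α = μ_M / μ_1 →
            ε = (∑ i ∈ Finset.univ.filter fun i : Fin K => M ≤ i.val,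
                  (ENNReal.ofReal (μ_M - MPBandit.sortedMean μ i) /
                    MPBandit.kl (MPBandit.sortedMean μ i) μ_M).toReal) * Real.log T
                + C * (μ_1 / μ_K * (K : ℝ) ^ 3 * Real.log T) →
            MPBandit.IsNash ν T ε (fun _ : Fin M => MPBandit.selfishRobust K T) ∧
            MPBandit.IsStable ν T α ε (fun _ : Fin M => MPBandit.selfishRobust K T) := by
  open MPBandit in
  -- In units of (μ_(1)/μ_(K)) K³ log T, the initialization enters with 3 · 2200, once in the loss
  -- of a cooperative player and twice in the gain of the deviator. The approximation of the
  -- divergences and the lower-order terms take one unit each.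
  refine ⟨7000, by norm_num, fun K M _ hM hMK μ hμ hμ0 => ?_⟩
  by_cases hμ1 : ∀ k, μ k ≤ 1
  swap
  -- Laws on [0,1] have means at most 1, so here no law exists.
  · exact ⟨0, fun ν hν => absurd (fun k => mean_le_one (hν k)) hμ1⟩
  have hK1 : (1 : ℝ) ≤ K := by exact_mod_cast hM.trans hMK
  obtain ⟨b, hb⟩ := exists_place_eq μ (show 0 < K by omega)
  obtain ⟨e, he⟩ := exists_place_eq μ (show M - 1 < K by omega)
  obtain ⟨w, hw⟩ := exists_place_eq μ (show K - 1 < K by omega)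
  have hB : ∀ k, μ k ≤ μ b := fun k => place_le_imp (by omega)
  have hm : ∀ k, μ w ≤ μ k := fun k => place_le_imp (by have := place_lt μ k; omega)
  have hbpos := hμ0 b
  have hwpos := hμ0 w
  have hw1 := hμ1 w
  have he' : place μ e + 1 = M := by omega
  have hke : ∀ k ∉ topArms M μ, μ k < μ e := fun k hk =>
    lt_of_place_lt hμ (by rw [mem_topArms] at hk; omega)
  -- An error of μ_(1) in each of at most K exploration constants is harmless: K μ_(1) log T is
  -- absorbed by the cubic term.
  obtain ⟨δ, hδ, hδm, hgap, hkl⟩ := exists_gap hμ0 hμ1 (e := e) hbpos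
  set r : ℝ → ℝ := fun x => (ENNReal.ofReal (μ e - x) / kl x (μ e)).toReal with hr
  set R := Finset.univ.filter fun k => k ∉ topArms M μ with hR
  set S := ∑ k ∈ R, r (μ k) with hS
  -- All contributions that do not grow with `T`; together with the log log T terms they are
  -- eventually below one unit of log T.
  set c := 2 * (M * μ b) + 3 * (μ b * (M + statsFailureBound M μ δ)) +
    3 * (μ b * initFailure K M (μ w)) + K * μ b with hc
  have hd : 0 < μ b / μ w * (K : ℝ) ^ 3 := by positivity
  obtain ⟨T₀, hT₀⟩ := Filter.eventually_atTop.1 (eventually_loglog_le (S + K * μ b) c hd)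
  refine ⟨T₀, fun ν hν T hTT μ_1 μ_M μ_K α ε h1 hMe hKw hα hε => ?_⟩
  obtain ⟨hT, hlarge⟩ := hT₀ T hTT
  rw [sortedMean_eq hμ (k := b) hb] at h1
  rw [sortedMean_eq hμ (k := e) he] at hMe
  rw [sortedMean_eq hμ (k := w) hw] at hKw
  subst h1 hMe hKw
  have hsum : ∑ i ∈ Finset.univ.filter (fun i : Fin K => M ≤ i.val),
      (ENNReal.ofReal (μ e - sortedMean μ i) / kl (sortedMean μ i) (μ e)).toReal = S :=
    sum_sortedMean_ge hμ M r
  rw [hsum] at hε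
  have hlog : 0 < Real.log T := by linarith
  have hS0 : 0 ≤ S := Finset.sum_nonneg fun k _ => ENNReal.toReal_nonneg
  rw [hα]
  refine isNash_isStable_selfishRobust hν hM hMK hμ hδ hδm hB hwpos hm hgap he' hT ?_
    fun L₀ hL₀ => ?_
  · rw [hε]; positivity
  have hF : 0 ≤ explorationLevel T := by
    have := Real.log_nonneg hT
    unfold explorationLevel; linarith
  have hcard : (R.card : ℝ) ≤ K := by
    exact_mod_cast (Finset.card_filter_le _ _).trans (by simp)
  have hexp : ∑ k ∈ R, (μ e - μ k) *
      (explorationLevel T / klReal (μ k + δ) (μ e - 2 * δ) + 1) ≤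
      explorationLevel T * (S + K * μ b) + K * μ b := by
    calc _ ≤ ∑ k ∈ R, (explorationLevel T * (r (μ k) + μ b) + μ b) := by
          refine Finset.sum_le_sum fun k hk => ?_
          have h2 := hke k (Finset.mem_filter.1 hk).2
          have h3 := mul_le_mul_of_nonneg_left (hkl k h2) hF
          have h4 : (μ e - μ k) * (explorationLevel T / klReal (μ k + δ) (μ e - 2 * δ) + 1) =
              explorationLevel T * ((μ e - μ k) / klReal (μ k + δ) (μ e - 2 * δ)) +
                (μ e - μ k) := by ring
          rw [h4]
          have h5 := hB e
          have h6 := hμ0 k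
          linarith
      _ = explorationLevel T * (S + R.card * μ b) + R.card * μ b := by
          rw [Finset.sum_add_distrib, ← Finset.mul_sum, Finset.sum_add_distrib, Finset.sum_const,
            nsmul_eq_mul]
      _ ≤ _ := by gcongr
  have hKB : K * μ b * Real.log T ≤ μ b / μ w * (K : ℝ) ^ 3 * Real.log T := by
    refine mul_le_mul_of_nonneg_right ?_ hlog.le
    have h2 : (1 : ℝ) ≤ 1 / μ w := by rw [le_div_iff₀ hwpos]; linarith
    have h3 : (K : ℝ) ≤ (K : ℝ) ^ 3 := le_self_pow₀ hK1 (by norm_num)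
    calc K * μ b ≤ (K : ℝ) ^ 3 * (μ b * (1 / μ w)) := by
          gcongr
          exact le_mul_of_one_le_right hbpos.le h2
      _ = μ b / μ w * (K : ℝ) ^ 3 := by ring
  have hLB : μ b * L₀ ≤ 2200 * (μ b / μ w * (K : ℝ) ^ 3 * Real.log T) := by
    refine (mul_le_mul_of_nonneg_left hL₀ hbpos.le).trans (le_of_eq ?_)
    ring
  have hX0 : 0 ≤ μ b / μ w * (K : ℝ) ^ 3 * Real.log T := by positivity
  have hFS : explorationLevel T * (S + K * μ b) =
      S * Real.log T + K * μ b * Real.log T + 4 * Real.log (Real.log T) * (S + K * μ b) := by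
    unfold explorationLevel; ring
  rw [hε, lowerLoss, upperGain]
  rw [hc] at hlarge
  linarith
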